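/- Let $n\ge 1$ be an integer and $c>0$. **Notation.** Let $\mathcal F(\mathbb R^n)$ be the set of lower semicontinuous convex functions $f:\mathbb R^n\to\mathbb R\cup\{+\infty\}$ that are finite at some point, and let $f^*(y)=\sup_{x}\{x\cdot y-f(x)\}$. One says that $\mathrm{IS}_n(c)$ holds if $$\int_{\mathbb R^n} e^{-f}\,dx\int_{\mathbb R^n} e^{-f^*}\,dx\ \ge\ c^n$$ for every $f\in\mathcal F(\mathbb R^n)$ with $\int e^{-f}\,dx>0$ and $\int e^{-f^*}\,dx>0$ (the integrals may be $+\infty$); $\mathrm{IS}_{n,s}(c)$ (resp. $\mathrm{IS}_{n,u}(c)$) is the same requirement for those $f$ which moreover are symmetric, $f(-x)=f(x)$ (resp. unconditional, $f(\varepsilon_1x_1,\dots,\varepsilon_nx_n)=f(x)$ for all $\varepsilon\in\{-1,1\}^n$). Let $\mathcal P_2(\mathbb R^n)$ be the set of Borel probability measures on $\mathbb R^n$ with finite second moment, and $\mathcal P_{s,2}(\mathbb R^n)$ (resp. $\mathcal P_{u,2}(\mathbb R^n)$) the subset of those invariant under $x\mapsto -x$ (resp. under $x\mapsto(\varepsilon_1x_1,\dots,\varepsilon_nx_n)$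 for all $\varepsilon\in\{-1,1\}^n$). Let $\gamma_n$ be the standard Gaussian measure, $H(\nu|\gamma_n)=\int h\log h\,d\gamma_n\in[0,+\infty]$ if $d\nu=h\,d\gamma_n$ and $H(\nu|\gamma_n)=+\infty$ if $\nu$ is not absolutely continuous with respect to $\gamma_n$, let $W_2^2(\nu_1,\nu_2)=\inf_\pi\int|x-y|^2\,\pi(dx\,dy)$ over all couplings $\pi$ of $\nu_1$ and $\nu_2$, and for $\nu_1,\nu_2\in\mathcal P_2(\mathbb R^n)$ put $$\mathcal G(\nu_1,\nu_2)=H(\nu_1|\gamma_n)+H(\nu_2|\gamma_n)-\tfrac12W_2^2(\nu_1,\nu_2)\in\mathbb R\cup\{+\infty\}.$$ **Theorem.** $\mathrm{IS}_n(c)$ holds if and only if for all $\nu_1,\nu_2\in\mathcal P_2(\mathbb R^n)$ $$\mathcal G(\nu_1,\nu_2)\ \ge\ \inf_{\eta_1\in\mathcal P_2(\mathbb R^n)}\mathcal G(\eta_1,\nu_2)+\inf_{\eta_2\in\mathcal P_2(\mathbb R^n)}\mathcal G(\nu_1,\eta_2)+n\log\frac{c}{2\pi}.\qquad(1)$$ Likewise,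 $\mathrm{IS}_{n,s}(c)$ holds if and only if (1), with $\mathcal P_2(\mathbb R^n)$ replaced by $\mathcal P_{s,2}(\mathbb R^n)$ in both infima, holds for all $\nu_1,\nu_2\in\mathcal P_{s,2}(\mathbb R^n)$; and $\mathrm{IS}_{n,u}(c)$ holds if and only if (1), with $\mathcal P_2(\mathbb R^n)$ replaced by $\mathcal P_{u,2}(\mathbb R^n)$ in both infima, holds for all $\nu_1,\nu_2\in\mathcal P_{u,2}(\mathbb R^n)$. (The infima may be $\pm\infty$; a sum $+\infty+(-\infty)$ on the right of (1) can occur only when $\mathcal G(\nu_1,\nu_2)=+\infty$, in which case (1) is regarded as true.) -/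

import Mathlib

open MeasureTheory
open scoped ENNReal

namespace InvSantalo

noncomputable section

/-! ### Convex functions with values in `ℝ ∪ {+∞}` and inverse Santaló inequalities -/

/-- The set `𝓕(ℝⁿ)` of lower semicontinuous convex functions `ℝⁿ → ℝ ∪ {+∞}` which are finite at
some point. They are encoded as `EReal`-valued functions that never take the value `-∞`; with the
`EReal` convention `0 * ⊤ = 0` the convexity inequality is the usual one, end points included. -/
def convexFun (n : ℕ) : Set (EuclideanSpace ℝ (Fin n) → EReal) :=
  {f | LowerSemicontinuous f ∧ (∀ x, f x ≠ ⊥) ∧ (∃ x, f x ≠ ⊤) ∧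
    ∀ x y : EuclideanSpace ℝ (Fin n), ∀ a b : ℝ, 0 ≤ a → 0 ≤ b → a + b = 1 →
      f (a • x + b • y) ≤ (a : EReal) * f x + (b : EReal) * f y}

/-- The coordinate sign change `x ↦ (ε₁ x₁, …, εₙ xₙ)`, `ε ∈ {-1, 1}ⁿ`. -/
def signFlip {n : ℕ} (ε : Fin n → ℤˣ) (x : EuclideanSpace ℝ (Fin n)) :
    EuclideanSpace ℝ (Fin n) :=
  WithLp.toLp 2 (fun i => (((ε i : ℤˣ) : ℤ) : ℝ) * x i)

/-- The symmetric (even) elements of `𝓕(ℝⁿ)`. -/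
def symmConvexFun (n : ℕ) : Set (EuclideanSpace ℝ (Fin n) → EReal) :=
  {f | f ∈ convexFun n ∧ ∀ x, f (-x) = f x}

/-- The unconditional elements of `𝓕(ℝⁿ)`. -/
def uncondConvexFun (n : ℕ) : Set (EuclideanSpace ℝ (Fin n) → EReal) :=
  {f | f ∈ convexFun n ∧ ∀ (ε : Fin n → ℤˣ) (x), f (signFlip ε x) = f x}

/-- The Fenchel-Legendre transform `f*(y) = sup_x (x ⬝ y - f x)`. -/
def legendre {n : ℕ} (f : EuclideanSpace ℝ (Fin n) → EReal) (y : EuclideanSpace ℝ (Fin n)) :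
    EReal :=
  ⨆ x : EuclideanSpace ℝ (Fin n), ((inner ℝ x y : ℝ) : EReal) - f x

/-- The integral `∫ e^{-f} dx ∈ [0, +∞]` with respect to Lebesgue measure. -/
def intExpNeg {n : ℕ} (f : EuclideanSpace ℝ (Fin n) → EReal) : ℝ≥0∞ :=
  ∫⁻ x, EReal.exp (-f x)

/-- The functional inverse Santaló inequality with constant `c` for all functions of a class `A`. -/
def InvSantaloOn {n : ℕ} (A : Set (EuclideanSpace ℝ (Fin n) → EReal)) (c : ℝ) : Prop :=
  ∀ f ∈ A, 0 < intExpNeg f → 0 < intExpNeg (legendre f) →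
    ENNReal.ofReal (c ^ n) ≤ intExpNeg f * intExpNeg (legendre f)

/-- The functional inverse Santaló inequality `IS_n(c)`. -/
def IS (n : ℕ) (c : ℝ) : Prop := InvSantaloOn (convexFun n) c

/-- The symmetric functional inverse Santaló inequality `IS_{n,s}(c)`. -/
def ISsymm (n : ℕ) (c : ℝ) : Prop := InvSantaloOn (symmConvexFun n) c

/-- The unconditional functional inverse Santaló inequality `IS_{n,u}(c)`. -/
def ISuncond (n : ℕ) (c : ℝ) : Prop := InvSantaloOn (uncondConvexFun n) c

/-! ### Probability measures, transport distance, entropy -/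

/-- `𝓟₂(ℝⁿ)`: Borel probability measures with finite second moment. -/
def P2 (n : ℕ) : Set (Measure (EuclideanSpace ℝ (Fin n))) :=
  {ν | IsProbabilityMeasure ν ∧ ∫⁻ x, ‖x‖ₑ ^ 2 ∂ν < ∞}

/-- `𝓟_{s,2}(ℝⁿ)`: the symmetric elements of `𝓟₂(ℝⁿ)`. -/
def P2symm (n : ℕ) : Set (Measure (EuclideanSpace ℝ (Fin n))) :=
  {ν | ν ∈ P2 n ∧ ν.map (fun x => -x) = ν}

/-- `𝓟_{u,2}(ℝⁿ)`: the unconditional elements of `𝓟₂(ℝⁿ)`. -/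
def P2uncond (n : ℕ) : Set (Measure (EuclideanSpace ℝ (Fin n))) :=
  {ν | ν ∈ P2 n ∧ ∀ ε : Fin n → ℤˣ, ν.map (signFlip ε) = ν}

/-- Transport plans between `ν₁` and `ν₂`. -/
def transportPlans {n : ℕ} (ν₁ ν₂ : Measure (EuclideanSpace ℝ (Fin n))) :
    Set (Measure (EuclideanSpace ℝ (Fin n) × EuclideanSpace ℝ (Fin n))) :=
  {π | IsProbabilityMeasure π ∧ π.fst = ν₁ ∧ π.snd = ν₂}

/-- The squared Kantorovich (Wasserstein) distance `W₂²(ν₁, ν₂)`. -/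
def W2sq {n : ℕ} (ν₁ ν₂ : Measure (EuclideanSpace ℝ (Fin n))) : ℝ≥0∞ :=
  ⨅ π ∈ transportPlans ν₁ ν₂, ∫⁻ p, ‖p.1 - p.2‖ₑ ^ 2 ∂π

/-- The relative entropy `H(ν | γ_n)` with respect to the standard Gaussian measure; it is `+∞`
when `ν` is not absolutely continuous or when `∫ h log h dγ_n = +∞`. -/
def gaussEntropy {n : ℕ} (ν : Measure (EuclideanSpace ℝ (Fin n))) : ℝ≥0∞ :=
  InformationTheory.klDiv ν (ProbabilityTheory.stdGaussian (EuclideanSpace ℝ (Fin n)))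

/-- `𝓖(ν₁, ν₂) = H(ν₁ | γ_n) + H(ν₂ | γ_n) - W₂²(ν₁, ν₂) / 2`. On `𝓟₂(ℝⁿ)` the transport term is
finite, so that the difference makes sense in `ℝ ∪ {+∞}`. -/
def G {n : ℕ} (ν₁ ν₂ : Measure (EuclideanSpace ℝ (Fin n))) : EReal :=
  (gaussEntropy ν₁ : EReal) + (gaussEntropy ν₂ : EReal)
    - ((1 / 2 : ℝ) : EReal) * (W2sq ν₁ ν₂ : EReal)

end

end InvSantalo

/-! Two dual formulas connect the functional and the transport side. By Kantorovich duality, `W₂²/2`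
is the supremum of `∫ φ dν₁ + ∫ ψ dν₂` over potentials with `φ(x) + ψ(y) ≤ |x - y|²/2`; replacing
each potential by `|x|²/2` minus itself turns the constraint into `⟨x, y⟩ ≤ g(x) + g'(y)`, the
relation between a function and its Legendre transform. By Donsker–Varadhan, `H(η|γ) ≥ ∫ (|x|²/2 -
g) dη - log ∫ e^{-g} + (n/2) log 2π`, with equality at the Gibbs measure of `g`.

From functions to measures: nearly optimal potentials for `(ν₁, ν₂)` are improved to a conjugate
pair `f, f*`. Testing the two infima at the Gibbs measures of `f*` and `f` bounds their sum by
`H(ν₁|γ) + H(ν₂|γ) - W₂²/2 - log(∫ e^{-f} ∫ e^{-f*}) + n log 2π`, up to a small error, and the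
inverse Santaló inequality bounds the logarithm (`transport_entropy_of_invSantaloOn`).

From measures to functions: for convex `F` of quadratic growth, (1) is applied to the moment
measures of `F` and `F*`, the images of their Gibbs measures under the gradients. The moment measure
of `F` makes `F` extremal: `log ∫ e^{-g} - log ∫ e^{-F} ≤ ∫ (φ - F*)(∇F) e^{-F} / ∫ e^{-F}` whenever
`⟨x, y⟩ ≤ g(x) + φ(y)`. This is the derivative at `t = 0` of Prékopa–Leindler along `(1 - t) F* + t
φ` (`log_integral_sub_le_integral_gradDefect`). With Donsker–Varadhan it bounds both infima from
below, while weak duality with the potentials of `F*` and `F**` bounds `𝓖(ν₁, ν₂)` from above; the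
entropies cancel and the inequality for `F` remains (`nice_inverse_santalo`). Small Gaussian noise
keeps these entropies finite. A general `f` is reached through Moreau envelopes plus `a|x|²`.

The three assertions are one: everything is done for functions and measures invariant under a
subgroup of `{-1, 1}ⁿ`, which is then taken to be trivial, `{1, -1}`, or everything. -/

namespace InvSantalo

/-! ### The Prékopa–Leindler inequality -/

section PrekopaLeindler

/-- The one-dimensional Brunn–Minkowski inequality with weights. -/
theorem brunn_minkowski_real {a b : ℝ} (ha : 0 < a) (hb : 0 < b) {A B C : Set ℝ}
    (hA : MeasurableSet A) (hB : MeasurableSet B) (hA0 : A.Nonempty) (hB0 : B.Nonempty)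
    (hC : ∀ x ∈ A, ∀ y ∈ B, a * x + b * y ∈ C) :
    ENNReal.ofReal a * volume A + ENNReal.ofReal b * volume B ≤ volume C := by
  have key : ∀ K ⊆ A, IsCompact K → K.Nonempty → ∀ L ⊆ B, IsCompact L → L.Nonempty →
      ENNReal.ofReal a * volume K + ENNReal.ofReal b * volume L ≤ volume C := by
    intro K hKA hK hK0 L hLB hL hL0
    -- The two affine copies `aK + b min L` and `a max K + bL` lie in `C`, on either side of `a k +
    -- b l`, so they overlap at most in that point.
    obtain ⟨k, hk, hkm⟩ := hK.exists_isGreatest hK0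
    obtain ⟨l, hl, hlm⟩ := hL.exists_isLeast hL0
    set S : Set ℝ := (fun x => a * x + b * l) '' K with hS
    set T : Set ℝ := (fun y => a * k + b * y) '' L with hT
    have hSc : IsCompact S := hK.image (by fun_prop)
    have hTc : IsCompact T := hL.image (by fun_prop)
    have vS : volume S = ENNReal.ofReal a * volume K := by
      have : S = (fun x => x + b * l) '' ((fun x => a * x) '' K) := by
        rw [hS, Set.image_image]
      rw [this, Set.image_add_right, measure_preimage_add_right]
      have h2 := Measure.addHaar_smul (volume : Measure ℝ) a K
      rwa [Module.finrank_self, pow_one, abs_of_pos ha] at h2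
    have vT : volume T = ENNReal.ofReal b * volume L := by
      have : T = (fun x => a * k + x) '' ((fun x => b * x) '' L) := by
        rw [hT, Set.image_image]
      rw [this, Set.image_add_left, measure_preimage_add]
      have h2 := Measure.addHaar_smul (volume : Measure ℝ) b L
      rwa [Module.finrank_self, pow_one, abs_of_pos hb] at h2
    have hST : AEDisjoint volume S T := by
      refine measure_mono_null (t := {a * k + b * l}) ?_ (by simp)
      rintro z ⟨⟨x, hx, rfl⟩, ⟨y, hy, hxy⟩⟩
      have h1 := hkm hx
      have h2 := hlm hy
      simp only [Set.mem_singleton_iff] at *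
      have := mul_le_mul_of_nonneg_left h1 ha.le
      have := mul_le_mul_of_nonneg_left h2 hb.le
      linarith
    rw [← vS, ← vT, ← measure_union₀ hTc.measurableSet.nullMeasurableSet hST]
    refine measure_mono (Set.union_subset ?_ ?_)
    · rintro _ ⟨x, hx, rfl⟩; exact hC x (hKA hx) l (hLB hl)
    · rintro _ ⟨y, hy, rfl⟩; exact hC k (hKA hk) y (hLB hy)
  have reg : ∀ {D : Set ℝ}, MeasurableSet D → D.Nonempty →
      volume D ≤ ⨆ K : {K : Set ℝ // K ⊆ D ∧ IsCompact K ∧ K.Nonempty}, volume K.1 := by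
    rintro D hD ⟨x, hx⟩
    rw [hD.measure_eq_iSup_isCompact]
    refine iSup_le fun K => iSup_le fun hKD => iSup_le fun hK => ?_
    exact (measure_mono (Set.subset_insert x K)).trans (le_iSup_of_le (ι := {K : Set ℝ // K ⊆ D ∧
      IsCompact K ∧ K.Nonempty}) ⟨insert x K, Set.insert_subset hx hKD, hK.insert x,
      Set.insert_nonempty _ _⟩ le_rfl)
  have ne : ∀ {D : Set ℝ}, D.Nonempty →
      Nonempty {K : Set ℝ // K ⊆ D ∧ IsCompact K ∧ K.Nonempty} := by
    rintro D ⟨x, hx⟩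
    exact ⟨{x}, by simpa using hx, isCompact_singleton, by simp⟩
  have := ne hA0
  have := ne hB0
  calc _ ≤ ENNReal.ofReal a * (⨆ K : {K : Set ℝ // K ⊆ A ∧ IsCompact K ∧ K.Nonempty}, volume K.1) +
        ENNReal.ofReal b * (⨆ K : {K : Set ℝ // K ⊆ B ∧ IsCompact K ∧ K.Nonempty}, volume K.1) := by
          gcongr
          exacts [reg hA hA0, reg hB hB0]
    _ ≤ volume C := by
      simp only [ENNReal.mul_iSup]
      exact ENNReal.iSup_add_iSup_le fun K L => key K.1 K.2.1 K.2.2.1 K.2.2.2 L.1 L.2.1 L.2.2.1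
        L.2.2.2

/-- Weighted arithmetic-geometric mean inequality in `[0, ∞]`. -/
theorem rpow_mul_rpow_le_add {t : ℝ} (h0 : 0 < t) (h1 : t < 1) (x y : ℝ≥0∞) :
    x ^ (1 - t) * y ^ t ≤ ENNReal.ofReal (1 - t) * x + ENNReal.ofReal t * y := by
  have h1' : 0 < 1 - t := by linarith
  rcases eq_or_ne x ∞ with rfl | hx
  · rw [ENNReal.mul_top (by simpa using h1)]; simp
  rcases eq_or_ne y ∞ with rfl | hy
  · rw [ENNReal.mul_top (a := ENNReal.ofReal t) (by simpa using h0)]; simp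
  lift x to NNReal using hx
  lift y to NNReal using hy
  rw [← ENNReal.coe_rpow_of_nonneg _ h1'.le, ← ENNReal.coe_rpow_of_nonneg _ h0.le, ENNReal.ofReal,
    ENNReal.ofReal]
  norm_cast
  have := NNReal.geom_mean_le_arith_mean2_weighted (1 - t).toNNReal t.toNNReal x y (by
    rw [← Real.toNNReal_add h1'.le h0.le]; simp)
  simpa [h1'.le, h0.le] using this

/-- The Prékopa–Leindler inequality for functions with supremum one, in additive form. -/
theorem prekopa_leindler_real_of_sup_one {t : ℝ} (h0 : 0 < t) (h1 : t < 1) {f g h : ℝ → ℝ}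
    (hf : Measurable f) (hg : Measurable g) (hh : Measurable h)
    (f0 : ∀ x, 0 ≤ f x) (g0 : ∀ x, 0 ≤ g x) (hh0 : ∀ x, 0 ≤ h x)
    (f1 : ∀ x, f x ≤ 1) (g1 : ∀ x, g x ≤ 1)
    (fs : ∀ s < 1, ∃ x, s < f x) (gs : ∀ s < 1, ∃ x, s < g x)
    (H : ∀ s, 0 < s → ∀ x y, s < f x → s < g y → s < h ((1 - t) * x + t * y)) :
    ENNReal.ofReal (1 - t) * (∫⁻ x, ENNReal.ofReal (f x)) +
      ENNReal.ofReal t * (∫⁻ x, ENNReal.ofReal (g x)) ≤ ∫⁻ x, ENNReal.ofReal (h x) := by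
  have lc : ∀ {u : ℝ → ℝ}, Measurable u → (∀ x, 0 ≤ u x) →
      ∫⁻ x, ENNReal.ofReal (u x) = ∫⁻ s in Set.Ioi (0 : ℝ), volume {x | s < u x} :=
    fun hu u0 => lintegral_eq_lintegral_meas_lt _ (.of_forall u0) hu.aemeasurable
  have hm : ∀ u : ℝ → ℝ, Measurable fun s => volume {x | s < u x} := fun u =>
    (show Antitone fun s => volume {x | s < u x} from
      fun s s' hs => measure_mono fun x hx => lt_of_le_of_lt hs hx).measurable
  rw [lc hf f0, lc hg g0, lc hh hh0, ← lintegral_const_mul _ (hm f),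
    ← lintegral_const_mul _ (hm g), ← lintegral_add_left ((hm f).const_mul _)]
  refine setLIntegral_mono (hm h) fun s hs => ?_
  -- Below level `1` both superlevel sets are nonempty, as Brunn–Minkowski requires; from level `1`
  -- on both are empty.
  rcases lt_or_ge s 1 with hs1 | hs1
  · exact brunn_minkowski_real (by linarith) h0 (measurableSet_lt measurable_const hf)
      (measurableSet_lt measurable_const hg) (fs s hs1) (gs s hs1)
      (fun x hx y hy => H s hs x y hx hy)
  · have e1 : {x | s < f x} = ∅ := by
      ext x; simpa using (f1 x).trans hs1
    have e2 : {x | s < g x} = ∅ := by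
      ext x; simpa using (g1 x).trans hs1
    simp [e1, e2]

/-- The Prékopa–Leindler property, with parameter `t`, of a measured vector space. -/
def PrekopaLeindler (t : ℝ) (E : Type*) [AddCommGroup E] [Module ℝ E] [MeasureSpace E] : Prop :=
  ∀ f g h : E → ℝ≥0∞, Measurable f → Measurable g → Measurable h →
    (∀ x y, f x ^ (1 - t) * g y ^ t ≤ h ((1 - t) • x + t • y)) →
    (∫⁻ x, f x) ^ (1 - t) * (∫⁻ x, g x) ^ t ≤ ∫⁻ x, h x

/-- Division of `f` and `g` by their suprema reduces to the additive inequality, whose left side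
dominates the geometric mean; homogeneity then restores the factor `c`. Truncating `h / c` at `1`
keeps it finite and is harmless because the normalized `f` and `g` are at most `1`. -/
theorem prekopaLeindler_real_of_bounded {t : ℝ} (h0 : 0 < t) (h1 : t < 1) {f g h : ℝ → ℝ≥0∞}
    (hf : Measurable f) (hg : Measurable g) (hh : Measurable h)
    {N : ℝ≥0∞} (hN : N ≠ ∞) (hfN : ∀ x, f x ≤ N) (hgN : ∀ x, g x ≤ N)
    (H : ∀ x y, f x ^ (1 - t) * g y ^ t ≤ h ((1 - t) • x + t • y)) :
    (∫⁻ x, f x) ^ (1 - t) * (∫⁻ x, g x) ^ t ≤ ∫⁻ x, h x := by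
  have h1' : 0 < 1 - t := by linarith
  set a := ⨆ x, f x with ha
  set b := ⨆ x, g x with hb
  have haT : a ≠ ∞ := ne_top_of_le_ne_top hN (iSup_le hfN)
  have hbT : b ≠ ∞ := ne_top_of_le_ne_top hN (iSup_le hgN)
  rcases eq_or_ne a 0 with ha0 | ha0
  · have : ∀ x, f x = 0 := by simpa [ha] using ha0
    simp [this, h1']
  rcases eq_or_ne b 0 with hb0 | hb0
  · have : ∀ x, g x = 0 := by simpa [hb] using hb0
    simp [this, h0]
  set c := a ^ (1 - t) * b ^ t with hc
  have hc0 : c ≠ 0 := mul_ne_zero (by simp [ENNReal.rpow_eq_zero_iff, ha0, haT])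
    (by simp [ENNReal.rpow_eq_zero_iff, hb0, hbT])
  have hcT : c ≠ ∞ := ENNReal.mul_ne_top (ENNReal.rpow_ne_top_of_nonneg h1'.le haT)
    (ENNReal.rpow_ne_top_of_nonneg h0.le hbT)
  have fa : ∀ x, f x / a ≤ 1 := fun x => ENNReal.div_le_of_le_mul (by simpa using le_iSup f x)
  have gb : ∀ x, g x / b ≤ 1 := fun x => ENNReal.div_le_of_le_mul (by simpa using le_iSup g x)
  have faT : ∀ x, f x / a ≠ ∞ := fun x => ne_top_of_le_ne_top ENNReal.one_ne_top (fa x)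
  have gbT : ∀ x, g x / b ≠ ∞ := fun x => ne_top_of_le_ne_top ENNReal.one_ne_top (gb x)
  have hcm : ∀ x, min (h x / c) 1 ≠ ∞ := fun x =>
    ne_top_of_le_ne_top ENNReal.one_ne_top (min_le_right _ _)
  have main := prekopa_leindler_real_of_sup_one h0 h1 (f := fun x => (f x / a).toReal)
    (g := fun x => (g x / b).toReal) (h := fun x => (min (h x / c) 1).toReal)
    (by fun_prop) (by fun_prop) (by fun_prop)
    (fun _ => ENNReal.toReal_nonneg) (fun _ => ENNReal.toReal_nonneg)
    (fun _ => ENNReal.toReal_nonneg)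
    (fun x => by simpa using ENNReal.toReal_mono ENNReal.one_ne_top (fa x))
    (fun x => by simpa using ENNReal.toReal_mono ENNReal.one_ne_top (gb x))
    (by
      intro s hs
      by_contra! hcon
      have h2 : ∀ x, f x ≤ ENNReal.ofReal s * a := fun x => by
        have := hcon x
        rw [← ENNReal.div_le_iff ha0 haT]
        exact ENNReal.le_ofReal_iff_toReal_le (faT x) (ENNReal.toReal_nonneg.trans this) |>.2 this
      have h3 : a ≤ ENNReal.ofReal s * a := iSup_le h2
      have h4 : ENNReal.ofReal s * a < 1 * a :=
        ENNReal.mul_lt_mul_left ha0 haT (by simpa using hs)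
      rw [one_mul] at h4
      exact absurd h3 (not_le.2 h4))
    (by
      intro s hs
      by_contra! hcon
      have h2 : ∀ x, g x ≤ ENNReal.ofReal s * b := fun x => by
        have := hcon x
        rw [← ENNReal.div_le_iff hb0 hbT]
        exact ENNReal.le_ofReal_iff_toReal_le (gbT x) (ENNReal.toReal_nonneg.trans this) |>.2 this
      have h3 : b ≤ ENNReal.ofReal s * b := iSup_le h2
      have h4 : ENNReal.ofReal s * b < 1 * b :=
        ENNReal.mul_lt_mul_left hb0 hbT (by simpa using hs)
      rw [one_mul] at h4
      exact absurd h3 (not_le.2 h4))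
    (by
      intro s hs x y hx hy
      have hx' : ENNReal.ofReal s < f x / a := (ENNReal.ofReal_lt_iff_lt_toReal hs.le (faT x)).2 hx
      have hy' : ENNReal.ofReal s < g y / b := (ENNReal.ofReal_lt_iff_lt_toReal hs.le (gbT y)).2 hy
      rw [← ENNReal.ofReal_lt_iff_lt_toReal hs.le (hcm _)]
      refine lt_min ?_ (hx'.trans_le (fa x))
      have e1 : ENNReal.ofReal s = ENNReal.ofReal s ^ (1 - t) * ENNReal.ofReal s ^ t := by
        rw [← ENNReal.rpow_add _ _ (by simpa using hs) (by simp)]; simp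
      have e2 : (f x / a) ^ (1 - t) * (g y / b) ^ t = (f x ^ (1 - t) * g y ^ t) / c := by
        rw [ENNReal.div_rpow_of_nonneg _ _ h1'.le, ENNReal.div_rpow_of_nonneg _ _ h0.le, hc,
          ENNReal.mul_div_mul_comm (Or.inr (ENNReal.rpow_ne_top_of_nonneg h0.le hbT))
            (Or.inl (ENNReal.rpow_ne_top_of_nonneg h1'.le haT))]
      calc ENNReal.ofReal s = ENNReal.ofReal s ^ (1 - t) * ENNReal.ofReal s ^ t := e1
        _ < (f x / a) ^ (1 - t) * (g y / b) ^ t :=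
          ENNReal.mul_lt_mul (ENNReal.rpow_lt_rpow hx' h1') (ENNReal.rpow_lt_rpow hy' h0)
        _ = (f x ^ (1 - t) * g y ^ t) / c := e2
        _ ≤ _ := ENNReal.div_le_div_right (by simpa using H x y) c)
  simp only [ENNReal.ofReal_toReal (faT _), ENNReal.ofReal_toReal (gbT _),
    ENNReal.ofReal_toReal (hcm _)] at main
  have hfin := (rpow_mul_rpow_le_add h0 h1 _ _).trans main
  simp only [ENNReal.div_eq_inv_mul] at hfin
  rw [lintegral_const_mul _ hf, lintegral_const_mul _ hg, ENNReal.mul_rpow_of_nonneg _ _ h1'.le,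
    ENNReal.mul_rpow_of_nonneg _ _ h0.le, mul_mul_mul_comm, ENNReal.inv_rpow, ENNReal.inv_rpow,
    ← ENNReal.mul_inv (Or.inr (ENNReal.rpow_ne_top_of_nonneg h0.le hbT))
            (Or.inl (ENNReal.rpow_ne_top_of_nonneg h1'.le haT)), ← hc] at hfin
  have h5 : ∫⁻ x, min (c⁻¹ * h x) 1 ≤ c⁻¹ * ∫⁻ x, h x := by
    rw [← lintegral_const_mul _ hh]; exact lintegral_mono fun x => min_le_left _ _
  have h6 : c * _ ≤ c * _ := mul_le_mul_right (hfin.trans h5) c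
  rwa [← mul_assoc, ENNReal.mul_inv_cancel hc0 hcT, one_mul, ← mul_assoc, ENNReal.mul_inv_cancel hc0 hcT, one_mul] at h6

/-- Truncation at height `N` and monotone convergence remove boundedness; vanishing integrals are
treated apart because multiplication on `[0, ∞]` is not continuous at `(0, ∞)`. -/
theorem prekopaLeindler_real {t : ℝ} (h0 : 0 < t) (h1 : t < 1) : PrekopaLeindler t ℝ := by
  intro f g h hf hg hh H
  have h1' : 0 < 1 - t := by linarith
  have lim : ∀ {u : ℝ → ℝ≥0∞}, Measurable u → Filter.Tendsto (fun N : ℕ => ∫⁻ x, min (u x) N)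
      Filter.atTop (nhds (∫⁻ x, u x)) := by
    intro u hu
    refine lintegral_tendsto_of_tendsto_of_monotone (fun N => (by fun_prop)) ?_ ?_
    · exact .of_forall fun x N M hNM => min_le_min le_rfl (by exact_mod_cast hNM)
    · refine .of_forall fun x => ?_
      have : Filter.Tendsto (fun N : ℕ => min (u x) (N : ℝ≥0∞)) Filter.atTop
        (nhds (min (u x) ⊤)) := tendsto_const_nhds.min ENNReal.tendsto_nat_nhds_top
      simpa using this
  have key : ∀ N : ℕ, (∫⁻ x, min (f x) N) ^ (1 - t) * (∫⁻ x, min (g x) N) ^ t ≤ ∫⁻ x, h x :=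
    fun N => prekopaLeindler_real_of_bounded h0 h1 (by fun_prop) (by fun_prop) hh
      (ENNReal.natCast_ne_top N) (fun x => min_le_right _ _) (fun x => min_le_right _ _)
      fun x y => le_trans (by gcongr <;> exact min_le_left _ _) (H x y)
  have key2 : ∀ N M : ℕ, (∫⁻ x, min (f x) N) ^ (1 - t) * (∫⁻ x, min (g x) M) ^ t ≤ ∫⁻ x, h x :=
    fun N M => le_trans (by gcongr; exacts [le_max_left N M, le_max_right N M]) (key (max N M))
  rcases eq_or_ne (∫⁻ x, f x) 0 with hf0 | hf0
  · simp [hf0, h1']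
  rcases eq_or_ne (∫⁻ x, g x) 0 with hg0 | hg0
  · simp [hg0, h0]
  refine le_of_tendsto (ENNReal.Tendsto.mul (((ENNReal.continuous_rpow_const (y := 1 - t)).tendsto _).comp (lim hf))
    (Or.inl ?_) (((ENNReal.continuous_rpow_const (y := t)).tendsto _).comp (lim hg)) (Or.inl ?_)) (.of_forall key)
  · simp [ENNReal.rpow_eq_zero_iff, hf0, not_lt.2 h1'.le]
  · simp [ENNReal.rpow_eq_zero_iff, hg0, not_lt.2 h0.le]

/-- By Tonelli: the inequality on the fibres `F` is exactly the hypothesis on `E` for the partial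
integrals. -/
theorem PrekopaLeindler.prod {t : ℝ} {E F : Type*} [AddCommGroup E] [Module ℝ E] [MeasureSpace E]
    [AddCommGroup F] [Module ℝ F] [MeasureSpace F] [SFinite (volume : Measure E)]
    [SFinite (volume : Measure F)]  [MeasurableAdd₂ F] [MeasurableConstSMul ℝ F]
    (hE : PrekopaLeindler t E) (hF : PrekopaLeindler t F) : PrekopaLeindler t (E × F) := by
  intro f g h hf hg hh H
  simp only [Measure.volume_eq_prod]
  rw [lintegral_prod _ hf.aemeasurable, lintegral_prod _ hg.aemeasurable,
    lintegral_prod _ hh.aemeasurable]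
  refine hE _ _ _ hf.lintegral_prod_right' hg.lintegral_prod_right' hh.lintegral_prod_right' ?_
  intro x y
  exact hF _ _ _ (hf.comp measurable_prodMk_left) (hg.comp measurable_prodMk_left)
    (hh.comp measurable_prodMk_left) fun u v => H (x, u) (y, v)

theorem PrekopaLeindler.of_measurePreserving {t : ℝ} {E F : Type*} [AddCommGroup E] [Module ℝ E]
    [MeasureSpace E] [AddCommGroup F] [Module ℝ F] [MeasureSpace F] (hE : PrekopaLeindler t E)
    (e : E ≃ᵐ F) (he : MeasurePreserving e) (hl : ∀ a b : ℝ, ∀ x y, e (a • x + b • y) =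
      a • e x + b • e y) : PrekopaLeindler t F := by
  intro f g h hf hg hh H
  rw [← he.lintegral_comp hf, ← he.lintegral_comp hg, ← he.lintegral_comp hh]
  exact hE _ _ _ (hf.comp e.measurable) (hg.comp e.measurable) (hh.comp e.measurable)
    fun x y => by rw [hl]; exact H _ _

theorem prekopaLeindler_pi {t : ℝ} (h0 : 0 < t) (h1 : t < 1) (n : ℕ) :
    PrekopaLeindler t (Fin n → ℝ) := by
  induction n with
  | zero =>
    intro f g h hf hg hh H
    have : (volume : Measure (Fin 0 → ℝ)) = Measure.dirac 0 := by
      rw [volume_pi]; exact Measure.pi_of_empty _ _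
    rw [this, lintegral_dirac, lintegral_dirac, lintegral_dirac]
    simpa using H 0 0
  | succ n ih =>
    refine ((prekopaLeindler_real h0 h1).prod ih).of_measurePreserving
      (MeasurableEquiv.piFinSuccAbove (fun _ => ℝ) 0).symm
      (volume_preserving_piFinSuccAbove (fun _ => ℝ) 0).symm ?_
    intro a b x y
    ext i
    refine Fin.cases ?_ (fun j => ?_) i <;> simp [MeasurableEquiv.piFinSuccAbove, Fin.insertNthEquiv]

/-- The Prékopa–Leindler inequality on `ℝⁿ`. -/
theorem prekopaLeindler_euclideanSpace {t : ℝ} (h0 : 0 < t) (h1 : t < 1) (n : ℕ) :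
    PrekopaLeindler t (EuclideanSpace ℝ (Fin n)) :=
  (prekopaLeindler_pi h0 h1 n).of_measurePreserving (MeasurableEquiv.toLp 2 (Fin n → ℝ))
    (EuclideanSpace.volume_preserving_symm_measurableEquiv_toLp (Fin n)).symm
    fun a b x y => by ext i; simp

end PrekopaLeindler

end InvSantalo

namespace InvSantalo

open scoped Pointwise

/-! ### The dual Kantorovich problem as a sublinear functional -/

section Kantorovich

/-- A sublinear functional admits a linear minorant that touches it at a given vector. -/
theorem exists_linear_le_sublinear_eq {V : Type*} [AddCommGroup V] [Module ℝ V] (p : V → ℝ)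
    (hsmul : ∀ c : ℝ, 0 < c → ∀ x, p (c • x) = c * p x) (hadd : ∀ x y, p (x + y) ≤ p x + p y)
    (v : V) : ∃ L : V →ₗ[ℝ] ℝ, L v = p v ∧ ∀ x, L x ≤ p x := by
  have p0 : p 0 = 0 := by
    have h1 := hsmul 2 two_pos 0
    rw [smul_zero] at h1
    linarith
  have h : ∀ c : ℝ, c • v = 0 → (RingHom.id ℝ) c • p v = 0 := by
    intro c hc
    rcases smul_eq_zero.1 hc with rfl | rfl
    · simp
    · simp [p0]
  obtain ⟨L, hL1, hL2⟩ := exists_extension_of_le_sublinear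
    (LinearPMap.mkSpanSingleton' (σ := RingHom.id ℝ) v (p v) h) p hsmul hadd (by
      rintro ⟨x, hx⟩
      obtain ⟨c, rfl⟩ := Submodule.mem_span_singleton.1 hx
      rw [LinearPMap.mkSpanSingleton'_apply]
      simp only [RingHom.id_apply, smul_eq_mul]
      rcases lt_trichotomy c 0 with hc | rfl | hc
      -- For negative `c`, subadditivity gives `0 = p 0 ≤ p (c • v) + p (-c • v)`, hence `c * p v ≤
      -- p (c • v)`.
      · have h1 := hsmul (-c) (neg_pos.2 hc) v
        have h2 := hadd (c • v) (-c • v)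
        rw [← add_smul, add_neg_cancel, zero_smul, p0, h1] at h2
        linarith
      · simp [p0]
      · rw [hsmul c hc])
  refine ⟨L, ?_, hL2⟩
  have h1 := hL1 ⟨v, Submodule.mem_span_singleton_self v⟩
  have h2 := LinearPMap.mkSpanSingleton'_apply (σ := RingHom.id ℝ) v (p v) h 1 (by
    rw [one_smul]; exact Submodule.mem_span_singleton_self v)
  simp only [one_smul, RingHom.id_apply] at h2
  rw [h1]; exact h2

variable {E : Type*} [NormedAddCommGroup E]

/-- Continuous functions of at most quadratic growth. -/
def QuadGrowth (φ : E → ℝ) : Prop := Continuous φ ∧ ∃ C, ∀ x, |φ x| ≤ C * (1 + ‖x‖ ^ 2)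

theorem QuadGrowth.add {φ ψ : E → ℝ} (h : QuadGrowth φ) (h' : QuadGrowth ψ) :
    QuadGrowth (fun x => φ x + ψ x) := by
  obtain ⟨hc, C, hC⟩ := h
  obtain ⟨hc', C', hC'⟩ := h'
  exact ⟨hc.add hc', C + C', fun x => (abs_add_le _ _).trans (by linarith [hC x, hC' x])⟩

theorem QuadGrowth.const_mul {φ : E → ℝ} (h : QuadGrowth φ) (c : ℝ) :
    QuadGrowth (fun x => c * φ x) := by
  obtain ⟨hc, C, hC⟩ := h
  exact ⟨hc.const_mul c, |c| * C, fun x => by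
    rw [abs_mul, mul_assoc]; exact mul_le_mul_of_nonneg_left (hC x) (abs_nonneg c)⟩

theorem QuadGrowth.neg {φ : E → ℝ} (h : QuadGrowth φ) : QuadGrowth (fun x => -φ x) := by
  simpa using h.const_mul (-1)

theorem QuadGrowth.sub {φ ψ : E → ℝ} (h : QuadGrowth φ) (h' : QuadGrowth ψ) :
    QuadGrowth (fun x => φ x - ψ x) := by
  simpa [sub_eq_add_neg] using h.add h'.neg

theorem quadGrowth_sq : QuadGrowth (fun x : E => ‖x‖ ^ 2 / 2) :=
  ⟨by fun_prop, 1, fun x => by rw [abs_of_nonneg (by positivity)]; nlinarith [sq_nonneg ‖x‖]⟩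

theorem quadGrowth_of_bounded {φ : E → ℝ} (hφ : Continuous φ) {C : ℝ} (hC : ∀ x, |φ x| ≤ C) :
    QuadGrowth φ :=
  ⟨hφ, C, fun x => (hC x).trans (by
    nlinarith [(abs_nonneg _).trans (hC x), mul_nonneg ((abs_nonneg _).trans (hC x)) (sq_nonneg ‖x‖)])⟩

theorem QuadGrowth.const (c : ℝ) : QuadGrowth (fun _ : E => c) :=
  quadGrowth_of_bounded continuous_const fun _ => le_rfl

theorem integrable_of_le_quad [MeasurableSpace E] {ν : Measure E} [IsFiniteMeasure ν]
    (hν : Integrable (fun x => ‖x‖ ^ 2) ν) {φ : E → ℝ} (hm : AEStronglyMeasurable φ ν) {C : ℝ}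
    (hC : ∀ x, |φ x| ≤ C * (1 + ‖x‖ ^ 2)) : Integrable φ ν :=
  (((integrable_const (1 : ℝ)).add hν).const_mul C).mono' hm (.of_forall hC)

theorem QuadGrowth.integrable [MeasurableSpace E] [BorelSpace E] [SecondCountableTopology E]
    {ν : Measure E} [IsFiniteMeasure ν]
    (hν : Integrable (fun x => ‖x‖ ^ 2) ν) {φ : E → ℝ} (h : QuadGrowth φ) : Integrable φ ν := by
  obtain ⟨hc, C, hC⟩ := h
  exact integrable_of_le_quad hν hc.aestronglyMeasurable hC

variable (E) in
/-- Functions on the product with at most quadratic growth. -/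
def quadBounded : Submodule ℝ (E × E → ℝ) where
  carrier := {h | ∃ C, ∀ p, |h p| ≤ C * (1 + ‖p.1‖ ^ 2 + ‖p.2‖ ^ 2)}
  zero_mem' := ⟨0, fun p => by simp⟩
  add_mem' := by
    rintro a b ⟨C, hC⟩ ⟨C', hC'⟩
    exact ⟨C + C', fun x => (abs_add_le _ _).trans (by linarith [hC x, hC' x])⟩
  smul_mem' := by
    rintro c a ⟨C, hC⟩
    exact ⟨|c| * C, fun x => by
      rw [Pi.smul_apply, smul_eq_mul, abs_mul, mul_assoc]
      exact mul_le_mul_of_nonneg_left (hC x) (abs_nonneg c)⟩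

theorem mem_quadBounded_of_bounded {h : E × E → ℝ} {C : ℝ} (hC : ∀ p, |h p| ≤ C) :
    h ∈ quadBounded E :=
  ⟨C, fun p => (hC p).trans (by
    have := (abs_nonneg _).trans (hC p)
    nlinarith [mul_nonneg this (sq_nonneg ‖p.1‖), mul_nonneg this (sq_nonneg ‖p.2‖)])⟩

theorem mem_quadBounded_of_sum {φ ψ : E → ℝ} (hφ : QuadGrowth φ) (hψ : QuadGrowth ψ) :
    (fun p : E × E => φ p.1 + ψ p.2) ∈ quadBounded E := by
  obtain ⟨-, C, hC⟩ := hφ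
  obtain ⟨-, D, hD⟩ := hψ
  refine ⟨|C| + |D|, fun p => (abs_add_le _ _).trans ?_⟩
  have h1 := (hC p.1).trans (mul_le_mul_of_nonneg_right (le_abs_self C) (by positivity))
  have h2 := (hD p.2).trans (mul_le_mul_of_nonneg_right (le_abs_self D) (by positivity))
  nlinarith [mul_nonneg (abs_nonneg C) (sq_nonneg ‖p.2‖), mul_nonneg (abs_nonneg D)
    (sq_nonneg ‖p.1‖)]

variable [MeasurableSpace E]

/-- The values of the dual Kantorovich problem that dominates `h`. -/
def dualValues (ν₁ ν₂ : Measure E) (h : E × E → ℝ) : Set ℝ :=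
  {r | ∃ φ ψ : E → ℝ, QuadGrowth φ ∧ QuadGrowth ψ ∧ (∀ x y, h (x, y) ≤ φ x + ψ y) ∧
    r = ∫ x, φ x ∂ν₁ + ∫ y, ψ y ∂ν₂}

theorem dualValues_nonempty (ν₁ ν₂ : Measure E) {h : E × E → ℝ} (hh : h ∈ quadBounded E) :
    (dualValues ν₁ ν₂ h).Nonempty := by
  obtain ⟨C, hC⟩ := hh
  refine ⟨_, fun x => C + (2 * C) * (‖x‖ ^ 2 / 2), fun x => (2 * C) * (‖x‖ ^ 2 / 2),
    (QuadGrowth.const C).add (quadGrowth_sq.const_mul (2 * C)), quadGrowth_sq.const_mul (2 * C),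
    fun x y => ?_, rfl⟩
  have := (le_abs_self _).trans (hC (x, y))
  simp only at this ⊢
  nlinarith

variable [BorelSpace E] [SecondCountableTopology E] {ν₁ ν₂ : Measure E} [IsProbabilityMeasure ν₁]
  [IsProbabilityMeasure ν₂]

/-- The two separated functions are compared by integrating against `ν₁ ⊗ ν₂`, one variable at a
time. -/
theorem le_of_mem_dualValues (h₁ : Integrable (fun x => ‖x‖ ^ 2) ν₁)
    (h₂ : Integrable (fun x => ‖x‖ ^ 2) ν₂) {h : E × E → ℝ} {φ ψ : E → ℝ}
    (hφ : QuadGrowth φ) (hψ : QuadGrowth ψ) (hle : ∀ x y, φ x + ψ y ≤ h (x, y)) {r : ℝ}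
    (hr : r ∈ dualValues ν₁ ν₂ h) : ∫ x, φ x ∂ν₁ + ∫ y, ψ y ∂ν₂ ≤ r := by
  obtain ⟨φ', ψ', hφ', hψ', hle', rfl⟩ := hr
  have key : ∀ y, ∫ x, φ x ∂ν₁ + ψ y ≤ ∫ x, φ' x ∂ν₁ + ψ' y := by
    intro y
    have := integral_mono (μ := ν₁) ((hφ.integrable h₁).add (integrable_const (ψ y)))
      ((hφ'.integrable h₁).add (integrable_const (ψ' y))) fun x => (hle x y).trans (hle' x y)
    simp only [Pi.add_apply] at this
    rw [integral_add (hφ.integrable h₁) (integrable_const _),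
      integral_add (hφ'.integrable h₁) (integrable_const _)] at this
    simpa using this
  have := integral_mono (μ := ν₂) ((integrable_const (∫ x, φ x ∂ν₁)).add (hψ.integrable h₂))
    ((integrable_const (∫ x, φ' x ∂ν₁)).add (hψ'.integrable h₂)) key
  simp only [Pi.add_apply] at this
  rw [integral_add (integrable_const _) (hψ.integrable h₂),
      integral_add (integrable_const _) (hψ'.integrable h₂)] at this
  simpa using this

theorem dualValues_bddBelow (h₁ : Integrable (fun x => ‖x‖ ^ 2) ν₁)
    (h₂ : Integrable (fun x => ‖x‖ ^ 2) ν₂) {h : E × E → ℝ} (hh : h ∈ quadBounded E) :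
    BddBelow (dualValues ν₁ ν₂ h) := by
  obtain ⟨C, hC⟩ := hh
  refine ⟨_, fun r hr => le_of_mem_dualValues (φ := fun x => -C + (-2 * C) * (‖x‖ ^ 2 / 2))
    (ψ := fun x => (-2 * C) * (‖x‖ ^ 2 / 2)) h₁ h₂
    ((QuadGrowth.const _).add (quadGrowth_sq.const_mul _)) (quadGrowth_sq.const_mul _)
    (fun x y => ?_) hr⟩
  have := (neg_abs_le _).trans' (neg_le_neg (hC (x, y)))
  simp only at this ⊢
  nlinarith

/-- The linear functional produced by the Hahn–Banach theorem from the dual Kantorovich problem. -/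
theorem exists_linear_dual (h₁ : Integrable (fun x => ‖x‖ ^ 2) ν₁)
    (h₂ : Integrable (fun x => ‖x‖ ^ 2) ν₂) (c : quadBounded E) :
    ∃ L : quadBounded E →ₗ[ℝ] ℝ, L c = sInf (dualValues ν₁ ν₂ c.1) ∧
      (∀ k k' : quadBounded E, (∀ p, k.1 p ≤ k'.1 p) → L k ≤ L k') ∧
      ∀ φ ψ : E → ℝ, QuadGrowth φ → QuadGrowth ψ → ∀ k : quadBounded E,
        (∀ p, k.1 p = φ p.1 + ψ p.2) → L k = ∫ x, φ x ∂ν₁ + ∫ y, ψ y ∂ν₂ := by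
  obtain ⟨L, hLc, hL⟩ := exists_linear_le_sublinear_eq
    (fun k : quadBounded E => sInf (dualValues ν₁ ν₂ k.1)) (by
      intro a ha k
      have : dualValues ν₁ ν₂ (a • k).1 = a • dualValues ν₁ ν₂ k.1 := by
        ext r
        rw [Set.mem_smul_set]
        constructor
        · rintro ⟨φ, ψ, hφ, hψ, hle, rfl⟩
          refine ⟨_, ⟨_, _, hφ.const_mul a⁻¹, hψ.const_mul a⁻¹, fun x y => ?_, rfl⟩, ?_⟩
          · have := hle x y
            simp only [SetLike.val_smul, Pi.smul_apply, smul_eq_mul] at this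
            rw [← mul_add, ← div_eq_inv_mul, le_div_iff₀ ha]; linarith
          · rw [integral_const_mul, integral_const_mul, smul_eq_mul]
            field_simp
        · rintro ⟨_, ⟨φ, ψ, hφ, hψ, hle, rfl⟩, rfl⟩
          refine ⟨_, _, hφ.const_mul a, hψ.const_mul a, fun x y => ?_, ?_⟩
          · have := mul_le_mul_of_nonneg_left (hle x y) ha.le
            simp only [SetLike.val_smul, Pi.smul_apply, smul_eq_mul]
            linarith
          · rw [integral_const_mul, integral_const_mul, smul_eq_mul]; ring
      simp only [this]
      rw [Real.sInf_smul_of_nonneg ha.le, smul_eq_mul]) (by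
      intro k k'
      rw [← csInf_add (dualValues_nonempty _ _ k.2) (dualValues_bddBelow h₁ h₂ k.2)
        (dualValues_nonempty _ _ k'.2) (dualValues_bddBelow h₁ h₂ k'.2)]
      refine csInf_le_csInf (dualValues_bddBelow h₁ h₂ (k + k').2)
        ((dualValues_nonempty _ _ k.2).add (dualValues_nonempty _ _ k'.2)) ?_
      rintro _ ⟨_, ⟨φ, ψ, hφ, hψ, hle, rfl⟩, _, ⟨φ', ψ', hφ', hψ', hle', rfl⟩, rfl⟩
      refine ⟨_, _, hφ.add hφ', hψ.add hψ', fun x y => ?_, ?_⟩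
      · have := add_le_add (hle x y) (hle' x y)
        simp only [Submodule.coe_add, Pi.add_apply]; linarith
      · rw [integral_add (hφ.integrable h₁) (hφ'.integrable h₁),
          integral_add (hψ.integrable h₂) (hψ'.integrable h₂)]; ring) c
  -- All remaining properties come from this bound: zero potentials give monotonicity, and its use
  -- for both `k` and `-k` determines `L` on sums `φ(x) + ψ(y)`.
  have le_of : ∀ φ ψ : E → ℝ, QuadGrowth φ → QuadGrowth ψ → ∀ k : quadBounded E,
      (∀ p, k.1 p ≤ φ p.1 + ψ p.2) → L k ≤ ∫ x, φ x ∂ν₁ + ∫ y, ψ y ∂ν₂ :=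
    fun φ ψ hφ hψ k hk => (hL k).trans (csInf_le (dualValues_bddBelow h₁ h₂ k.2)
      ⟨φ, ψ, hφ, hψ, fun x y => hk (x, y), rfl⟩)
  refine ⟨L, hLc, fun k k' hk => ?_, fun φ ψ hφ hψ k hk => le_antisymm
    (le_of φ ψ hφ hψ k fun p => (hk p).le) ?_⟩
  · have := le_of (fun _ => 0) (fun _ => 0) (QuadGrowth.const 0) (QuadGrowth.const 0) (k - k')
      (fun p => by simpa using hk p)
    simp only [map_sub, integral_zero] at this
    linarith
  · have := le_of _ _ hφ.neg hψ.neg (-k) (fun p => by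
      simp only [Submodule.coe_neg, Pi.neg_apply, hk p]; linarith)
    rw [map_neg, integral_neg, integral_neg] at this
    linarith

end Kantorovich

/-! ### Cutoff functions -/

section Cutoff

variable {E : Type*} [NormedAddCommGroup E]

/-- A continuous cutoff function, equal to `1` on the ball of radius `R`. -/
noncomputable def cutoff (R : ℕ) (x : E) : ℝ := max 0 (min 1 (R + 1 - ‖x‖))

theorem cutoff_nonneg (R : ℕ) (x : E) : 0 ≤ cutoff R x := le_max_left _ _

theorem cutoff_le_one (R : ℕ) (x : E) : cutoff R x ≤ 1 := max_le zero_le_one (min_le_left _ _)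

theorem continuous_cutoff (R : ℕ) : Continuous (cutoff R : E → ℝ) := by
  unfold cutoff; fun_prop

theorem cutoff_mono {R S : ℕ} (h : R ≤ S) (x : E) : cutoff R x ≤ cutoff S x := by
  have : (R : ℝ) ≤ S := by exact_mod_cast h
  unfold cutoff; gcongr

theorem cutoff_eq_zero {R : ℕ} {x : E} (h : R + 1 ≤ ‖x‖) : cutoff R x = 0 :=
  max_eq_left ((min_le_right _ _).trans (by linarith))

theorem tendsto_cutoff (x : E) :
    Filter.Tendsto (fun R : ℕ => cutoff R x) Filter.atTop (nhds 1) := by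
  refine tendsto_const_nhds.congr' ?_
  filter_upwards [Filter.eventually_ge_atTop ⌈‖x‖⌉₊] with R hR
  have : ‖x‖ ≤ R := Nat.ceil_le.1 hR
  rw [cutoff, min_eq_left (by linarith), max_eq_right zero_le_one]

theorem hasCompactSupport_cutoff_mul [ProperSpace E] (R : ℕ) (k : E × E → ℝ) :
    HasCompactSupport fun p : E × E => k p * (cutoff R p.1 * cutoff R p.2) := by
  refine HasCompactSupport.intro ((isCompact_closedBall (0 : E) (R + 1)).prod
    (isCompact_closedBall (0 : E) (R + 1))) fun p hp => ?_
  simp only [Set.mem_prod, mem_closedBall_zero_iff, not_and_or, not_le] at hp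
  rcases hp with hp | hp <;> simp [cutoff_eq_zero hp.le]

theorem integral_one_sub_cutoff_tendsto [MeasurableSpace E] [BorelSpace E]
    [SecondCountableTopology E] (ν : Measure E) [IsFiniteMeasure ν] :
    Filter.Tendsto (fun R : ℕ => ∫ x, (1 - cutoff R x) ∂ν) Filter.atTop (nhds 0) := by
  have : (0 : ℝ) = ∫ x : E, (0 : ℝ) ∂ν := by simp
  rw [this]
  refine tendsto_integral_of_dominated_convergence (fun _ => 1)
    (fun R => (continuous_const.sub (continuous_cutoff R)).aestronglyMeasurable)
    (integrable_const 1) (fun R => .of_forall fun x => ?_) (.of_forall fun x => ?_)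
  · rw [Real.norm_eq_abs, abs_of_nonneg (by linarith [cutoff_le_one R x])]
    linarith [cutoff_nonneg R x]
  · simpa using (tendsto_cutoff x).const_sub 1

end Cutoff

/-! ### Kantorovich duality through the Riesz–Markov theorem -/

section KantorovichDuality

variable {E : Type*} [NormedAddCommGroup E] [ProperSpace E] [MeasurableSpace E] [BorelSpace E]
  {ν₁ ν₂ : Measure E} [IsProbabilityMeasure ν₁] [IsProbabilityMeasure ν₂]

/-- Kantorovich duality for the quadratic cost: the optimal transport cost is attained from
below by dual potentials. -/
theorem exists_coupling_le_dual (h₁ : Integrable (fun x => ‖x‖ ^ 2) ν₁)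
    (h₂ : Integrable (fun x => ‖x‖ ^ 2) ν₂) {δ : ℝ} (hδ : 0 < δ) :
    ∃ π : Measure (E × E), IsProbabilityMeasure π ∧ π.fst = ν₁ ∧ π.snd = ν₂ ∧
      ∃ φ ψ : E → ℝ, QuadGrowth φ ∧ QuadGrowth ψ ∧
        (∀ x y, φ x + ψ y ≤ ‖x - y‖ ^ 2 / 2) ∧ 0 ≤ ∫ x, φ x ∂ν₁ + ∫ y, ψ y ∂ν₂ + δ ∧
        ∫⁻ p, ENNReal.ofReal (‖p.1 - p.2‖ ^ 2 / 2) ∂π ≤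
          ENNReal.ofReal (∫ x, φ x ∂ν₁ + ∫ y, ψ y ∂ν₂ + δ) := by
  have hcmem : (fun p : E × E => -(‖p.1 - p.2‖ ^ 2 / 2)) ∈ quadBounded E := by
    refine ⟨1, fun p => ?_⟩
    rw [abs_neg, abs_of_nonneg (by positivity)]
    have := norm_sub_le p.1 p.2
    nlinarith [sq_nonneg (‖p.1‖ - ‖p.2‖), norm_nonneg (p.1 - p.2), norm_nonneg p.1,
      norm_nonneg p.2]
  set c : quadBounded E := ⟨_, hcmem⟩ with hc
  -- Since `c` is minus the cost, `-L c` is the value of the dual problem. The plan will be the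
  -- measure representing `L` on compactly supported functions.
  obtain ⟨L, hLc, hLmono, hLsum⟩ := exists_linear_dual h₁ h₂ c
  have hbd : ∀ f : CompactlySupportedContinuousMap (E × E) ℝ, (f : E × E → ℝ) ∈ quadBounded E := by
    intro f
    obtain ⟨C, hC⟩ := f.hasCompactSupport.exists_bound_of_continuous f.continuous
    exact mem_quadBounded_of_bounded hC
  let Λ : CompactlySupportedContinuousMap (E × E) ℝ →ₚ[ℝ] ℝ := PositiveLinearMap.mk₀
    { toFun := fun f => L ⟨f, hbd f⟩
      map_add' := fun f g => by rw [← map_add]; rfl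
      map_smul' := fun a f => by
        rw [RingHom.id_apply, ← map_smul]; rfl } (by
      intro f hf
      have := hLmono 0 ⟨f, hbd f⟩ (fun p => hf p)
      simpa using this)
  set π := RealRMK.rieszMeasure Λ with hπ
  have hint : ∀ (k : quadBounded E) (R : ℕ) (hk : Continuous k.1)
      (hm : (fun p : E × E => k.1 p * (cutoff R p.1 * cutoff R p.2)) ∈ quadBounded E),
      ∫ p, k.1 p * (cutoff R p.1 * cutoff R p.2) ∂π =
        L ⟨fun p => k.1 p * (cutoff R p.1 * cutoff R p.2), hm⟩ := by
    intro k R hk hm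
    have hcont : Continuous fun p : E × E => k.1 p * (cutoff R p.1 * cutoff R p.2) :=
      hk.mul (((continuous_cutoff R).comp continuous_fst).mul
        ((continuous_cutoff R).comp continuous_snd))
    exact RealRMK.integral_rieszMeasure Λ ⟨⟨_, hcont⟩, hasCompactSupport_cutoff_mul R k.1⟩
  have hcut : ∀ (k : quadBounded E) (R : ℕ),
      (fun p : E × E => k.1 p * (cutoff R p.1 * cutoff R p.2)) ∈ quadBounded E := by
    rintro ⟨k, C, hC⟩ R
    refine ⟨C, fun p => ?_⟩
    rw [abs_mul, abs_of_nonneg (mul_nonneg (cutoff_nonneg R p.1) (cutoff_nonneg R p.2))]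
    exact (mul_le_of_le_one_right (abs_nonneg _) (mul_le_one₀ (cutoff_le_one R p.1)
      (cutoff_nonneg R p.2) (cutoff_le_one R p.2))).trans (hC p)
  -- Cutoffs and monotone convergence give only an inequality, since `L` could charge infinity; for
  -- bounded functions this is excluded below.
  have upper : ∀ k : quadBounded E, Continuous k.1 → (∀ p, 0 ≤ k.1 p) →
      ∫⁻ p, ENNReal.ofReal (k.1 p) ∂π ≤ ENNReal.ofReal (L k) := by
    intro k hk k0
    have hcont : ∀ R, Continuous fun p : E × E => k.1 p * (cutoff R p.1 * cutoff R p.2) :=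
      fun R => hk.mul (((continuous_cutoff R).comp continuous_fst).mul
        ((continuous_cutoff R).comp continuous_snd))
    have lim := lintegral_tendsto_of_tendsto_of_monotone (μ := π)
      (f := fun R p => ENNReal.ofReal (k.1 p * (cutoff R p.1 * cutoff R p.2)))
      (F := fun p => ENNReal.ofReal (k.1 p))
      (fun R => (hcont R).measurable.ennreal_ofReal.aemeasurable)
      (.of_forall fun p R S hRS => ENNReal.ofReal_le_ofReal (mul_le_mul_of_nonneg_left
        (mul_le_mul (cutoff_mono hRS _) (cutoff_mono hRS _) (cutoff_nonneg _ _)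
          (cutoff_nonneg _ _)) (k0 p)))
      (.of_forall fun p => (ENNReal.continuous_ofReal.tendsto _).comp (by
        simpa using ((tendsto_cutoff p.1).mul (tendsto_cutoff p.2)).const_mul (k.1 p)))
    refine le_of_tendsto' lim fun R => ?_
    rw [← ofReal_integral_eq_lintegral_ofReal, hint k R hk (hcut k R)]
    · refine ENNReal.ofReal_le_ofReal (hLmono _ _ fun p => ?_)
      exact mul_le_of_le_one_right (k0 p) (mul_le_one₀ (cutoff_le_one R p.1)
        (cutoff_nonneg R p.2) (cutoff_le_one R p.2))
    · exact (hcont R).integrable_of_hasCompactSupport (hasCompactSupport_cutoff_mul R k.1)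
    · exact .of_forall fun p => mul_nonneg (k0 p) (mul_nonneg (cutoff_nonneg _ _)
        (cutoff_nonneg _ _))
  have one_mem : (fun _ : E × E => (1 : ℝ)) ∈ quadBounded E :=
    mem_quadBounded_of_bounded (C := 1) (by simp)
  have L1 : L ⟨_, one_mem⟩ = 1 := by
    rw [hLsum (fun _ => 1) (fun _ => 0) (QuadGrowth.const 1) (QuadGrowth.const 0) _ (by simp)]
    simp
  have mass_le : π Set.univ ≤ 1 := by
    have := upper ⟨_, one_mem⟩ continuous_const (by simp)
    simpa [L1] using this
  have fin : IsFiniteMeasure π := ⟨mass_le.trans_lt ENNReal.one_lt_top⟩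
  have qcut : ∀ R, QuadGrowth (fun x : E => 1 - cutoff R x) := fun R =>
    quadGrowth_of_bounded (C := 1) (continuous_const.sub (continuous_cutoff R)) (fun x => by
      rw [abs_of_nonneg (by linarith [cutoff_le_one R x])]; linarith [cutoff_nonneg R x])
  have mass : IsProbabilityMeasure π := by
    -- No mass escapes: `1 - χ(x)χ(y) ≤ (1 - χ(x)) + (1 - χ(y))` for the cutoff `χ`, and `L` of the
    -- right side is computed from the marginals.
    have low : ∀ R : ℕ, 1 - (∫ x, (1 - cutoff R x) ∂ν₁ + ∫ x, (1 - cutoff R x) ∂ν₂) ≤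
        π.real Set.univ := by
      intro R
      have e1 := hint ⟨_, one_mem⟩ R continuous_const (hcut _ R)
      have e2 := hLsum _ _ (qcut R) (qcut R) ⟨_, mem_quadBounded_of_sum (qcut R) (qcut R)⟩
        (fun p => rfl)
      have e3 := hLmono (⟨_, one_mem⟩ - ⟨_, mem_quadBounded_of_sum (qcut R) (qcut R)⟩)
        ⟨_, hcut ⟨_, one_mem⟩ R⟩ (fun p => by
          simp only [Submodule.coe_sub, Pi.sub_apply]
          nlinarith [cutoff_le_one R p.1, cutoff_le_one R p.2])
      rw [map_sub, L1, e2, ← e1] at e3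
      refine e3.trans ?_
      have : π.real Set.univ = ∫ p, (1 : ℝ) ∂π := by simp
      rw [this]
      refine integral_mono_of_nonneg (.of_forall fun p => ?_) (integrable_const 1)
        (.of_forall fun p => ?_)
      · simpa using mul_nonneg (cutoff_nonneg R p.1) (cutoff_nonneg R p.2)
      · simpa using (mul_le_one₀ (cutoff_le_one R p.1) (cutoff_nonneg R p.2)
          (cutoff_le_one R p.2))
    have lim : Filter.Tendsto (fun R : ℕ => 1 - (∫ x, (1 - cutoff R x) ∂ν₁ +
        ∫ x, (1 - cutoff R x) ∂ν₂)) Filter.atTop (nhds 1) := by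
      simpa using ((integral_one_sub_cutoff_tendsto ν₁).add
        (integral_one_sub_cutoff_tendsto ν₂)).const_sub 1
    have := le_of_tendsto' lim low
    refine ⟨le_antisymm mass_le ?_⟩
    rw [← ofReal_measureReal (μ := π)]
    simpa using ENNReal.ofReal_le_ofReal this
  have marg : ∀ (ν : Measure E) [IsProbabilityMeasure ν] (P : E × E → E), Continuous P →
      (∀ u : E → ℝ, QuadGrowth u → ∀ k : quadBounded E, (∀ p, k.1 p = u (P p)) →
        L k = ∫ x, u x ∂ν) → π.map P = ν := by
    intro ν _ P hP hν
    have hPp : IsProbabilityMeasure (π.map P) :=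
      Measure.isProbabilityMeasure_map hP.measurable.aemeasurable
    have le : ∀ u : E → ℝ, Continuous u → (∀ x, 0 ≤ u x) → ∀ C, (∀ x, u x ≤ C) →
        ∫ x, u x ∂(π.map P) ≤ ∫ x, u x ∂ν := by
      intro u hu u0 C huC
      have hb : ∀ x, |u x| ≤ C := fun x => by rw [abs_of_nonneg (u0 x)]; exact huC x
      have hk : (fun p => u (P p)) ∈ quadBounded E :=
        mem_quadBounded_of_bounded (C := C) fun p => hb _
      have h3 := upper ⟨_, hk⟩ (hu.comp hP) (fun p => u0 _)
      rw [hν u (quadGrowth_of_bounded hu hb) _ (fun p => rfl),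
        ← ofReal_integral_eq_lintegral_ofReal] at h3
      · rw [integral_map hP.measurable.aemeasurable hu.aestronglyMeasurable]
        exact (ENNReal.ofReal_le_ofReal_iff (integral_nonneg u0)).1 h3
      · exact Integrable.of_bound (hu.comp hP).aestronglyMeasurable C
          (.of_forall fun p => hb _)
      · exact .of_forall fun p => u0 _
    refine ext_of_forall_integral_eq_of_IsFiniteMeasure fun f => ?_
    obtain ⟨C, hC⟩ : ∃ C, ∀ x, |f x| ≤ C := ⟨‖f‖, fun x => f.norm_coe_le_norm x⟩
    have i1 : Integrable f (π.map P) := Integrable.of_bound f.continuous.aestronglyMeasurable C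
          (.of_forall hC)
    have i2 : Integrable f ν := Integrable.of_bound f.continuous.aestronglyMeasurable C
          (.of_forall hC)
    -- The one-sided bound applied to the nonnegative functions `C + f` and `C - f` yields equality,
    -- the total masses being equal.
    have e1 := le (fun x => C + f x) (by fun_prop) (fun x => by linarith [neg_abs_le (f x), hC x])
      (2 * C) (fun x => by linarith [le_abs_self (f x), hC x])
    have e2 := le (fun x => C - f x) (by fun_prop) (fun x => by linarith [le_abs_self (f x), hC x])
      (2 * C) (fun x => by linarith [neg_abs_le (f x), hC x])
    rw [integral_add (integrable_const _) i1, integral_add (integrable_const _) i2] at e1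
    rw [integral_sub (integrable_const _) i1, integral_sub (integrable_const _) i2] at e2
    simp only [integral_const, probReal_univ, smul_eq_mul, one_mul] at e1 e2
    linarith
  obtain ⟨r, ⟨φ, ψ, hφ, hψ, hle, rfl⟩, hr⟩ := exists_lt_of_csInf_lt (dualValues_nonempty ν₁ ν₂ c.2)
    (show sInf (dualValues ν₁ ν₂ c.1) < L c + δ by rw [← hLc]; linarith)
  refine ⟨π, mass, marg ν₁ Prod.fst continuous_fst fun u hu k hk => ?_,
    marg ν₂ Prod.snd continuous_snd fun u hu k hk => ?_, fun x => -φ x, fun y => -ψ y, hφ.neg,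
    hψ.neg, fun x y => ?_, ?_, ?_⟩
  · rw [hLsum u (fun _ => 0) hu (QuadGrowth.const 0) k (fun p => by rw [hk]; ring)]; simp
  · rw [hLsum (fun _ => 0) u (QuadGrowth.const 0) hu k (fun p => by rw [hk]; ring)]; simp
  · have := hle x y
    simp only [hc] at this
    linarith
  · have := hLmono 0 (-c) (fun p => by
      simp only [hc, Submodule.coe_neg, Pi.neg_apply, neg_neg, Submodule.coe_zero, Pi.zero_apply]
      positivity)
    rw [map_zero, map_neg] at this
    rw [integral_neg, integral_neg]
    linarith
  · have e1 := upper (-c) (by simp only [hc, Submodule.coe_neg]; fun_prop)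
      (fun p => by simp only [hc, Submodule.coe_neg, Pi.neg_apply, neg_neg]; positivity)
    simp only [hc, Submodule.coe_neg, Pi.neg_apply, neg_neg] at e1
    refine e1.trans (ENNReal.ofReal_le_ofReal ?_)
    rw [← hc, map_neg, integral_neg, integral_neg]
    linarith

end KantorovichDuality

end InvSantalo

namespace InvSantalo

/-! ### Relative entropy with respect to the Gaussian -/

section Gaussian

open ProbabilityTheory InformationTheory

/-- Euclidean space `ℝⁿ`. -/
abbrev Euc (n : ℕ) := EuclideanSpace ℝ (Fin n)

variable {n : ℕ}

theorem integrable_exp_neg_mul_sq {a : ℝ} (ha : 0 < a) :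
    Integrable (fun x : Euc n => Real.exp (-a * ‖x‖ ^ 2)) := by
  have := (GaussianFourier.integrable_cexp_neg_mul_sq_norm_add (b := (a : ℂ)) (V := Euc n)
    (by simpa using ha) 0 0).norm
  refine this.congr (.of_forall fun x => ?_)
  simp only [Complex.norm_exp]
  congr 1
  simp [← Complex.ofReal_pow]

theorem integrable_exp_neg_sq_div_two : Integrable (fun x : Euc n => Real.exp (-(‖x‖ ^ 2 / 2))) := by
  refine (integrable_exp_neg_mul_sq (n := n) (a := 1 / 2) (by norm_num)).congr (.of_forall fun x => ?_)
  simp only; congr 1; ring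

theorem integral_exp_neg_sq_div_two :
    ∫ x : Euc n, Real.exp (-(‖x‖ ^ 2 / 2)) = (2 * Real.pi) ^ ((n : ℝ) / 2) := by
  have := GaussianFourier.integral_rexp_neg_mul_sq_norm (V := Euc n) (b := 1 / 2) (by norm_num)
  rw [finrank_euclideanSpace, Fintype.card_fin] at this
  rw [show Real.pi / (1 / 2) = 2 * Real.pi by ring] at this
  rw [← this]
  congr 1; ext x; congr 1; ring

/-- The characteristic functions agree. The explicit density brings Gibbs measures within reach of
the formulas for tilted measures. -/
theorem stdGaussian_eq_tilted :
    stdGaussian (Euc n) = volume.tilted (fun x => -(‖x‖ ^ 2 / 2)) := by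
  have hp : IsProbabilityMeasure ((volume : Measure (Euc n)).tilted (fun x => -(‖x‖ ^ 2 / 2))) :=
    isProbabilityMeasure_tilted integrable_exp_neg_sq_div_two
  refine Measure.ext_of_charFun (funext fun t => ?_)
  rw [charFun_stdGaussian, charFun_apply, integral_tilted]
  have h1 := GaussianFourier.integral_cexp_neg_mul_sq_norm_add (V := Euc n) (b := 1 / 2)
    (by norm_num) Complex.I t
  have h2 : ∀ x : Euc n, (Real.exp (-(‖x‖ ^ 2 / 2)) / ∫ y : Euc n, Real.exp (-(‖y‖ ^ 2 / 2))) •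
      Complex.exp (((inner ℝ x t : ℝ) : ℂ) * Complex.I) =
      (((2 * Real.pi) ^ ((n : ℝ) / 2) : ℝ) : ℂ)⁻¹ *
        Complex.exp (-(1 / 2) * (‖x‖ : ℂ) ^ 2 + Complex.I * ((inner ℝ t x : ℝ) : ℂ)) := by
    intro x
    rw [integral_exp_neg_sq_div_two, Complex.real_smul, Complex.exp_add, real_inner_comm]
    push_cast
    rw [div_eq_inv_mul, mul_assoc]
    congr 3
    · ring
    · ring
  simp_rw [h2]
  rw [integral_const_mul, h1, finrank_euclideanSpace, Fintype.card_fin]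
  have h3 : ((Real.pi : ℂ) / (1 / 2)) ^ ((n : ℂ) / 2) = (((2 * Real.pi) ^ ((n : ℝ) / 2) : ℝ) : ℂ) := by
    rw [Complex.ofReal_cpow (by positivity)]
    push_cast
    congr 1; ring
  have h4 : (((2 * Real.pi) ^ ((n : ℝ) / 2) : ℝ) : ℂ) ≠ 0 := by
    exact_mod_cast (Real.rpow_pos_of_pos (by positivity) _).ne'
  rw [h3, inv_mul_cancel_left₀ h4]
  congr 1
  rw [Complex.I_sq]; ring

theorem tilted_stdGaussian (g : Euc n → ℝ) :
    (stdGaussian (Euc n)).tilted (fun x => ‖x‖ ^ 2 / 2 - g x) = volume.tilted (fun x => -g x) := by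
  rw [stdGaussian_eq_tilted, tilted_tilted integrable_exp_neg_sq_div_two]
  congr 1; ext x; simp only [Pi.add_apply]; ring

theorem integral_exp_stdGaussian (g : Euc n → ℝ) :
    ∫ x, Real.exp (‖x‖ ^ 2 / 2 - g x) ∂(stdGaussian (Euc n)) =
      (∫ x : Euc n, Real.exp (-g x)) / (2 * Real.pi) ^ ((n : ℝ) / 2) := by
  rw [stdGaussian_eq_tilted, integral_exp_tilted, integral_exp_neg_sq_div_two]
  congr 2; ext x; simp only [Pi.add_apply]; congr 1; ring

theorem integrable_exp_stdGaussian {g : Euc n → ℝ} (hg : Integrable fun x => Real.exp (-g x)) :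
    Integrable (fun x => Real.exp (‖x‖ ^ 2 / 2 - g x)) (stdGaussian (Euc n)) := by
  rw [stdGaussian_eq_tilted, integrable_tilted_iff integrable_exp_neg_sq_div_two]
  refine hg.congr (.of_forall fun x => ?_)
  simp only [smul_eq_mul, ← Real.exp_add]; congr 1; ring

theorem log_integral_exp_stdGaussian {g : Euc n → ℝ} (hg : Integrable fun x => Real.exp (-g x)) :
    Real.log (∫ x, Real.exp (‖x‖ ^ 2 / 2 - g x) ∂(stdGaussian (Euc n))) =
      Real.log (∫ x : Euc n, Real.exp (-g x)) - n / 2 * Real.log (2 * Real.pi) := by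
  rw [integral_exp_stdGaussian, Real.log_div (integral_exp_pos hg).ne'
    (Real.rpow_pos_of_pos (by positivity) _).ne', Real.log_rpow (by positivity)]

/-- The Donsker–Varadhan inequality for the relative entropy with respect to the Gaussian. -/
theorem donsker_varadhan_gaussEntropy {η : Measure (Euc n)} [IsProbabilityMeasure η]
    (hη : Integrable (fun x => ‖x‖ ^ 2) η) (hH : gaussEntropy η ≠ ∞) {g : Euc n → ℝ}
    (hg : Integrable g η) (hge : Integrable fun x => Real.exp (-g x)) :
    ∫ x, (‖x‖ ^ 2 / 2 - g x) ∂η - Real.log (∫ x, Real.exp (-g x)) +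
      n / 2 * Real.log (2 * Real.pi) ≤ (gaussEntropy η).toReal := by
  obtain ⟨hac, hint⟩ := klDiv_ne_top_iff.1 hH
  have hge' := integrable_exp_stdGaussian hge
  have hf : Integrable (fun x => ‖x‖ ^ 2 / 2 - g x) η := (hη.div_const 2).sub hg
  have e := integral_llr_tilted_right hac hf hge' hint
  have hp : IsProbabilityMeasure ((stdGaussian (Euc n)).tilted fun x => ‖x‖ ^ 2 / 2 - g x) :=
    isProbabilityMeasure_tilted hge'
  -- Gibbs' inequality: the entropy of `η` relative to the tilted Gaussian, which is the Gibbs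
  -- measure of `g`, is nonnegative.
  have nn := integral_llr_add_sub_measure_univ_nonneg
    (hac.trans (absolutelyContinuous_tilted hge')) (integrable_llr_tilted_right hac hf hint hge')
  rw [e, log_integral_exp_stdGaussian hge] at nn
  simp only [probReal_univ] at nn
  rw [gaussEntropy, toReal_klDiv_of_measure_eq hac (by simp)]
  linarith

/-- The relative entropy of a Gibbs measure with respect to the Gaussian. -/
theorem gaussEntropy_tilted {g : Euc n → ℝ} (hge : Integrable fun x => Real.exp (-g x))
    (hsq : Integrable (fun x => ‖x‖ ^ 2) ((volume : Measure (Euc n)).tilted fun x => -g x))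
    (hg : Integrable g (volume.tilted fun x => -g x)) :
    gaussEntropy ((volume : Measure (Euc n)).tilted fun x => -g x) ≠ ∞ ∧
    (gaussEntropy ((volume : Measure (Euc n)).tilted fun x => -g x)).toReal =
      ∫ x, (‖x‖ ^ 2 / 2 - g x) ∂(volume.tilted fun x => -g x) - Real.log (∫ x, Real.exp (-g x)) +
      n / 2 * Real.log (2 * Real.pi) := by
  have hp : IsProbabilityMeasure ((volume : Measure (Euc n)).tilted fun x => -g x) :=
    isProbabilityMeasure_tilted hge
  have hge' := integrable_exp_stdGaussian hge
  have hf : Integrable (fun x => ‖x‖ ^ 2 / 2 - g x) (volume.tilted fun x => -g x) :=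
    (hsq.div_const 2).sub hg
  have hac : (volume : Measure (Euc n)).tilted (fun x => -g x) ≪ stdGaussian (Euc n) := by
    rw [← tilted_stdGaussian]; exact tilted_absolutelyContinuous _ _
  have hl : llr ((volume : Measure (Euc n)).tilted fun x => -g x) (stdGaussian (Euc n))
      =ᵐ[volume.tilted fun x => -g x] fun x => (‖x‖ ^ 2 / 2 - g x) -
        (Real.log (∫ x, Real.exp (-g x)) - n / 2 * Real.log (2 * Real.pi)) := by
    have := hac.ae_le (log_rnDeriv_tilted_left_self hge')
    rw [tilted_stdGaussian, log_integral_exp_stdGaussian hge] at this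
    exact this
  refine ⟨klDiv_ne_top hac ((hf.sub (integrable_const _)).congr hl.symm), ?_⟩
  rw [gaussEntropy, toReal_klDiv_of_measure_eq hac (by simp), integral_congr_ae hl,
    integral_sub hf (integrable_const _)]
  simp only [integral_const, probReal_univ, one_smul]
  ring

/-- A probability measure with finite second moment and bounded density has finite entropy. -/
theorem gaussEntropy_ne_top_of_le {η : Measure (Euc n)} [IsProbabilityMeasure η]
    (hη : Integrable (fun x => ‖x‖ ^ 2) η) {C : ℝ≥0∞} (hC : C ≠ ∞) (hle : η ≤ C • volume) :
    gaussEntropy η ≠ ∞ := by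
  have hac0 : η ≪ (volume : Measure (Euc n)) :=
    (Measure.absolutelyContinuous_of_le hle).trans Measure.smul_absolutelyContinuous
  have hac : η ≪ stdGaussian (Euc n) := by
    rw [stdGaussian_eq_tilted]
    exact hac0.trans (absolutelyContinuous_tilted integrable_exp_neg_sq_div_two)
  have hacG : stdGaussian (Euc n) ≪ volume := by
    rw [stdGaussian_eq_tilted]; exact tilted_absolutelyContinuous _ _
  have hdens : ∀ᵐ x, (η.rnDeriv volume x) ≤ C := by
    refine ae_le_of_forall_setLIntegral_le_of_sigmaFinite (Measure.measurable_rnDeriv _ _)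
      fun s hs _ => ?_
    rw [Measure.setLIntegral_rnDeriv hac0, setLIntegral_const]
    exact hle s
  have hden2 := rnDeriv_tilted_right η (volume : Measure (Euc n))
    (f := fun x => -(‖x‖ ^ 2 / 2)) (by exact (integrable_exp_neg_sq_div_two (n := n)))
  rw [← stdGaussian_eq_tilted, integral_exp_neg_sq_div_two] at hden2
  set Z := (2 * Real.pi) ^ ((n : ℝ) / 2)
  have hZ : 0 < Z := Real.rpow_pos_of_pos (by positivity) _
  set K := |Real.log (Z * C.toReal)|
  rw [gaussEntropy, klDiv_eq_lintegral_klFun_of_ac hac]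
  -- A Lebesgue density at most `C` means a Gaussian density `r ≤ e^{|x|²/2} Z C`, so `log r ≤ K +
  -- |x|²/2`; integrating `r (K + |x|²/2)` against the Gaussian gives a second moment of `η`.
  have hbound : ∀ᵐ x ∂(stdGaussian (Euc n)),
      ENNReal.ofReal (klFun (η.rnDeriv (stdGaussian (Euc n)) x).toReal) ≤
      1 + η.rnDeriv (stdGaussian (Euc n)) x * ENNReal.ofReal (K + ‖x‖ ^ 2 / 2) := by
    filter_upwards [hacG.ae_le hdens, hacG.ae_le hden2,
      Measure.rnDeriv_lt_top η (stdGaussian (Euc n))] with x hx1 hx2 hx3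
    set r := η.rnDeriv (stdGaussian (Euc n)) x
    have hr : r.toReal ≤ Real.exp (‖x‖ ^ 2 / 2) * (Z * C.toReal) := by
      rw [hx2, ENNReal.toReal_mul, ENNReal.toReal_ofReal (by positivity), neg_neg, mul_assoc]
      gcongr
    have hr0 : 0 ≤ r.toReal := ENNReal.toReal_nonneg
    have hk : klFun r.toReal ≤ 1 + r.toReal * (K + ‖x‖ ^ 2 / 2) := by
      rw [klFun]
      rcases hr0.eq_or_lt with h0 | h0
      · rw [← h0]; simp
      · have hpos : 0 < Z * C.toReal :=
          pos_of_mul_pos_right (h0.trans_le hr) (Real.exp_pos _).le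
        have hlog := Real.log_le_log h0 hr
        rw [Real.log_mul (Real.exp_pos _).ne' hpos.ne', Real.log_exp] at hlog
        have : Real.log (Z * C.toReal) ≤ K := le_abs_self _
        nlinarith
    refine (ENNReal.ofReal_le_ofReal hk).trans ?_
    have hK : 0 ≤ K := abs_nonneg _
    rw [ENNReal.ofReal_add zero_le_one (by positivity), ENNReal.ofReal_mul hr0,
      ENNReal.ofReal_toReal hx3.ne, ENNReal.ofReal_one]
  refine ne_top_of_le_ne_top ?_ (lintegral_mono_ae hbound)
  have : η.HaveLebesgueDecomposition (stdGaussian (Euc n)) :=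
    Measure.haveLebesgueDecomposition_of_sigmaFinite _ _
  have hmeas : AEMeasurable (fun x : Euc n => ENNReal.ofReal (K + ‖x‖ ^ 2 / 2))
    (stdGaussian (Euc n)) := by fun_prop
  rw [lintegral_add_left measurable_const, lintegral_rnDeriv_mul hac hmeas]
  have hi : Integrable (fun x => K + ‖x‖ ^ 2 / 2) η := (integrable_const K).add (hη.div_const 2)
  refine ENNReal.add_ne_top.2 ⟨by simp, ?_⟩
  have := hi.lintegral_lt_top
  exact this.ne

end Gaussian

/-! ### The transport cost and the functional `𝓖` -/

section Transport

variable {n : ℕ}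

theorem integrable_sq_of_mem_P2 {ν : Measure (Euc n)} (hν : ν ∈ P2 n) :
    Integrable (fun x => ‖x‖ ^ 2) ν := by
  refine ⟨by fun_prop, ?_⟩
  have := hν.2
  simpa [HasFiniteIntegral, enorm_pow] using this

theorem mem_P2 {ν : Measure (Euc n)} [hp : IsProbabilityMeasure ν]
    (hν : Integrable (fun x => ‖x‖ ^ 2) ν) : ν ∈ P2 n := by
  refine ⟨hp, ?_⟩
  have := hν.2
  simpa [HasFiniteIntegral, enorm_pow] using this

theorem W2sq_comm (ν₁ ν₂ : Measure (Euc n)) : W2sq ν₁ ν₂ = W2sq ν₂ ν₁ := by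
  have key : ∀ ν₁ ν₂ : Measure (Euc n), W2sq ν₁ ν₂ ≤ W2sq ν₂ ν₁ := by
    intro ν₁ ν₂
    refine le_iInf₂ fun π hπ => ?_
    obtain ⟨hp, h1, h2⟩ := hπ
    have hmem : π.map Prod.swap ∈ transportPlans ν₁ ν₂ := ⟨Measure.isProbabilityMeasure_map
      measurable_swap.aemeasurable, by rw [Measure.fst_map_swap, h2],
      by rw [Measure.snd_map_swap, h1]⟩
    refine (iInf₂_le (π.map Prod.swap) hmem).trans ?_
    · rw [lintegral_map (by fun_prop) measurable_swap]
      simp only [Prod.fst_swap, Prod.snd_swap]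
      refine lintegral_mono fun p => ?_
      rw [← enorm_neg, neg_sub]
  exact le_antisymm (key _ _) (key _ _)

theorem G_comm (ν₁ ν₂ : Measure (Euc n)) : G ν₁ ν₂ = G ν₂ ν₁ := by
  rw [G, G, W2sq_comm, add_comm (gaussEntropy ν₁ : EReal)]

theorem ofReal_sq_div_two (x : Euc n) :
    ENNReal.ofReal (‖x‖ ^ 2 / 2) = ENNReal.ofReal (1 / 2) * ‖x‖ₑ ^ 2 := by
  rw [div_eq_inv_mul, ENNReal.ofReal_mul (by norm_num), ENNReal.ofReal_pow (norm_nonneg _),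
    ofReal_norm, one_div]

/-- Kantorovich duality: nearly optimal dual potentials. -/
theorem exists_dual_potentials {ν₁ ν₂ : Measure (Euc n)} (h₁ : ν₁ ∈ P2 n) (h₂ : ν₂ ∈ P2 n) {δ : ℝ}
    (hδ : 0 < δ) : W2sq ν₁ ν₂ ≠ ∞ ∧ ∃ φ ψ : Euc n → ℝ, QuadGrowth φ ∧ QuadGrowth ψ ∧
      (∀ x y, φ x + ψ y ≤ ‖x - y‖ ^ 2 / 2) ∧
      (W2sq ν₁ ν₂).toReal / 2 ≤ ∫ x, φ x ∂ν₁ + ∫ y, ψ y ∂ν₂ + δ := by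
  have := h₁.1
  have := h₂.1
  obtain ⟨π, hp, e1, e2, φ, ψ, hφ, hψ, hle, hpos, hπ⟩ := exists_coupling_le_dual
    (integrable_sq_of_mem_P2 h₁) (integrable_sq_of_mem_P2 h₂) hδ
  have hW : ENNReal.ofReal (1 / 2) * W2sq ν₁ ν₂ ≤
      ENNReal.ofReal (∫ x, φ x ∂ν₁ + ∫ y, ψ y ∂ν₂ + δ) := by
    refine le_trans ?_ hπ
    simp_rw [ofReal_sq_div_two]
    rw [lintegral_const_mul _ (by fun_prop)]
    gcongr
    exact iInf₂_le π ⟨hp, e1, e2⟩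
  have hfin : W2sq ν₁ ν₂ ≠ ∞ := by
    intro h
    rw [h, ENNReal.mul_top (by simp)] at hW
    exact absurd hW (by simp)
  refine ⟨hfin, φ, ψ, hφ, hψ, hle, ?_⟩
  have := ENNReal.toReal_mono ENNReal.ofReal_ne_top hW
  rw [ENNReal.toReal_mul, ENNReal.toReal_ofReal hpos, ENNReal.toReal_ofReal (by norm_num)] at this
  linarith

/-- Weak duality for the quadratic transport cost. -/
theorem dual_le_W2sq {ν₁ ν₂ : Measure (Euc n)} (hW : W2sq ν₁ ν₂ ≠ ∞) {φ ψ : Euc n → ℝ}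
    (hφ : Integrable φ ν₁) (hψ : Integrable ψ ν₂) (hle : ∀ x y, φ x + ψ y ≤ ‖x - y‖ ^ 2 / 2) :
    ∫ x, φ x ∂ν₁ + ∫ y, ψ y ∂ν₂ ≤ (W2sq ν₁ ν₂).toReal / 2 := by
  have key : ENNReal.ofReal (2 * (∫ x, φ x ∂ν₁ + ∫ y, ψ y ∂ν₂)) ≤ W2sq ν₁ ν₂ := by
    refine le_iInf₂ fun π hπ => ?_
    obtain ⟨hp, rfl, rfl⟩ := hπ
    rcases eq_or_ne (∫⁻ p, ‖p.1 - p.2‖ₑ ^ 2 ∂π) ∞ with h | h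
    · rw [h]; exact le_top
    have hi : Integrable (fun p : Euc n × Euc n => ‖p.1 - p.2‖ ^ 2) π := by
      refine ⟨Continuous.aestronglyMeasurable (by fun_prop), ?_⟩
      simpa [HasFiniteIntegral, enorm_pow] using lt_top_iff_ne_top.2 h
    have i1 : Integrable (fun p : Euc n × Euc n => φ p.1) π :=
      hφ.comp_measurable measurable_fst
    have i2 : Integrable (fun p : Euc n × Euc n => ψ p.2) π :=
      hψ.comp_measurable measurable_snd
    have e1 : ∫ x, φ x ∂π.fst = ∫ p, φ p.1 ∂π :=
      integral_map measurable_fst.aemeasurable hφ.1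
    have e2 : ∫ x, ψ x ∂π.snd = ∫ p, ψ p.2 ∂π :=
      integral_map measurable_snd.aemeasurable hψ.1
    have e3 : ∫⁻ p, ‖p.1 - p.2‖ₑ ^ 2 ∂π = ENNReal.ofReal (∫ p, ‖p.1 - p.2‖ ^ 2 ∂π) := by
      rw [ofReal_integral_eq_lintegral_ofReal hi (.of_forall fun p => by positivity)]
      refine lintegral_congr fun p => ?_
      rw [ENNReal.ofReal_pow (norm_nonneg _), ofReal_norm]
    rw [e3, e1, e2, ← integral_add i1 i2, ← integral_const_mul]
    refine ENNReal.ofReal_le_ofReal (integral_mono ((i1.add i2).const_mul 2) hi fun p => ?_)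
    have := hle p.1 p.2
    simp only
    linarith
  have := (ENNReal.ofReal_le_iff_le_toReal hW).1 key
  linarith

/-- The duality theorem also supplies a plan of finite cost, so no `∞ - ∞` arises here. -/
theorem G_eq_top {ν₁ ν₂ : Measure (Euc n)} (h₁ : ν₁ ∈ P2 n) (h₂ : ν₂ ∈ P2 n)
    (h : gaussEntropy ν₁ = ∞ ∨ gaussEntropy ν₂ = ∞) : G ν₁ ν₂ = ⊤ := by
  have hW := (exists_dual_potentials h₁ h₂ one_pos).1
  have hs : (gaussEntropy ν₁ : EReal) + (gaussEntropy ν₂ : EReal) = ⊤ := by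
    rw [← EReal.coe_ennreal_add]
    rcases h with h | h <;> simp [h]
  rw [G, hs, ← EReal.coe_ennreal_toReal hW, ← EReal.coe_mul]
  exact EReal.top_sub_coe _

theorem G_eq_coe {ν₁ ν₂ : Measure (Euc n)} (h₁ : ν₁ ∈ P2 n) (h₂ : ν₂ ∈ P2 n)
    (e₁ : gaussEntropy ν₁ ≠ ∞) (e₂ : gaussEntropy ν₂ ≠ ∞) :
    G ν₁ ν₂ = (((gaussEntropy ν₁).toReal + (gaussEntropy ν₂).toReal -
      (W2sq ν₁ ν₂).toReal / 2 : ℝ) : EReal) := by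
  have hW := (exists_dual_potentials h₁ h₂ one_pos).1
  rw [G, ← EReal.coe_ennreal_toReal hW, ← EReal.coe_ennreal_toReal e₁,
    ← EReal.coe_ennreal_toReal e₂]
  norm_cast
  congr 1; ring

end Transport

end InvSantalo

namespace InvSantalo

/-! ### Legendre transforms of real-valued functions -/

section Conjugate

variable {n : ℕ}

/-- The real-valued Legendre transform, meaningful when the supremum is finite. -/
noncomputable def lconj (f : Euc n → ℝ) (y : Euc n) : ℝ := ⨆ x, (inner ℝ x y - f x)

/-- The functions whose Legendre transform is finite everywhere. -/
def ConjFinite (f : Euc n → ℝ) : Prop := ∀ y, BddAbove (Set.range fun x => inner ℝ x y - f x)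

theorem ConjFinite.of_dual {f g : Euc n → ℝ} (h : ∀ x y, inner ℝ x y ≤ f x + g y) :
    ConjFinite f := fun y => ⟨g y, by rintro _ ⟨x, rfl⟩; have := h x y; simp only; linarith⟩

theorem ConjFinite.inner_le {f : Euc n → ℝ} (hf : ConjFinite f) (x y : Euc n) :
    inner ℝ x y ≤ f x + lconj f y := by
  have := le_ciSup (hf y) x
  simp only [lconj]
  linarith

theorem conj_le {f : Euc n → ℝ} {y : Euc n} {c : ℝ} (h : ∀ x, inner ℝ x y ≤ f x + c) :
    lconj f y ≤ c := ciSup_le fun x => by linarith [h x]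

theorem ConjFinite.conj {f : Euc n → ℝ} (hf : ConjFinite f) : ConjFinite (lconj f) :=
  ConjFinite.of_dual (g := f) fun x y => by
    rw [real_inner_comm]; linarith [hf.inner_le y x]

theorem ConjFinite.conj_conj_le {f : Euc n → ℝ} (hf : ConjFinite f) (x : Euc n) :
    lconj (lconj f) x ≤ f x := conj_le fun y => by
  rw [real_inner_comm]; linarith [hf.inner_le x y]

theorem ConjFinite.convexOn_conj {f : Euc n → ℝ} (hf : ConjFinite f) :
    ConvexOn ℝ Set.univ (lconj f) := by
  refine ⟨convex_univ, fun y _ z _ a b ha hb hab => conj_le fun x => ?_⟩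
  have h1 := mul_le_mul_of_nonneg_left (hf.inner_le x y) ha
  have h2 := mul_le_mul_of_nonneg_left (hf.inner_le x z) hb
  rw [inner_add_right, real_inner_smul_right, real_inner_smul_right, smul_eq_mul, smul_eq_mul]
  have : f x = a * f x + b * f x := by rw [← add_mul, hab, one_mul]
  linarith

theorem continuous_of_convexOn {f : Euc n → ℝ} (hf : ConvexOn ℝ Set.univ f) : Continuous f :=
  hf.locallyLipschitz.continuous

theorem ConjFinite.legendre_coe {f : Euc n → ℝ} (hf : ConjFinite f) :
    legendre (fun x => (f x : EReal)) = fun y => (lconj f y : EReal) := by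
  funext y
  refine le_antisymm (iSup_le fun x => ?_) ?_
  · have := hf.inner_le x y
    rw [← EReal.coe_sub, EReal.coe_le_coe_iff]
    linarith
  · refine EReal.le_of_forall_lt_iff_le.1 fun z hz => ?_
    have hz' : (lconj f y : EReal) ≤ z := by
      have h2 : ∀ x, ((inner ℝ x y : ℝ) : EReal) - (f x : EReal) < (z : EReal) := fun x =>
        (le_iSup (fun x => ((inner ℝ x y : ℝ) : EReal) - (f x : EReal)) x).trans_lt hz
      norm_cast
      refine conj_le fun x => ?_
      have := h2 x
      norm_cast at this
      linarith
    exact hz'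

theorem intExpNeg_coe (f : Euc n → ℝ) :
    intExpNeg (fun x => (f x : EReal)) = ∫⁻ x, ENNReal.ofReal (Real.exp (-f x)) := by
  simp only [intExpNeg]
  refine lintegral_congr fun x => ?_
  rw [← EReal.coe_neg, EReal.exp_coe]

theorem coe_mem_convexFun {f : Euc n → ℝ} (hf : ConvexOn ℝ Set.univ f) :
    (fun x => (f x : EReal)) ∈ convexFun n := by
  refine ⟨(continuous_coe_real_ereal.comp (continuous_of_convexOn hf)).lowerSemicontinuous,
    fun x => EReal.coe_ne_bot _, ⟨0, EReal.coe_ne_top _⟩, fun x y a b ha hb hab => ?_⟩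
  have := hf.2 (Set.mem_univ x) (Set.mem_univ y) ha hb hab
  simp only [smul_eq_mul] at this
  beta_reduce
  exact_mod_cast this

theorem conj_comp_isometry (σ : Euc n ≃ₗᵢ[ℝ] Euc n) {f : Euc n → ℝ} (hf : ∀ x, f (σ x) = f x)
    (y : Euc n) : lconj f (σ y) = lconj f y := by
  rw [lconj, lconj, ← σ.surjective.iSup_comp]
  congr 1; ext x
  rw [σ.inner_map_map, hf]

end Conjugate

/-! ### Convex functions of quadratic growth -/

section Nice

variable {n : ℕ}

/-- Convex functions that grow exactly quadratically. -/
structure Nice (F : Euc n → ℝ) : Prop where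
  convexOn : ConvexOn ℝ Set.univ F
  lower : ∃ a C : ℝ, 0 < a ∧ ∀ x, a * ‖x‖ ^ 2 - C ≤ F x
  upper : ∃ C : ℝ, ∀ x, F x ≤ C * (1 + ‖x‖ ^ 2)

theorem Nice.continuous {F : Euc n → ℝ} (hF : Nice F) : Continuous F :=
  continuous_of_convexOn hF.convexOn

theorem inner_le_quad {a : ℝ} (ha : 0 < a) (x y : Euc n) :
    inner ℝ x y ≤ a * ‖x‖ ^ 2 + (4 * a)⁻¹ * ‖y‖ ^ 2 := by
  have h1 := real_inner_le_norm x y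
  have h2 := sq_nonneg (2 * a * ‖x‖ - ‖y‖)
  have h3 : a * ‖x‖ ^ 2 + (4 * a)⁻¹ * ‖y‖ ^ 2 - ‖x‖ * ‖y‖ =
      (4 * a)⁻¹ * (2 * a * ‖x‖ - ‖y‖) ^ 2 := by field_simp; ring
  have : 0 ≤ (4 * a)⁻¹ * (2 * a * ‖x‖ - ‖y‖) ^ 2 := by positivity
  linarith

theorem Nice.conjFinite {F : Euc n → ℝ} (hF : Nice F) : ConjFinite F := by
  obtain ⟨a, C, ha, h⟩ := hF.lower
  exact ConjFinite.of_dual (g := fun y => (4 * a)⁻¹ * ‖y‖ ^ 2 + C) fun x y => by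
    linarith [h x, inner_le_quad ha x y]

/-- Conjugation exchanges the two quadratic bounds. The lower one results from testing the supremum
at `y / (2(|C| + 1))`, the maximizer of `⟨x, y⟩ - (|C| + 1)|x|²`. -/
theorem Nice.conj {F : Euc n → ℝ} (hF : Nice F) : Nice (lconj F) := by
  refine ⟨hF.conjFinite.convexOn_conj, ?_, ?_⟩
  · obtain ⟨C, h⟩ := hF.upper
    have hC : 0 < |C| + 1 := by positivity
    refine ⟨(4 * (|C| + 1))⁻¹, |C| + 1, by positivity, fun y => ?_⟩
    have h1 := hF.conjFinite.inner_le ((2 * (|C| + 1))⁻¹ • y) y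
    have h2 := h ((2 * (|C| + 1))⁻¹ • y)
    rw [real_inner_smul_left, real_inner_self_eq_norm_sq] at h1
    rw [norm_smul, Real.norm_eq_abs, abs_of_pos (a := (2 * (|C| + 1))⁻¹) (by positivity), mul_pow] at h2
    have h3 : C * (1 + (2 * (|C| + 1))⁻¹ ^ 2 * ‖y‖ ^ 2) ≤
        (|C| + 1) * (1 + (2 * (|C| + 1))⁻¹ ^ 2 * ‖y‖ ^ 2) := by
      gcongr; linarith [le_abs_self C]
    have h4 : (|C| + 1) * (1 + (2 * (|C| + 1))⁻¹ ^ 2 * ‖y‖ ^ 2) =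
      (|C| + 1) + (4 * (|C| + 1))⁻¹ * ‖y‖ ^ 2 := by field_simp; norm_num [mul_comm]
    have h5 : (2 * (|C| + 1))⁻¹ * ‖y‖ ^ 2 = 2 * ((4 * (|C| + 1))⁻¹ * ‖y‖ ^ 2) := by
      field_simp; norm_num [mul_comm]
    linarith
  · obtain ⟨a, C, ha, h⟩ := hF.lower
    refine ⟨(4 * a)⁻¹ + |C|, fun y => conj_le fun x => ?_⟩
    have : 0 ≤ (4 * a)⁻¹ := by positivity
    nlinarith [h x, inner_le_quad ha x y, le_abs_self C, mul_nonneg (abs_nonneg C) (sq_nonneg ‖y‖)]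

theorem Nice.abs_le {F : Euc n → ℝ} (hF : Nice F) : ∃ C, 0 ≤ C ∧ ∀ x, |F x| ≤ C * (1 + ‖x‖ ^ 2) := by
  obtain ⟨a, C, ha, h⟩ := hF.lower
  obtain ⟨D, h'⟩ := hF.upper
  refine ⟨|C| + |D|, by positivity, fun x => _root_.abs_le.2 ⟨?_, ?_⟩⟩
  · nlinarith [h x, le_abs_self C, abs_nonneg D, mul_nonneg (abs_nonneg C) (sq_nonneg ‖x‖),
      mul_nonneg (abs_nonneg D) (sq_nonneg ‖x‖), mul_nonneg ha.le (sq_nonneg ‖x‖)]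
  · nlinarith [h' x, abs_nonneg C, mul_nonneg (abs_nonneg C) (sq_nonneg ‖x‖),
      mul_le_mul_of_nonneg_right (le_abs_self D) (by positivity : 0 ≤ 1 + ‖x‖ ^ 2)]

theorem Nice.quadGrowth {F : Euc n → ℝ} (hF : Nice F) : QuadGrowth F := by
  obtain ⟨C, -, h⟩ := hF.abs_le
  exact ⟨hF.continuous, C, h⟩

/-- Exponential integrability below a Gaussian. -/
theorem integrable_exp_of_le {F : Euc n → ℝ} (hF : Measurable F) {a C : ℝ} (ha : 0 < a)
    (h : ∀ x, F x ≤ C - a * ‖x‖ ^ 2) : Integrable fun x => Real.exp (F x) := by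
  refine ((integrable_exp_neg_mul_sq (n := n) ha).const_mul (Real.exp C)).mono'
    (hF.exp).aestronglyMeasurable (.of_forall fun x => ?_)
  rw [Real.norm_eq_abs, Real.abs_exp, ← Real.exp_add]
  exact Real.exp_le_exp.2 (by linarith [h x])

theorem integrable_sq_mul_exp_of_le {F : Euc n → ℝ} (hF : Measurable F) {a C : ℝ} (ha : 0 < a)
    (h : ∀ x, F x ≤ C - a * ‖x‖ ^ 2) : Integrable fun x => Real.exp (F x) * ‖x‖ ^ 2 := by
  have h1 : Integrable fun x : Euc n => Real.exp (F x + (a / 2) * ‖x‖ ^ 2) :=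
    integrable_exp_of_le (by fun_prop) (half_pos ha) (C := C) fun x => by linarith [h x]
  refine (h1.const_mul (2 / a)).mono' (by fun_prop) (.of_forall fun x => ?_)
  rw [Real.norm_eq_abs, abs_of_nonneg (by positivity), Real.exp_add]
  -- Half of the Gaussian decay absorbs the factor `|x|²`.
  have h2 := Real.add_one_le_exp ((a / 2) * ‖x‖ ^ 2)
  have h3 : ‖x‖ ^ 2 ≤ 2 / a * Real.exp ((a / 2) * ‖x‖ ^ 2) := by
    rw [div_mul_eq_mul_div, le_div_iff₀ ha]; linarith
  calc _ ≤ Real.exp (F x) * (2 / a * Real.exp ((a / 2) * ‖x‖ ^ 2)) := by gcongr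
    _ = _ := by ring

/-- The second moment of the Gibbs measure of a function with quadratic lower bound. -/
theorem integrable_sq_tilted {F : Euc n → ℝ} (hF : Measurable F) {a C : ℝ} (ha : 0 < a)
    (h : ∀ x, a * ‖x‖ ^ 2 - C ≤ F x) :
    Integrable (fun x => ‖x‖ ^ 2) ((volume : Measure (Euc n)).tilted fun x => -F x) := by
  have hF' : Measurable fun x => -F x := hF.neg
  have h' : ∀ x, -F x ≤ C - a * ‖x‖ ^ 2 := fun x => by linarith [h x]
  rw [integrable_tilted_iff (integrable_exp_of_le hF' ha h')]
  simpa using integrable_sq_mul_exp_of_le hF' ha h'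

theorem Nice.integrable_exp {F : Euc n → ℝ} (hF : Nice F) :
    Integrable fun x => Real.exp (-F x) := by
  obtain ⟨a, C, ha, h⟩ := hF.lower
  have hF' : Measurable fun x => -F x := hF.continuous.measurable.neg
  exact integrable_exp_of_le hF' ha (C := C) fun x => by linarith [h x]

theorem Nice.integrable_sq {F : Euc n → ℝ} (hF : Nice F) :
    Integrable (fun x => ‖x‖ ^ 2) ((volume : Measure (Euc n)).tilted fun x => -F x) := by
  obtain ⟨a, C, ha, h⟩ := hF.lower
  exact integrable_sq_tilted hF.continuous.measurable ha h

end Nice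

/-! ### Gradients of convex functions -/

section Gradient

variable {n : ℕ}

/-- Convex functions are locally Lipschitz, so Rademacher's theorem applies near every point. -/
theorem ae_differentiableAt_of_convexOn {f : Euc n → ℝ} (hf : ConvexOn ℝ Set.univ f) :
    ∀ᵐ x, DifferentiableAt ℝ f x := by
  refine measure_null_of_locally_null _ fun x _ => ?_
  obtain ⟨K, t, ht, hK⟩ := hf.locallyLipschitz x
  obtain ⟨u, hut, huo, hxu⟩ := mem_nhds_iff.1 ht
  refine ⟨{y | ¬ DifferentiableAt ℝ f y} ∩ u, Filter.inter_mem self_mem_nhdsWithin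
    (mem_nhdsWithin_of_mem_nhds (huo.mem_nhds hxu)), ?_⟩
  refine measure_mono_null ?_ (ae_iff.1 ((hK.mono hut).ae_differentiableWithinAt_of_mem
    (μ := (volume : Measure (Euc n)))))
  rintro y ⟨hy1, hy2⟩ h
  exact hy1 ((h hy2).differentiableAt (huo.mem_nhds hy2))

theorem convexOn_gradient_le {f : Euc n → ℝ} (hf : ConvexOn ℝ Set.univ f) {x : Euc n}
    (hx : DifferentiableAt ℝ f x) (z : Euc n) : f x + inner ℝ (gradient f x) (z - x) ≤ f z := by
  have h1 : HasDerivAt (fun t : ℝ => f (x + t • (z - x))) (inner ℝ (gradient f x) (z - x)) 0 := by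
    have h2 := hx.hasGradientAt.hasFDerivAt
    have h3 : HasDerivAt (fun t : ℝ => x + t • (z - x)) (z - x) 0 := by
      simpa using ((hasDerivAt_id (0 : ℝ)).smul_const (z - x)).const_add x
    have h4 : HasFDerivAt f ((InnerProductSpace.toDual ℝ (Euc n)) (gradient f x))
      (x + (0 : ℝ) • (z - x)) := by simpa using h2
    have h5 := h4.comp_hasDerivAt (0 : ℝ) h3
    rw [InnerProductSpace.toDual_apply_apply] at h5
    exact h5
  have h5 := h1.tendsto_slope.mono_left (nhdsWithin_mono 0 (s := Set.Ioi 0)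
    fun t ht => (ne_of_gt ht : t ≠ 0))
  have h6 : ∀ᶠ t : ℝ in nhdsWithin 0 (Set.Ioi 0),
      slope (fun t : ℝ => f (x + t • (z - x))) 0 t ≤ f z - f x := by
    filter_upwards [Ioo_mem_nhdsGT (zero_lt_one' ℝ)] with t ht
    have h7 := hf.2 (Set.mem_univ x) (Set.mem_univ z) (sub_nonneg.2 ht.2.le) ht.1.le (by ring)
    rw [slope_def_field, sub_zero, zero_smul, add_zero, div_le_iff₀ ht.1]
    have h8 : x + t • (z - x) = (1 - t) • x + t • z := by module
    rw [h8]
    simp only [smul_eq_mul] at h7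
    linarith
  have := le_of_tendsto h5 h6
  linarith

theorem measurable_gradient (f : Euc n → ℝ) : Measurable (gradient f) :=
  (InnerProductSpace.toDual ℝ (Euc n)).symm.continuous.measurable.comp (measurable_fderiv ℝ f)

/-- Equality in Young's inequality. -/
theorem inner_gradient_eq {f : Euc n → ℝ} (hf : ConvexOn ℝ Set.univ f) {x : Euc n}
    (hx : DifferentiableAt ℝ f x) : f x + lconj f (gradient f x) ≤ inner ℝ x (gradient f x) := by
  have : lconj f (gradient f x) ≤ inner ℝ x (gradient f x) - f x := conj_le fun z => by
    have := convexOn_gradient_le hf hx z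
    rw [inner_sub_right, real_inner_comm, real_inner_comm x] at this
    linarith
  linarith

theorem gradient_comp_isometry (σ : Euc n ≃ₗᵢ[ℝ] Euc n) {f : Euc n → ℝ}
    (hf : ∀ x, f (σ x) = f x) (x : Euc n) : gradient f (σ x) = σ (gradient f x) := by
  have h1 : f ∘ σ.toContinuousLinearEquiv = f := funext hf
  have h2 : fderiv ℝ f x = (fderiv ℝ f (σ x)).comp (σ.toContinuousLinearEquiv : Euc n →L[ℝ] Euc n) := by
    conv_lhs => rw [← h1]
    exact σ.toContinuousLinearEquiv.comp_right_fderiv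
  refine ext_inner_right ℝ fun v => ?_
  obtain ⟨w, rfl⟩ := σ.surjective v
  rw [σ.inner_map_map]
  simp only [gradient, InnerProductSpace.toDual_symm_apply, h2]
  rfl

/-- Young's equality gives `F*(∇F) ≤ ⟨x, ∇F⟩ - F(x)`; the left side grows quadratically in `∇F`, and
half of that growth absorbs the inner product. -/
theorem Nice.gradient_le {F : Euc n → ℝ} (hF : Nice F) :
    ∃ C, 0 ≤ C ∧ ∀ x, ‖gradient F x‖ ^ 2 ≤ C * (1 + ‖x‖ ^ 2) := by
  obtain ⟨a, C, ha, h⟩ := hF.conj.lower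
  obtain ⟨D, hD, h'⟩ := hF.abs_le
  refine ⟨(2 / a) * (|C| + D + (2 * a)⁻¹), by positivity, fun x => ?_⟩
  by_cases hx : DifferentiableAt ℝ F x
  · have h1 := inner_gradient_eq hF.convexOn hx
    have h2 := h (gradient F x)
    have h3 := inner_le_quad (half_pos ha) (gradient F x) x
    rw [real_inner_comm] at h3
    have h4 := (_root_.abs_le.1 (h' x)).1
    rw [show 4 * (a / 2) = 2 * a by ring] at h3
    have h6 : a / 2 * ‖gradient F x‖ ^ 2 ≤ (|C| + D + (2 * a)⁻¹) * (1 + ‖x‖ ^ 2) := by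
      have : 0 ≤ (2 * a)⁻¹ := by positivity
      nlinarith [le_abs_self C, mul_nonneg (abs_nonneg C) (sq_nonneg ‖x‖)]
    have h7 : ‖gradient F x‖ ^ 2 = (2 / a) * (a / 2 * ‖gradient F x‖ ^ 2) := by field_simp
    rw [h7, mul_assoc]
    gcongr
  -- Where `F` is not differentiable the gradient has the default value `0`.
  · have : gradient F x = 0 := by
      rw [gradient, fderiv_zero_of_not_differentiableAt hx, map_zero]
    rw [this]; rw [norm_zero, zero_pow two_ne_zero]; positivity

end Gradient

end InvSantalo

namespace InvSantalo

/-! ### The variational inequality for moment measures -/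

section Moment

open ProbabilityTheory

variable {n : ℕ}

/-- The defect `φ - F*` evaluated at the gradient of `F`. -/
noncomputable def gradDefect (F φ : Euc n → ℝ) (x : Euc n) : ℝ :=
  φ (gradient F x) - lconj F (gradient F x)

theorem measurable_gradDefect {F φ : Euc n → ℝ} (hF : Nice F) (hφ : QuadGrowth φ) :
    Measurable (gradDefect F φ) :=
  (hφ.1.measurable.comp (measurable_gradient F)).sub
    (hF.conj.continuous.measurable.comp (measurable_gradient F))

theorem abs_gradDefect_le {F φ : Euc n → ℝ} (hF : Nice F) (hφ : QuadGrowth φ) :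
    ∃ K, 0 ≤ K ∧ ∀ x, |gradDefect F φ x| ≤ K * (1 + ‖x‖ ^ 2) := by
  obtain ⟨-, C, hC⟩ := hφ.sub hF.conj.quadGrowth
  obtain ⟨D, hD, hD'⟩ := hF.gradient_le
  refine ⟨|C| * (1 + D), by positivity, fun x => (hC (gradient F x)).trans ?_⟩
  have h1 : 0 ≤ 1 + ‖gradient F x‖ ^ 2 := by positivity
  calc C * (1 + ‖gradient F x‖ ^ 2) ≤ |C| * (1 + ‖gradient F x‖ ^ 2) := by
        gcongr; exact le_abs_self C
    _ ≤ |C| * ((1 + D) * (1 + ‖x‖ ^ 2)) := by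
        gcongr; nlinarith [hD' x, sq_nonneg ‖x‖]
    _ = _ := by ring

theorem integrable_exp_neg_add_of_le {F X : Euc n → ℝ} (hF : Nice F) (hX : Measurable X) {K : ℝ}
    (hK0 : 0 ≤ K) (hK : ∀ x, |X x| ≤ K * (1 + ‖x‖ ^ 2)) :
    ∃ t₀ > 0, ∀ t : ℝ, |t| < t₀ → Integrable fun x => Real.exp (-F x + t * X x) := by
  obtain ⟨a, C, ha, h⟩ := hF.lower
  -- This threshold gives `|t| K ≤ a / 2`, so half of the quadratic growth of `F` survives.
  refine ⟨a / (2 * (K + 1)), by positivity, fun t ht => ?_⟩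
  refine integrable_exp_of_le (by have := hF.continuous.measurable; fun_prop) (half_pos ha)
    (C := C + a / 2) fun x => ?_
  rw [lt_div_iff₀ (by positivity)] at ht
  have h1 : t * X x ≤ |t| * (K * (1 + ‖x‖ ^ 2)) := by
    refine (le_abs_self _).trans ?_
    rw [abs_mul]
    gcongr; exact hK x
  have h2 : |t| * K ≤ a / 2 := by nlinarith [abs_nonneg t]
  have h3 : |t| * (K * (1 + ‖x‖ ^ 2)) ≤ a / 2 * (1 + ‖x‖ ^ 2) := by
    rw [← mul_assoc]; gcongr
  linarith [h x]

/-- The Prékopa–Leindler inequality along the interpolation of the Legendre transforms. -/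
theorem prekopaLeindler_conj {F g φ : Euc n → ℝ} (hF : Nice F) (hg : QuadGrowth g)
    (hd : ∀ x y, inner ℝ x y ≤ g x + φ y) {t : ℝ} (h0 : 0 < t) (h1 : t < 1) :
    (∫⁻ x, ENNReal.ofReal (Real.exp (-F x))) ^ (1 - t) *
      (∫⁻ x, ENNReal.ofReal (Real.exp (-g x))) ^ t ≤
        ∫⁻ x, ENNReal.ofReal (Real.exp (-F x + t * gradDefect F φ x)) := by
  -- The transform of this interpolation satisfies `w*((1 - t)x + ty) ≤ (1 - t) F(x) + t g(y)`, the
  -- hypothesis of Prékopa–Leindler for `e^{-F}`, `e^{-g}` and `e^{-w*}`.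
  set w : Euc n → ℝ := fun y => (1 - t) * lconj F y + t * φ y with hw
  have h1' : 0 < 1 - t := by linarith
  have hle : ∀ x y z, inner ℝ ((1 - t) • x + t • y) z ≤ ((1 - t) * F x + t * g y) + w z := by
    intro x y z
    have e1 := mul_le_mul_of_nonneg_left (hF.conjFinite.inner_le x z) h1'.le
    have e2 := mul_le_mul_of_nonneg_left (hd y z) h0.le
    rw [inner_add_left, real_inner_smul_left, real_inner_smul_left]
    simp only [hw]
    linarith
  have hwfin : ConjFinite w := ConjFinite.of_dual (g := fun x => (1 - t) * F x + t * g x) fun z x => by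
    have := hle x x z
    rw [← add_smul, sub_add_cancel, one_smul, real_inner_comm] at this
    linarith
  have hu : Continuous (lconj w) := continuous_of_convexOn hwfin.convexOn_conj
  have hFm := hF.continuous.measurable
  have hgm := hg.1.measurable
  refine (prekopaLeindler_euclideanSpace h0 h1 n
    (fun x => ENNReal.ofReal (Real.exp (-F x))) (fun x => ENNReal.ofReal (Real.exp (-g x)))
    (fun x => ENNReal.ofReal (Real.exp (-lconj w x))) (by fun_prop) (by fun_prop)
    (by have := hu.measurable; fun_prop) fun x y => ?_).trans ?_
  · rw [ENNReal.ofReal_rpow_of_pos (Real.exp_pos _), ENNReal.ofReal_rpow_of_pos (Real.exp_pos _),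
      ← ENNReal.ofReal_mul (by positivity), ← Real.exp_mul, ← Real.exp_mul, ← Real.exp_add]
    refine ENNReal.ofReal_le_ofReal (Real.exp_le_exp.2 ?_)
    have : lconj w ((1 - t) • x + t • y) ≤ (1 - t) * F x + t * g y := conj_le fun z => by
      rw [real_inner_comm]; linarith [hle x y z]
    linarith
  · refine lintegral_mono_ae ?_
    filter_upwards [ae_differentiableAt_of_convexOn hF.convexOn] with x hx
    refine ENNReal.ofReal_le_ofReal (Real.exp_le_exp.2 ?_)
    -- Testing `w*` at `∇F(x)` and using equality in Young's inequality there gives `w* ≥ F - t (φ -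
    -- F*)(∇F)`.
    have e1 := inner_gradient_eq hF.convexOn hx
    have e2 := hwfin.inner_le (gradient F x) x
    rw [real_inner_comm] at e2
    simp only [hw] at e2
    simp only [gradDefect]
    linarith

/-- The moment measure of `F` minimizes `g ↦ ∫ g* - log ∫ e^{-g}`: variational inequality. -/
theorem log_integral_sub_le_integral_gradDefect {F g φ : Euc n → ℝ} (hF : Nice F)
    (hg : QuadGrowth g) (hφ : QuadGrowth φ) (hd : ∀ x y, inner ℝ x y ≤ g x + φ y) :
    Integrable (fun x => Real.exp (-g x)) ∧
      Real.log (∫ x, Real.exp (-g x)) - Real.log (∫ x, Real.exp (-F x)) ≤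
        ∫ x, gradDefect F φ x ∂((volume : Measure (Euc n)).tilted fun x => -F x) := by
  have hXm := measurable_gradDefect hF hφ
  obtain ⟨K, hK0, hK⟩ := abs_gradDefect_le hF hφ
  obtain ⟨t₀, ht₀, hint⟩ := integrable_exp_neg_add_of_le hF hXm hK0 hK
  have hFi := hF.integrable_exp
  have hFm := hF.continuous.measurable
  have hgm := hg.1.measurable
  have hZF : 0 < ∫ x, Real.exp (-F x) := integral_exp_pos hFi
  have hFl : ∫⁻ x, ENNReal.ofReal (Real.exp (-F x)) = ENNReal.ofReal (∫ x, Real.exp (-F x)) :=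
    (ofReal_integral_eq_lintegral_ofReal hFi (.of_forall fun x => (Real.exp_pos _).le)).symm
  have key : ∀ t, 0 < t → t < 1 → t < t₀ → (∫⁻ x, ENNReal.ofReal (Real.exp (-F x))) ^ (1 - t) *
      (∫⁻ x, ENNReal.ofReal (Real.exp (-g x))) ^ t ≤
        ENNReal.ofReal (∫ x, Real.exp (-F x + t * gradDefect F φ x)) := by
    intro t h0 h1 h2
    rw [ofReal_integral_eq_lintegral_ofReal (hint t (by rwa [abs_of_pos h0]))
      (.of_forall fun x => (Real.exp_pos _).le)]
    exact prekopaLeindler_conj hF hg hd h0 h1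
  -- If `∫ e^{-g}` were infinite, so would be the left side of `key`, whereas its right side is
  -- finite.
  have hgi : Integrable (fun x => Real.exp (-g x)) := by
    refine ⟨by fun_prop, ?_⟩
    rw [hasFiniteIntegral_iff_ofReal (.of_forall fun x => (Real.exp_pos _).le)]
    by_contra hcon
    have htop := not_lt_top_iff.1 hcon
    set t := min (1 / 2) (t₀ / 2) with ht
    have h0 : 0 < t := lt_min (by norm_num) (half_pos ht₀)
    have h1 : t < 1 := (min_le_left _ _).trans_lt (by norm_num)
    have h2 : t < t₀ := (min_le_right _ _).trans_lt (half_lt_self ht₀)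
    have h3 := key t h0 h1 h2
    rw [htop, ENNReal.top_rpow_of_pos h0, ENNReal.mul_top] at h3
    · exact absurd h3 (by simp)
    · rw [hFl]
      exact (ENNReal.rpow_pos (by simpa using hZF) ENNReal.ofReal_ne_top).ne'
  refine ⟨hgi, ?_⟩
  have hZg : 0 < ∫ x, Real.exp (-g x) := integral_exp_pos hgi
  have hgl : ∫⁻ x, ENNReal.ofReal (Real.exp (-g x)) = ENNReal.ofReal (∫ x, Real.exp (-g x)) :=
    (ofReal_integral_eq_lintegral_ofReal hgi (.of_forall fun x => (Real.exp_pos _).le)).symm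
  set μ := (volume : Measure (Euc n)).tilted fun x => -F x with hμ
  have hp : IsProbabilityMeasure μ := isProbabilityMeasure_tilted hFi
  set D := Real.log (∫ x, Real.exp (-g x)) - Real.log (∫ x, Real.exp (-F x)) with hD
  -- After division by `∫ e^{-F}`, Prékopa–Leindler bounds `e^{tD}`, hence `1 + tD`, by the moment
  -- generating function of the defect. Both equal `1` at `t = 0`, so the slopes there compare.
  have hmgf : ∀ t, 0 < t → t < 1 → t < t₀ → 1 + t * D ≤ mgf (gradDefect F φ) μ t := by
    intro t h0 h1 h2
    have h3 := key t h0 h1 h2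
    rw [hFl, hgl, ENNReal.ofReal_rpow_of_pos hZF, ENNReal.ofReal_rpow_of_pos hZg,
      ← ENNReal.ofReal_mul (by positivity), ENNReal.ofReal_le_ofReal_iff (by positivity)] at h3
    have h4 : mgf (gradDefect F φ) μ t =
        (∫ x, Real.exp (-F x + t * gradDefect F φ x)) / ∫ x, Real.exp (-F x) := by
      rw [mgf, hμ, integral_exp_tilted]
      simp only [Pi.add_apply]
    rw [h4, le_div_iff₀ hZF]
    refine le_trans ?_ h3
    have h5 : (∫ x, Real.exp (-F x)) ^ (1 - t) * (∫ x, Real.exp (-g x)) ^ t =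
        Real.exp (t * D) * ∫ x, Real.exp (-F x) := by
      rw [Real.rpow_def_of_pos hZF, Real.rpow_def_of_pos hZg, ← Real.exp_add]
      conv_rhs => rhs; rw [← Real.exp_log hZF]
      rw [← Real.exp_add]
      congr 1
      rw [hD]; ring
    rw [h5]
    gcongr
    linarith [Real.add_one_le_exp (t * D)]
  have h0mem : (0 : ℝ) ∈ interior (integrableExpSet (gradDefect F φ) μ) := by
    refine mem_interior_iff_mem_nhds.2 (Filter.mem_of_superset (Metric.ball_mem_nhds 0 ht₀) ?_)
    intro t ht
    rw [mem_ball_zero_iff, Real.norm_eq_abs] at ht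
    change Integrable _ _
    rw [hμ, integrable_tilted_iff hFi]
    refine (hint t ht).congr (.of_forall fun x => ?_)
    simp only [smul_eq_mul, Real.exp_add]
  have hder := hasDerivAt_mgf h0mem
  simp only [zero_mul, Real.exp_zero, mul_one] at hder
  have hslope := hder.tendsto_slope.mono_left (nhdsWithin_mono 0 (s := Set.Ioi 0)
    fun t ht => (ne_of_gt ht : t ≠ 0))
  refine ge_of_tendsto hslope ?_
  filter_upwards [Ioo_mem_nhdsGT (lt_min one_pos ht₀)] with t ht
  rw [slope_def_field, mgf_zero, sub_zero, le_div_iff₀ ht.1]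
  linarith [hmgf t ht.1 (ht.2.trans_le (min_le_left _ _)) (ht.2.trans_le (min_le_right _ _))]

end Moment

end InvSantalo

namespace InvSantalo

/-! ### Gaussian smoothing of measures -/

section Smoothing

open ProbabilityTheory

variable {n : ℕ}

theorem stdGaussian_integrable_sq : Integrable (fun x : Euc n => ‖x‖ ^ 2) (stdGaussian (Euc n)) := by
  rw [stdGaussian_eq_tilted]
  exact integrable_sq_tilted (F := fun x => ‖x‖ ^ 2 / 2) (by fun_prop) (a := 1 / 2) (C := 0)
    (by norm_num) fun x => by linarith

theorem stdGaussian_integrable_id : Integrable (fun x : Euc n => x) (stdGaussian (Euc n)) := by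
  refine ((integrable_const (1 : ℝ)).add stdGaussian_integrable_sq).mono' (by fun_prop)
    (.of_forall fun x => ?_)
  simp only [Pi.add_apply]
  nlinarith [sq_nonneg (‖x‖ - 1), sq_nonneg ‖x‖]

theorem stdGaussian_le_smul_volume : stdGaussian (Euc n) ≤
    ENNReal.ofReal (((2 * Real.pi) ^ ((n : ℝ) / 2))⁻¹) • volume := by
  rw [stdGaussian_eq_tilted, Measure.tilted, ← withDensity_const]
  refine withDensity_mono (.of_forall fun x => ENNReal.ofReal_le_ofReal ?_)
  rw [integral_exp_neg_sq_div_two, div_eq_mul_inv]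
  refine mul_le_of_le_one_left (by positivity) (Real.exp_le_one_iff.2 ?_)
  have : 0 ≤ ‖x‖ ^ 2 := by positivity
  linarith

/-- The convolution of `ν` with the centered Gaussian of standard deviation `ε`. -/
noncomputable def smooth (ε : ℝ) (ν : Measure (Euc n)) : Measure (Euc n) :=
  (ν.prod (stdGaussian (Euc n))).map fun p => p.1 + ε • p.2

instance isProbabilityMeasure_smooth (ε : ℝ) (ν : Measure (Euc n)) [IsProbabilityMeasure ν] :
    IsProbabilityMeasure (smooth ε ν) :=
  Measure.isProbabilityMeasure_map (by fun_prop)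

theorem integrable_prod_sq {ν : Measure (Euc n)} [IsProbabilityMeasure ν]
    (hν : Integrable (fun x => ‖x‖ ^ 2) ν) : Integrable (fun p : Euc n × Euc n =>
      1 + 2 * ‖p.1‖ ^ 2 + 2 * ‖p.2‖ ^ 2) (ν.prod (stdGaussian (Euc n))) :=
  ((integrable_const 1).add ((hν.comp_fst _).const_mul 2)).add
    ((stdGaussian_integrable_sq.comp_snd _).const_mul 2)

theorem norm_add_smul_sq_le {ε : ℝ} (hε : |ε| ≤ 1) (x z : Euc n) :
    ‖x + ε • z‖ ^ 2 ≤ 2 * ‖x‖ ^ 2 + 2 * ‖z‖ ^ 2 := by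
  have h1 : ‖x + ε • z‖ ≤ ‖x‖ + ‖z‖ := (norm_add_le _ _).trans (by
    rw [norm_smul, Real.norm_eq_abs]
    gcongr
    exact mul_le_of_le_one_left (norm_nonneg z) hε)
  nlinarith [norm_nonneg (x + ε • z), sq_nonneg (‖x‖ - ‖z‖), norm_nonneg x, norm_nonneg z]

theorem integrable_sq_smooth {ν : Measure (Euc n)} [IsProbabilityMeasure ν]
    (hν : Integrable (fun x => ‖x‖ ^ 2) ν) {ε : ℝ} (hε : |ε| ≤ 1) :
    Integrable (fun x => ‖x‖ ^ 2) (smooth ε ν) := by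
  refine (integrable_map_measure (by fun_prop) (by fun_prop)).2
    ((integrable_prod_sq hν).mono' (by fun_prop) (.of_forall fun p => ?_))
  simp only [Function.comp_apply]
  rw [Real.norm_eq_abs, abs_of_nonneg (by positivity)]
  linarith [norm_add_smul_sq_le hε p.1 p.2]

theorem tendsto_integral_smooth {ν : Measure (Euc n)} [IsProbabilityMeasure ν]
    (hν : Integrable (fun x => ‖x‖ ^ 2) ν) {f : Euc n → ℝ} (hf : QuadGrowth f) {ε : ℕ → ℝ}
    (hε : ∀ k, |ε k| ≤ 1) (hlim : Filter.Tendsto ε Filter.atTop (nhds 0)) :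
    Filter.Tendsto (fun k => ∫ x, f x ∂(smooth (ε k) ν)) Filter.atTop (nhds (∫ x, f x ∂ν)) := by
  obtain ⟨hc, C, hC⟩ := hf
  have e1 : ∀ k, ∫ x, f x ∂(smooth (ε k) ν) =
      ∫ p, f (p.1 + ε k • p.2) ∂(ν.prod (stdGaussian (Euc n))) := fun k =>
    integral_map (by fun_prop) hc.aestronglyMeasurable
  have e2 : ∫ x, f x ∂ν = ∫ p, f p.1 ∂(ν.prod (stdGaussian (Euc n))) := by
    rw [integral_fun_fst]; simp
  simp_rw [e1, e2]
  refine tendsto_integral_of_dominated_convergence _ (fun k => Continuous.aestronglyMeasurable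
    (by fun_prop)) ((integrable_prod_sq hν).const_mul |C|) (fun k => .of_forall fun p => ?_)
    (.of_forall fun p => ?_)
  · refine (hC _).trans ((mul_le_mul_of_nonneg_right (le_abs_self C) (by positivity)).trans ?_)
    refine mul_le_mul_of_nonneg_left ?_ (abs_nonneg C)
    linarith [norm_add_smul_sq_le (hε k) p.1 p.2]
  · refine (hc.tendsto _).comp ?_
    simpa using (hlim.smul_const p.2).const_add p.1

theorem map_smooth (σ : Euc n ≃ₗᵢ[ℝ] Euc n) {ν : Measure (Euc n)} [IsProbabilityMeasure ν]
    (hν : ν.map σ = ν) (ε : ℝ) : (smooth ε ν).map σ = smooth ε ν := by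
  have hσ : Measurable σ := σ.continuous.measurable
  rw [smooth, Measure.map_map hσ (by fun_prop)]
  have h1 : (ν.prod (stdGaussian (Euc n))).map (Prod.map σ σ) = ν.prod (stdGaussian (Euc n)) := by
    rw [← Measure.map_prod_map _ _ hσ hσ, hν, stdGaussian_map]
  conv_rhs => rw [← h1]
  rw [Measure.map_map (by fun_prop) (hσ.prodMap hσ)]
  congr 1
  ext p : 1
  simp

/-- For each fixed `x` the law of `x + εz` is a translated and scaled Gaussian, whose density is
bounded independently of `x`. -/
theorem smooth_le_smul_volume {ν : Measure (Euc n)} [IsProbabilityMeasure ν] {ε : ℝ} (hε : ε ≠ 0) :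
    ∃ C : ℝ≥0∞, C ≠ ∞ ∧ smooth ε ν ≤ C • volume := by
  refine ⟨ENNReal.ofReal (((2 * Real.pi) ^ ((n : ℝ) / 2))⁻¹) *
    ENNReal.ofReal |(ε ^ Module.finrank ℝ (Euc n))⁻¹|,
    ENNReal.mul_ne_top ENNReal.ofReal_ne_top ENNReal.ofReal_ne_top, ?_⟩
  refine Measure.le_iff.2 fun s hs => ?_
  rw [smooth, Measure.map_apply (by fun_prop) hs, Measure.prod_apply
    (hs.preimage (by fun_prop))]
  refine (lintegral_mono (g := fun _ => _) fun x => ?_).trans (by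
    rw [lintegral_const, measure_univ, mul_one])
  refine (stdGaussian_le_smul_volume _).trans ?_
  have e : Prod.mk x ⁻¹' ((fun p : Euc n × Euc n => p.1 + ε • p.2) ⁻¹' s) =
      (fun z : Euc n => ε • z) ⁻¹' ((fun z => x + z) ⁻¹' s) := rfl
  rw [e, Measure.smul_apply, Measure.addHaar_preimage_smul _ hε, measure_preimage_add,
    Measure.smul_apply, smul_eq_mul, smul_eq_mul, mul_assoc]

theorem gaussEntropy_smooth_ne_top {ν : Measure (Euc n)} [IsProbabilityMeasure ν]
    (hν : Integrable (fun x => ‖x‖ ^ 2) ν) {ε : ℝ} (hε : |ε| ≤ 1) (h0 : ε ≠ 0) :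
    gaussEntropy (smooth ε ν) ≠ ∞ := by
  obtain ⟨C, hC, hle⟩ := smooth_le_smul_volume (ν := ν) h0
  exact gaussEntropy_ne_top_of_le (integrable_sq_smooth hν hε) hC hle

variable (n) in
/-- The second moment of the standard Gaussian. -/
noncomputable def gaussSecondMoment : ℝ := ∫ x, ‖x‖ ^ 2 ∂(stdGaussian (Euc n))

theorem lintegral_norm_sub_smul_sq (a : Euc n) (ε : ℝ) :
    ∫⁻ z, ‖a - ε • z‖ₑ ^ 2 ∂(stdGaussian (Euc n)) =
      ‖a‖ₑ ^ 2 + ENNReal.ofReal (ε ^ 2 * gaussSecondMoment n) := by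
  have h1 : ∀ z : Euc n, ‖a - ε • z‖ ^ 2 = ‖a‖ ^ 2 - 2 * ε * inner ℝ a z + ε ^ 2 * ‖z‖ ^ 2 := by
    intro z
    rw [norm_sub_sq_real, norm_smul, mul_pow, Real.norm_eq_abs, sq_abs, real_inner_smul_right]
    ring
  have i1 : Integrable (fun z : Euc n => inner ℝ a z) (stdGaussian (Euc n)) :=
    stdGaussian_integrable_id.const_inner a
  have i2 : Integrable (fun z : Euc n => ‖a - ε • z‖ ^ 2) (stdGaussian (Euc n)) := by
    simp_rw [h1]
    exact ((integrable_const _).sub (i1.const_mul _)).add (stdGaussian_integrable_sq.const_mul _)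
  have h2 : ∫ z, ‖a - ε • z‖ ^ 2 ∂(stdGaussian (Euc n)) =
      ‖a‖ ^ 2 + ε ^ 2 * gaussSecondMoment n := by
    have i3 : Integrable (fun z : Euc n => ‖a‖ ^ 2 - 2 * ε * inner ℝ a z) (stdGaussian (Euc n)) :=
      (integrable_const _).sub (i1.const_mul _)
    simp_rw [h1]
    rw [integral_add i3 (stdGaussian_integrable_sq.const_mul _), integral_sub (integrable_const _) (i1.const_mul _),
      integral_const_mul, integral_const_mul, integral_inner stdGaussian_integrable_id,
      integral_id_stdGaussian]
    simp [gaussSecondMoment]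
  have h3 : ∀ z : Euc n, ‖a - ε • z‖ₑ ^ 2 = ENNReal.ofReal (‖a - ε • z‖ ^ 2) := fun z => by
    rw [ENNReal.ofReal_pow (norm_nonneg _), ofReal_norm]
  have hM : 0 ≤ gaussSecondMoment n := integral_nonneg fun x => by positivity
  simp_rw [h3]
  rw [← ofReal_integral_eq_lintegral_ofReal i2 (.of_forall fun z => by positivity), h2,
    ENNReal.ofReal_add (by positivity) (by positivity), ENNReal.ofReal_pow (norm_nonneg _),
    ofReal_norm]

/-- Independent noise is added to the second coordinate of a plan; as the noise is centered, the
squared cost has no cross term. -/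
theorem W2sq_smooth_le (η ν : Measure (Euc n)) (ε : ℝ) :
    W2sq η (smooth ε ν) ≤ W2sq η ν + ENNReal.ofReal (ε ^ 2 * gaussSecondMoment n) := by
  unfold W2sq
  simp only [ENNReal.iInf_add]
  refine le_iInf₂ fun π hπ => ?_
  obtain ⟨hp, h1, h2⟩ := hπ
  set m : (Euc n × Euc n) × Euc n → Euc n × Euc n := fun p => (p.1.1, p.1.2 + ε • p.2) with hm
  have hmm : Measurable m := by fun_prop
  have hmem : (π.prod (stdGaussian (Euc n))).map m ∈ transportPlans η (smooth ε ν) := by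
    refine ⟨Measure.isProbabilityMeasure_map hmm.aemeasurable, ?_, ?_⟩
    · rw [Measure.fst, Measure.map_map measurable_fst hmm, ← h1]
      have : Prod.fst ∘ m = Prod.fst ∘ Prod.fst := rfl
      rw [this, ← Measure.map_map measurable_fst measurable_fst]
      change (π.prod (stdGaussian (Euc n))).fst.fst = _
      rw [Measure.fst_prod]
    · rw [Measure.snd, Measure.map_map measurable_snd hmm, ← h2, smooth]
      have : π.snd.prod (stdGaussian (Euc n)) =
          (π.prod (stdGaussian (Euc n))).map (Prod.map Prod.snd id) := by
        rw [← Measure.map_prod_map _ _ measurable_snd measurable_id, Measure.map_id]; rfl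
      rw [this, Measure.map_map (by fun_prop) (by fun_prop)]
      rfl
  refine (iInf₂_le _ hmem).trans ?_
  rw [lintegral_map (by fun_prop) hmm, lintegral_prod _ (by fun_prop)]
  simp only [hm]
  have : ∀ x : Euc n × Euc n, ∫⁻ z, ‖x.1 - (x.2 + ε • z)‖ₑ ^ 2 ∂(stdGaussian (Euc n)) =
      ‖x.1 - x.2‖ₑ ^ 2 + ENNReal.ofReal (ε ^ 2 * gaussSecondMoment n) := fun x => by
    rw [← lintegral_norm_sub_smul_sq]
    simp_rw [sub_sub]
  simp_rw [this]
  rw [lintegral_add_right _ measurable_const, lintegral_const, measure_univ, mul_one]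

end Smoothing

/-! ### Moment measures and the inverse Santaló inequality under quadratic growth -/

section MomentMeasure

variable {n : ℕ}

/-- The moment measure of a convex function. -/
noncomputable def momentMeasure (F : Euc n → ℝ) : Measure (Euc n) :=
  ((volume : Measure (Euc n)).tilted fun x => -F x).map (gradient F)

theorem Nice.isProbabilityMeasure {F : Euc n → ℝ} (hF : Nice F) :
    IsProbabilityMeasure (momentMeasure F) := by
  have : IsProbabilityMeasure ((volume : Measure (Euc n)).tilted fun x => -F x) :=
    isProbabilityMeasure_tilted hF.integrable_exp
  exact Measure.isProbabilityMeasure_map (measurable_gradient F).aemeasurable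

theorem Nice.integrable_sq_momentMeasure {F : Euc n → ℝ} (hF : Nice F) :
    Integrable (fun x => ‖x‖ ^ 2) (momentMeasure F) := by
  have : IsProbabilityMeasure ((volume : Measure (Euc n)).tilted fun x => -F x) :=
    isProbabilityMeasure_tilted hF.integrable_exp
  obtain ⟨C, hC, h⟩ := hF.gradient_le
  refine (integrable_map_measure (by fun_prop) (measurable_gradient F).aemeasurable).2 ?_
  refine integrable_of_le_quad hF.integrable_sq (C := C)
    ((measurable_gradient F).norm.pow_const 2).aestronglyMeasurable fun x => ?_
  simp only [Function.comp_apply]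
  rw [abs_of_nonneg (by positivity)]
  exact h x

theorem tilted_map_isometry (σ : Euc n ≃ₗᵢ[ℝ] Euc n) {F : Euc n → ℝ} (hF : ∀ x, F (σ x) = F x) :
    ((volume : Measure (Euc n)).tilted fun x => -F x).map σ = volume.tilted fun x => -F x := by
  have hσ : MeasurableEmbedding σ := σ.toHomeomorph.measurableEmbedding
  refine Measure.ext fun s hs => ?_
  rw [Measure.map_apply hσ.measurable hs, tilted_apply' _ _ (hσ.measurable hs), tilted_apply' _ _ hs,
    ← σ.measurePreserving.setLIntegral_comp_preimage_emb hσ (fun a => ENNReal.ofReal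
      (Real.exp (-F a) / ∫ x, Real.exp (-F x))) s]
  simp_rw [hF]

theorem map_momentMeasure (σ : Euc n ≃ₗᵢ[ℝ] Euc n) {F : Euc n → ℝ} (hF : ∀ x, F (σ x) = F x) :
    (momentMeasure F).map σ = momentMeasure F := by
  have hσ : Measurable σ := σ.continuous.measurable
  rw [momentMeasure, Measure.map_map hσ (measurable_gradient F)]
  conv_rhs => rw [← tilted_map_isometry σ hF]
  rw [Measure.map_map (measurable_gradient F) hσ]
  congr 1
  ext x : 1
  simp [gradient_comp_isometry σ hF]

/-- Lower bound for `𝓖(·, ν)` when `ν` is a smoothed moment measure. -/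
theorem le_G_smooth_momentMeasure {F : Euc n → ℝ} (hF : Nice F) {ε : ℝ} (hε : |ε| ≤ 1)
    (h0 : ε ≠ 0) {η : Measure (Euc n)} (hη : η ∈ P2 n) :
    (((gaussEntropy (smooth ε (momentMeasure F))).toReal - Real.log (∫ x, Real.exp (-F x))
      - ∫ y, (‖y‖ ^ 2 / 2 - lconj F y) ∂(momentMeasure F) - ε ^ 2 * gaussSecondMoment n / 2
      + n / 2 * Real.log (2 * Real.pi) : ℝ) : EReal) ≤ G η (smooth ε (momentMeasure F)) := by
  have hp := hF.isProbabilityMeasure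
  have hsq := hF.integrable_sq_momentMeasure
  have hs := gaussEntropy_smooth_ne_top hsq hε h0
  have hmem := mem_P2 (integrable_sq_smooth hsq hε)
  by_cases hH : gaussEntropy η = ∞
  · rw [G_eq_top hη hmem (Or.inl hH)]; exact le_top
  have := hη.1
  have hηsq := integrable_sq_of_mem_P2 hη
  rw [G_eq_coe hη hmem hH hs, EReal.coe_le_coe_iff]
  refine le_of_forall_pos_le_add fun δ hδ => ?_
  obtain ⟨hW, φ, ψ, hφ, hψ, hle, hd⟩ := exists_dual_potentials hη (mem_P2 hsq) hδ
  have hM : 0 ≤ gaussSecondMoment n := integral_nonneg fun x => by positivity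
  have hWs : (W2sq η (smooth ε (momentMeasure F))).toReal ≤
      (W2sq η (momentMeasure F)).toReal + ε ^ 2 * gaussSecondMoment n := by
    have := ENNReal.toReal_mono (ENNReal.add_ne_top.2 ⟨hW, ENNReal.ofReal_ne_top⟩)
      (W2sq_smooth_le η (momentMeasure F) ε)
    rwa [ENNReal.toReal_add hW ENNReal.ofReal_ne_top, ENNReal.toReal_ofReal (by positivity)] at this
  -- With `g = |x|²/2 - φ`, Donsker–Varadhan bounds `H(η|γ) - ∫ φ dη` from below by `-log ∫ e^{-g}`
  -- plus a constant, and the variational inequality controls `log ∫ e^{-g}`; the integrals of `ψ`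
  -- cancel.
  have hg := (quadGrowth_sq (E := Euc n)).sub hφ
  have hψ' := (quadGrowth_sq (E := Euc n)).sub hψ
  obtain ⟨hgi, hmom⟩ := log_integral_sub_le_integral_gradDefect hF hg hψ' fun x y => by
    have h1 := hle x y
    rw [norm_sub_sq_real] at h1
    linarith
  have hDV := donsker_varadhan_gaussEntropy hηsq hH (hg.integrable hηsq) hgi
  simp only [sub_sub_cancel] at hDV
  have hmom2 : ∫ x, gradDefect F (fun x => ‖x‖ ^ 2 / 2 - ψ x) x
      ∂((volume : Measure (Euc n)).tilted fun x => -F x) =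
      ∫ y, (‖y‖ ^ 2 / 2 - lconj F y) ∂(momentMeasure F) - ∫ y, ψ y ∂(momentMeasure F) := by
    rw [← integral_sub (((quadGrowth_sq (E := Euc n)).sub hF.conj.quadGrowth).integrable hsq)
      (hψ.integrable hsq), momentMeasure, integral_map (measurable_gradient F).aemeasurable]
    · refine integral_congr_ae (.of_forall fun x => ?_)
      simp only [gradDefect]; ring
    · exact (((quadGrowth_sq (E := Euc n)).sub hF.conj.quadGrowth).sub hψ).1.aestronglyMeasurable
  rw [hmom2] at hmom
  linarith

/-- The transport-entropy inequality implies the inverse Santaló inequality for convex functions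
that grow quadratically. -/
theorem nice_inverse_santalo {c : ℝ} (hc : 0 < c) {A : Set (Measure (Euc n))} (hA : A ⊆ P2 n)
    (h : ∀ ν₁ ∈ A, ∀ ν₂ ∈ A, G ν₁ ν₂ ≥ (⨅ η₁ ∈ A, G η₁ ν₂) + (⨅ η₂ ∈ A, G ν₁ η₂) +
      ((n * Real.log (c / (2 * Real.pi)) : ℝ) : EReal)) {F : Euc n → ℝ} (hF : Nice F)
    (h₁ : ∀ ε : ℝ, |ε| ≤ 1 → smooth ε (momentMeasure F) ∈ A)
    (h₂ : ∀ ε : ℝ, |ε| ≤ 1 → smooth ε (momentMeasure (lconj F)) ∈ A) :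
    ENNReal.ofReal (c ^ n) ≤
      intExpNeg (fun x => (F x : EReal)) * intExpNeg (legendre fun x => (F x : EReal)) := by
  have hF' := hF.conj
  have := hF.isProbabilityMeasure
  have := hF'.isProbabilityMeasure
  have s1 := hF.integrable_sq_momentMeasure
  have s2 := hF'.integrable_sq_momentMeasure
  set Z₁ := ∫ x, Real.exp (-F x) with hZ₁
  set Z₂ := ∫ x, Real.exp (-lconj F x) with hZ₂
  set u : Euc n → ℝ := fun y => ‖y‖ ^ 2 / 2 - lconj F y with hu
  set v : Euc n → ℝ := fun y => ‖y‖ ^ 2 / 2 - lconj (lconj F) y with hv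
  have qu : QuadGrowth u := quadGrowth_sq.sub hF'.quadGrowth
  have qv : QuadGrowth v := quadGrowth_sq.sub hF'.conj.quadGrowth
  -- Moment measures may be singular, so (1) is applied to the smoothed ones. Their finite entropies
  -- occur on both sides and cancel.
  have key : ∀ ε : ℝ, |ε| ≤ 1 → ε ≠ 0 →
      n * Real.log c ≤ Real.log Z₁ + Real.log Z₂ +
        (∫ y, u y ∂(momentMeasure F) - ∫ y, u y ∂(smooth ε (momentMeasure F))) +
        (∫ y, v y ∂(momentMeasure (lconj F)) - ∫ y, v y ∂(smooth ε (momentMeasure (lconj F)))) +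
        ε ^ 2 * gaussSecondMoment n := by
    intro ε hε h0
    have e1 := gaussEntropy_smooth_ne_top s1 hε h0
    have e2 := gaussEntropy_smooth_ne_top s2 hε h0
    have main := h _ (h₁ ε hε) _ (h₂ ε hε)
    have m1 := hA (h₁ ε hε)
    have m2 := hA (h₂ ε hε)
    have low1 := le_iInf₂ (f := fun (η : Measure (Euc n)) (_ : η ∈ A) =>
      G η (smooth ε (momentMeasure (lconj F))))
      fun η hη => le_G_smooth_momentMeasure hF' hε h0 (hA hη)
    have low2 := le_iInf₂ (f := fun (η : Measure (Euc n)) (_ : η ∈ A) =>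
      G (smooth ε (momentMeasure F)) η)
      fun η hη => (le_G_smooth_momentMeasure hF hε h0 (hA hη)).trans_eq (G_comm _ _)
    have main2 := (add_le_add (add_le_add low1 low2) le_rfl).trans main
    rw [G_eq_coe m1 m2 e1 e2, ← EReal.coe_add, ← EReal.coe_add, EReal.coe_le_coe_iff] at main2
    -- Admissibility of `u` and `v` is Young's inequality for `F*` and `F**`; the identity `F** = F`
    -- is not needed.
    have dual := dual_le_W2sq (exists_dual_potentials m1 m2 one_pos).1
      (qu.integrable (integrable_sq_of_mem_P2 m1)) (qv.integrable (integrable_sq_of_mem_P2 m2))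
      fun x y => by
        have := hF'.conjFinite.inner_le x y
        rw [norm_sub_sq_real]
        simp only [hu, hv]
        linarith
    rw [Real.log_div hc.ne' (by positivity)] at main2
    simp only [hu, hv] at dual ⊢
    linarith
  have lim : Filter.Tendsto (fun k : ℕ => 1 / ((k : ℝ) + 1)) Filter.atTop (nhds 0) :=
    tendsto_one_div_add_atTop_nhds_zero_nat
  have hk : ∀ k : ℕ, |1 / ((k : ℝ) + 1)| ≤ 1 := fun k => by
    rw [abs_of_pos (by positivity)]
    exact (div_le_one (by positivity)).2 (by linarith [Nat.cast_nonneg (α := ℝ) k])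
  have final : n * Real.log c ≤ Real.log Z₁ + Real.log Z₂ := by
    have t1 := (tendsto_integral_smooth s1 qu hk lim).const_sub (∫ y, u y ∂(momentMeasure F))
    have t2 := (tendsto_integral_smooth s2 qv hk lim).const_sub
      (∫ y, v y ∂(momentMeasure (lconj F)))
    have t3 := (lim.pow 2).mul_const (gaussSecondMoment n)
    have t := ((t1.const_add (Real.log Z₁ + Real.log Z₂)).add t2).add t3
    simp only [sub_self, add_zero, ne_eq, OfNat.ofNat_ne_zero, not_false_eq_true, zero_pow,
      zero_mul] at t
    exact ge_of_tendsto' t fun k => key _ (hk k) (by positivity)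
  have p1 : 0 < Z₁ := integral_exp_pos hF.integrable_exp
  have p2 : 0 < Z₂ := integral_exp_pos hF'.integrable_exp
  rw [hF.conjFinite.legendre_coe, intExpNeg_coe, intExpNeg_coe,
    ← ofReal_integral_eq_lintegral_ofReal hF.integrable_exp
      (.of_forall fun x => (Real.exp_pos _).le),
    ← ofReal_integral_eq_lintegral_ofReal hF'.integrable_exp
      (.of_forall fun x => (Real.exp_pos _).le), ← ENNReal.ofReal_mul p1.le]
  refine ENNReal.ofReal_le_ofReal ?_
  rw [← Real.log_le_log_iff (by positivity) (by positivity), Real.log_pow,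
    Real.log_mul p1.ne' p2.ne']
  exact final

end MomentMeasure

end InvSantalo

namespace InvSantalo

/-! ### Invariance under groups of sign changes -/

section Symmetry

variable {n : ℕ}

theorem signFlip_signFlip (ε ε' : Fin n → ℤˣ) (x : Euc n) :
    signFlip ε (signFlip ε' x) = signFlip (ε * ε') x := by
  ext i
  simp [signFlip, mul_assoc]

theorem signFlip_one (x : Euc n) : signFlip 1 x = x := by
  ext i
  simp [signFlip]

theorem signFlip_mul_self (ε : Fin n → ℤˣ) (x : Euc n) : signFlip ε (signFlip ε x) = x := by
  rw [signFlip_signFlip, show ε * ε = 1 from funext fun i => Int.units_mul_self (ε i),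
    signFlip_one]

theorem norm_signFlip (ε : Fin n → ℤˣ) (x : Euc n) : ‖signFlip ε x‖ = ‖x‖ := by
  rw [EuclideanSpace.norm_eq, EuclideanSpace.norm_eq]
  congr 1
  refine Finset.sum_congr rfl fun i _ => ?_
  rcases Int.units_eq_one_or (ε i) with h | h <;> simp [signFlip, h]

/-- Sign changes as linear isometries. -/
noncomputable def signIso (ε : Fin n → ℤˣ) : Euc n ≃ₗᵢ[ℝ] Euc n where
  toFun := signFlip ε
  invFun := signFlip ε
  map_add' x y := by ext i; simp [signFlip, mul_add]
  map_smul' a x := by ext i; simp [signFlip, mul_left_comm]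
  left_inv := signFlip_mul_self ε
  right_inv := signFlip_mul_self ε
  norm_map' x := norm_signFlip ε x

theorem coe_signIso (ε : Fin n → ℤˣ) : ⇑(signIso ε) = signFlip ε := rfl

theorem continuous_signFlip (ε : Fin n → ℤˣ) : Continuous (signFlip ε : Euc n → Euc n) :=
  (signIso ε).continuous

variable (H : Subgroup (Fin n → ℤˣ))

/-- The elements of `convexFun n` that are invariant under a group of sign changes. -/
def convexClass : Set (Euc n → EReal) :=
  {f | f ∈ convexFun n ∧ ∀ ε ∈ H, ∀ x, f (signFlip ε x) = f x}

/-- The elements of `P2 n` that are invariant under a group of sign changes. -/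
def measureClass : Set (Measure (Euc n)) :=
  {ν | ν ∈ P2 n ∧ ∀ ε ∈ H, ν.map (signFlip ε) = ν}

/-- The average of a function over a group of sign changes. -/
noncomputable def signAverage (φ : Euc n → ℝ) (x : Euc n) : ℝ :=
  (Nat.card H : ℝ)⁻¹ * ∑ᶠ ε : H, φ (signFlip ε.1 x)

variable {H}

theorem signAverage_eq_sum [Fintype H] (φ : Euc n → ℝ) (x : Euc n) :
    signAverage H φ x = (Fintype.card H : ℝ)⁻¹ * ∑ ε : H, φ (signFlip ε.1 x) := by
  rw [signAverage, finsum_eq_sum_of_fintype, Nat.card_eq_fintype_card]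

theorem signAverage_signFlip (φ : Euc n → ℝ) {ε : Fin n → ℤˣ} (hε : ε ∈ H) (x : Euc n) :
    signAverage H φ (signFlip ε x) = signAverage H φ x := by
  have := Fintype.ofFinite H
  rw [signAverage_eq_sum, signAverage_eq_sum]
  congr 1
  simp_rw [signFlip_signFlip]
  exact Fintype.sum_equiv (Equiv.mulRight (⟨ε, hε⟩ : H)) _ _ fun i => rfl

theorem QuadGrowth.sum {ι : Type*} (s : Finset ι) {f : ι → Euc n → ℝ}
    (h : ∀ i ∈ s, QuadGrowth (f i)) : QuadGrowth fun x => ∑ i ∈ s, f i x := by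
  classical
  induction s using Finset.induction_on with
  | empty => simpa using QuadGrowth.const (E := Euc n) 0
  | insert a s ha ih =>
    simp_rw [Finset.sum_insert ha]
    exact (h a (by simp)).add (ih fun i hi => h i (by simp [hi]))

theorem QuadGrowth.comp_signFlip {φ : Euc n → ℝ} (hφ : QuadGrowth φ) (ε : Fin n → ℤˣ) :
    QuadGrowth fun x => φ (signFlip ε x) := by
  obtain ⟨hc, C, hC⟩ := hφ
  exact ⟨hc.comp (continuous_signFlip ε), C, fun x => by simpa [norm_signFlip] using hC (signFlip ε x)⟩

theorem QuadGrowth.signAverage {φ : Euc n → ℝ} (hφ : QuadGrowth φ) :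
    QuadGrowth (signAverage H φ) := by
  have := Fintype.ofFinite H
  have e : InvSantalo.signAverage H φ = fun x =>
    (Fintype.card H : ℝ)⁻¹ * ∑ ε : H, φ (signFlip ε.1 x) := funext (signAverage_eq_sum φ)
  rw [e]
  exact (QuadGrowth.sum Finset.univ fun (i : H) _ => hφ.comp_signFlip i.1).const_mul _

theorem integral_signAverage {φ : Euc n → ℝ} (hφ : QuadGrowth φ) {ν : Measure (Euc n)}
    (hν : ν ∈ measureClass H) : ∫ x, signAverage H φ x ∂ν = ∫ x, φ x ∂ν := by
  have := Fintype.ofFinite H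
  have := hν.1.1
  have hsq := integrable_sq_of_mem_P2 hν.1
  simp_rw [signAverage_eq_sum]
  rw [integral_const_mul, integral_finsetSum _ fun (i : H) _ => (hφ.comp_signFlip i.1).integrable hsq]
  have e : ∀ i : H, ∫ x, φ (signFlip i.1 x) ∂ν = ∫ x, φ x ∂ν := fun i => by
    conv_rhs => rw [← hν.2 i.1 i.2]
    rw [integral_map (continuous_signFlip i.1).measurable.aemeasurable hφ.1.aestronglyMeasurable]
  simp_rw [e]
  rw [Finset.sum_const, Finset.card_univ, nsmul_eq_mul, inv_mul_cancel_left₀]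
  exact_mod_cast Fintype.card_ne_zero

/-- Both averages are paired along the same sign change, an isometry that leaves `|x - y|`
unchanged. -/
theorem signAverage_add_le {φ ψ : Euc n → ℝ} (h : ∀ x y, φ x + ψ y ≤ ‖x - y‖ ^ 2 / 2) (x y : Euc n) :
    signAverage H φ x + signAverage H ψ y ≤ ‖x - y‖ ^ 2 / 2 := by
  have := Fintype.ofFinite H
  have hpos : (0 : ℝ) < Fintype.card H := by exact_mod_cast Fintype.card_pos
  rw [signAverage_eq_sum, signAverage_eq_sum, ← mul_add, ← Finset.sum_add_distrib,
    inv_mul_le_iff₀ hpos]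
  refine (Finset.sum_le_card_nsmul _ _ (‖x - y‖ ^ 2 / 2) fun i _ => ?_).trans_eq (by simp)
  refine (h _ _).trans_eq ?_
  rw [← coe_signIso, ← map_sub, (signIso i.1).norm_map]

end Symmetry

/-! ### From inverse Santaló to transport-entropy -/

section Forward

variable {n : ℕ}

theorem coe_le_of_forall_pos {a : EReal} {r : ℝ} (h : ∀ δ : ℝ, 0 < δ → a ≤ ((r + δ : ℝ) : EReal)) :
    a ≤ r := by
  refine EReal.le_of_forall_lt_iff_le.1 fun z hz => ?_
  have := h (z - r) (sub_pos.2 (by exact_mod_cast hz))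
  simpa using this

/-- Upper bound for `𝓖(·, ν)` at regularized Gibbs measures. -/
theorem G_gibbs_le {g g' : Euc n → ℝ} (hg : QuadGrowth g) (hg' : QuadGrowth g')
    (hd : ∀ x y, inner ℝ x y ≤ g x + g' y) {b : ℝ} (hb : ∀ x, -b ≤ g x) {a : ℝ} (ha : 0 < a)
    {ν : Measure (Euc n)} (hν : ν ∈ P2 n) (hH : gaussEntropy ν ≠ ∞) :
    Integrable (fun x => Real.exp (-(g x + a * ‖x‖ ^ 2))) ∧
    (volume : Measure (Euc n)).tilted (fun x => -(g x + a * ‖x‖ ^ 2)) ∈ P2 n ∧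
    G ((volume : Measure (Euc n)).tilted fun x => -(g x + a * ‖x‖ ^ 2)) ν ≤
      (((gaussEntropy ν).toReal - Real.log (∫ x, Real.exp (-(g x + a * ‖x‖ ^ 2))) +
        n / 2 * Real.log (2 * Real.pi) - ∫ y, (‖y‖ ^ 2 / 2 - g' y) ∂ν : ℝ) : EReal) := by
  have hgm := hg.1.measurable
  have := hν.1
  have hνsq := integrable_sq_of_mem_P2 hν
  have hi : Integrable (fun x => Real.exp (-(g x + a * ‖x‖ ^ 2))) :=
    integrable_exp_of_le (by fun_prop) ha (C := b) fun x => by linarith [hb x]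
  have hsq : Integrable (fun x => ‖x‖ ^ 2)
      ((volume : Measure (Euc n)).tilted fun x => -(g x + a * ‖x‖ ^ 2)) :=
    integrable_sq_tilted (by fun_prop) ha (C := b) fun x => by linarith [hb x]
  have hp : IsProbabilityMeasure ((volume : Measure (Euc n)).tilted
      fun x => -(g x + a * ‖x‖ ^ 2)) := isProbabilityMeasure_tilted hi
  have hgi := hg.integrable hsq
  obtain ⟨h1, h2⟩ := gaussEntropy_tilted hi hsq (hgi.add (hsq.const_mul a))
  set η := (volume : Measure (Euc n)).tilted fun x => -(g x + a * ‖x‖ ^ 2) with hη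
  have hmem := mem_P2 hsq
  refine ⟨hi, hmem, ?_⟩
  rw [G_eq_coe hmem hν h1 hH, EReal.coe_le_coe_iff, h2]
  have dual := dual_le_W2sq (exists_dual_potentials hmem hν one_pos).1
    ((quadGrowth_sq.sub hg).integrable hsq) ((quadGrowth_sq.sub hg').integrable hνsq) fun x y => by
      have := hd x y
      rw [norm_sub_sq_real]
      linarith
  -- The term `a|x|²` provides integrability and moments; its contribution to the entropy is
  -- negative and can be dropped.
  have e : ∫ x, (‖x‖ ^ 2 / 2 - (g x + a * ‖x‖ ^ 2)) ∂η ≤ ∫ x, (‖x‖ ^ 2 / 2 - g x) ∂η := by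
    refine integral_mono ((hsq.div_const 2).sub (hgi.add (hsq.const_mul a)))
      ((hsq.div_const 2).sub hgi) fun x => ?_
    have : 0 ≤ a * ‖x‖ ^ 2 := by positivity
    simp only
    linarith
  linarith

/-- Monotone convergence, so that an infinite limit is allowed. -/
theorem tendsto_regularized {g : Euc n → ℝ} (hg : Continuous g) :
    Filter.Tendsto (fun k : ℕ => ∫⁻ x, ENNReal.ofReal (Real.exp (-(g x + 1 / ((k : ℝ) + 1) * ‖x‖ ^ 2))))
      Filter.atTop (nhds (intExpNeg fun x => (g x : EReal))) := by
  rw [intExpNeg_coe]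
  have hgm := hg.measurable
  refine lintegral_tendsto_of_tendsto_of_monotone (fun k => by fun_prop)
    (.of_forall fun x k l hkl => ENNReal.ofReal_le_ofReal (Real.exp_le_exp.2 (neg_le_neg ?_)))
    (.of_forall fun x => ?_)
  · have := Nat.one_div_le_one_div (α := ℝ) hkl
    gcongr
  · refine (ENNReal.continuous_ofReal.tendsto _).comp ((Real.continuous_exp.tendsto _).comp ?_)
    simpa using ((tendsto_one_div_add_atTop_nhds_zero_nat (𝕜 := ℝ)).mul_const
      (‖x‖ ^ 2)).const_add (g x) |>.neg

theorem tilted_mem_measureClass {H : Subgroup (Fin n → ℤˣ)} {g : Euc n → ℝ}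
    (hg : ∀ ε ∈ H, ∀ x, g (signFlip ε x) = g x) {a : ℝ}
    (hmem : (volume : Measure (Euc n)).tilted (fun x => -(g x + a * ‖x‖ ^ 2)) ∈ P2 n) :
    (volume : Measure (Euc n)).tilted (fun x => -(g x + a * ‖x‖ ^ 2)) ∈ measureClass H :=
  ⟨hmem, fun ε hε => tilted_map_isometry (signIso ε) (F := fun x => g x + a * ‖x‖ ^ 2) fun x => by
    simp only [coe_signIso, norm_signFlip, hg ε hε]⟩

/-- The inverse Santaló inequality implies the transport-entropy inequality. -/
theorem transport_entropy_of_invSantaloOn {H : Subgroup (Fin n → ℤˣ)} {c : ℝ} (hc : 0 < c)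
    (h : InvSantaloOn (convexClass H) c) {ν₁ ν₂ : Measure (Euc n)} (h₁ : ν₁ ∈ measureClass H)
    (h₂ : ν₂ ∈ measureClass H) :
    G ν₁ ν₂ ≥ (⨅ η₁ ∈ measureClass H, G η₁ ν₂) + (⨅ η₂ ∈ measureClass H, G ν₁ η₂) +
      ((n * Real.log (c / (2 * Real.pi)) : ℝ) : EReal) := by
  by_cases hH : gaussEntropy ν₁ = ∞ ∨ gaussEntropy ν₂ = ∞
  · rw [G_eq_top h₁.1 h₂.1 hH]; exact le_top
  push Not at hH
  obtain ⟨hH1, hH2⟩ := hH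
  have := h₁.1.1
  have := h₂.1.1
  have sq1 := integrable_sq_of_mem_P2 h₁.1
  have sq2 := integrable_sq_of_mem_P2 h₂.1
  rw [G_eq_coe h₁.1 h₂.1 hH1 hH2]
  refine coe_le_of_forall_pos fun δ hδ => ?_
  obtain ⟨-, φ₀, ψ₀, hφ₀, hψ₀, hle₀, hopt⟩ := exists_dual_potentials h₁.1 h₂.1 (half_pos hδ)
  -- Averaging the potentials keeps them admissible and nearly optimal, and makes the functions
  -- built from them invariant.
  rw [← integral_signAverage hφ₀ h₁, ← integral_signAverage hψ₀ h₂] at hopt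
  set φ : Euc n → ℝ := fun x => ‖x‖ ^ 2 / 2 - signAverage H φ₀ x with hφ
  set ψ : Euc n → ℝ := fun x => ‖x‖ ^ 2 / 2 - signAverage H ψ₀ x with hψ
  have qφ : QuadGrowth φ := quadGrowth_sq.sub hφ₀.signAverage
  have qψ : QuadGrowth ψ := quadGrowth_sq.sub hψ₀.signAverage
  have hdual : ∀ x y, inner ℝ x y ≤ φ x + ψ y := fun x y => by
    have := signAverage_add_le (H := H) hle₀ x y
    rw [norm_sub_sq_real] at this
    simp only [hφ, hψ]
    linarith
  have φinv : ∀ ε ∈ H, ∀ x, φ (signFlip ε x) = φ x := fun ε hε x => by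
    simp only [hφ, norm_signFlip, signAverage_signFlip φ₀ hε]
  have cφ : ConjFinite φ := ConjFinite.of_dual hdual
  set f := lconj φ with hf
  set f' := lconj f with hf'
  have cf : ConjFinite f := cφ.conj
  have finv : ∀ ε ∈ H, ∀ x, f (signFlip ε x) = f x := fun ε hε x =>
    conj_comp_isometry (signIso ε) (φinv ε hε) x
  have finv' : ∀ ε ∈ H, ∀ x, f' (signFlip ε x) = f' x := fun ε hε x =>
    conj_comp_isometry (signIso ε) (finv ε hε) x
  have f_le : ∀ x, f x ≤ ψ x := fun x => conj_le fun y => by linarith [hdual y x]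
  have f_le' : ∀ x, f' x ≤ φ x := cφ.conj_conj_le
  have f_ge : ∀ x, -φ 0 ≤ f x := fun x => by
    have := cφ.inner_le 0 x
    rw [inner_zero_left] at this
    linarith
  have f_ge' : ∀ x, -f 0 ≤ f' x := fun x => by
    have := cf.inner_le 0 x
    rw [inner_zero_left] at this
    linarith
  -- The conjugates `f` and `f'` inherit quadratic growth: they lie below `ψ` and `φ`, and above the
  -- constants `-φ 0` and `-f 0`.
  have quad_of : ∀ {u v : Euc n → ℝ} {b : ℝ}, Continuous u → QuadGrowth v → (∀ x, u x ≤ v x) →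
      (∀ x, -b ≤ u x) → QuadGrowth u := by
    rintro u v b hu ⟨-, C, hC⟩ huv hbu
    refine ⟨hu, |b| + |C|, fun x => abs_le.2 ⟨?_, ?_⟩⟩
    · nlinarith [hbu x, le_abs_self b, mul_nonneg (abs_nonneg b) (sq_nonneg ‖x‖),
        mul_nonneg (abs_nonneg C) (by positivity : 0 ≤ 1 + ‖x‖ ^ 2)]
    · have h1 := (le_abs_self _).trans (hC x)
      nlinarith [huv x, mul_nonneg (abs_nonneg b) (by positivity : 0 ≤ 1 + ‖x‖ ^ 2),
        mul_le_mul_of_nonneg_right (le_abs_self C) (by positivity : 0 ≤ 1 + ‖x‖ ^ 2)]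
  have contf : Continuous f := continuous_of_convexOn cφ.convexOn_conj
  have contf' : Continuous f' := continuous_of_convexOn cf.convexOn_conj
  have qf : QuadGrowth f := quad_of contf qψ f_le f_ge
  have qf' : QuadGrowth f' := quad_of contf' qφ f_le' f_ge'
  have bound2 := fun k : ℕ => G_gibbs_le qf qf' cf.inner_le f_ge (a := 1 / ((k : ℝ) + 1))
    (by positivity) h₁.1 hH1
  have bound1 := fun k : ℕ => G_gibbs_le qf' qf (fun x y => by
    rw [real_inner_comm]; linarith [cf.inner_le y x]) f_ge' (a := 1 / ((k : ℝ) + 1))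
    (by positivity) h₂.1 hH2
  have lim := tendsto_regularized contf
  have lim' := tendsto_regularized contf'
  have pos_of : ∀ {u : Euc n → ℝ}, Integrable (fun x => Real.exp (-(u x + 1 / (((0 : ℕ) : ℝ) + 1) * ‖x‖ ^ 2))) →
      0 < intExpNeg fun x => (u x : EReal) := by
    intro u hu
    have h1 : 0 < ENNReal.ofReal (∫ x, Real.exp (-(u x + 1 / (((0 : ℕ) : ℝ) + 1) * ‖x‖ ^ 2))) :=
      ENNReal.ofReal_pos.2 (integral_exp_pos hu)
    rw [ofReal_integral_eq_lintegral_ofReal hu (.of_forall fun x => (Real.exp_pos _).le)] at h1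
    refine h1.trans_le ?_
    rw [intExpNeg_coe]
    refine lintegral_mono fun x => ENNReal.ofReal_le_ofReal (Real.exp_le_exp.2 (neg_le_neg ?_))
    have : 0 ≤ 1 / (((0 : ℕ) : ℝ) + 1) * ‖x‖ ^ 2 := by positivity
    linarith
  have pos := pos_of (bound2 0).1
  have pos' := pos_of (bound1 0).1
  have hIS := h (fun x => (f x : EReal)) ⟨coe_mem_convexFun cφ.convexOn_conj, fun ε hε x => by
    simp only [finv ε hε x]⟩ pos (by rw [cf.legendre_coe]; exact pos')
  rw [cf.legendre_coe] at hIS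
  -- Positivity of both limits excludes `0 * ∞`; the limits themselves may be infinite, which is why
  -- a finite stage `k` is extracted next.
  have limprod := ENNReal.Tendsto.mul lim (Or.inl pos.ne') lim' (Or.inl pos'.ne')
  have hlt : ENNReal.ofReal (c ^ n * Real.exp (-(δ / 2))) <
      intExpNeg (fun x => (f x : EReal)) * intExpNeg fun x => (f' x : EReal) := by
    refine lt_of_lt_of_le ?_ hIS
    refine (ENNReal.ofReal_lt_ofReal_iff (by positivity)).2 (mul_lt_of_lt_one_right (by positivity) ?_)
    exact Real.exp_lt_one_iff.2 (by linarith)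
  obtain ⟨k, hk⟩ := (limprod.eventually (lt_mem_nhds hlt)).exists
  obtain ⟨i2, mem2, le2⟩ := bound2 k
  obtain ⟨i1, mem1, le1⟩ := bound1 k
  rw [← ofReal_integral_eq_lintegral_ofReal i2 (.of_forall fun x => (Real.exp_pos _).le),
    ← ofReal_integral_eq_lintegral_ofReal i1 (.of_forall fun x => (Real.exp_pos _).le),
    ← ENNReal.ofReal_mul (integral_exp_pos i2).le,
    ENNReal.ofReal_lt_ofReal_iff (mul_pos (integral_exp_pos i2) (integral_exp_pos i1))] at hk
  have hlog := Real.log_le_log (by positivity) hk.le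
  rw [Real.log_mul (by positivity) (Real.exp_pos _).ne', Real.log_exp, Real.log_pow,
    Real.log_mul (integral_exp_pos i2).ne' (integral_exp_pos i1).ne'] at hlog
  rw [G_comm] at le2
  have fin1 := (iInf₂_le (f := fun (η : Measure (Euc n)) (_ : η ∈ measureClass H) => G η ν₂) _
    (tilted_mem_measureClass finv' mem1)).trans le1
  have fin2 := (iInf₂_le (f := fun (η : Measure (Euc n)) (_ : η ∈ measureClass H) => G ν₁ η) _
    (tilted_mem_measureClass finv mem2)).trans le2
  refine (add_le_add (add_le_add fin1 fin2) le_rfl).trans ?_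
  rw [← EReal.coe_add, ← EReal.coe_add, EReal.coe_le_coe_iff, Real.log_div hc.ne' (by positivity)]
  have e1 : ∫ x, signAverage H φ₀ x ∂ν₁ ≤ ∫ y, (‖y‖ ^ 2 / 2 - f' y) ∂ν₁ :=
    integral_mono (hφ₀.signAverage.integrable sq1) ((quadGrowth_sq.sub qf').integrable sq1)
      fun x => by have := f_le' x; simp only [hφ] at this ⊢; linarith
  have e2 : ∫ x, signAverage H ψ₀ x ∂ν₂ ≤ ∫ y, (‖y‖ ^ 2 / 2 - f y) ∂ν₂ :=
    integral_mono (hψ₀.signAverage.integrable sq2) ((quadGrowth_sq.sub qf).integrable sq2)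
      fun x => by have := f_le x; simp only [hψ] at this ⊢; linarith
  linarith

end Forward

end InvSantalo

namespace InvSantalo

/-! ### Extended-valued convex functions and their domains -/

section ExtendedConvex

variable {n : ℕ}

theorem continuous_exp_neg : Continuous fun a : EReal => EReal.exp (-a) :=
  ENNReal.continuous_exp.comp continuous_neg

/-- The effective domain of an extended-valued function. -/
def effDom (f : Euc n → EReal) : Set (Euc n) := {x | f x ≠ ⊤}

theorem coe_toReal_of_mem_effDom {f : Euc n → EReal} (hf : f ∈ convexFun n) {x : Euc n}
    (hx : x ∈ effDom f) : ((f x).toReal : EReal) = f x := EReal.coe_toReal hx (hf.2.1 x)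

theorem eq_top_of_notMem_effDom {f : Euc n → EReal} {x : Euc n} (hx : x ∉ effDom f) : f x = ⊤ :=
  not_not.1 hx

theorem effDom_nonempty {f : Euc n → EReal} (hf : f ∈ convexFun n) : (effDom f).Nonempty := hf.2.2.1

theorem convexOn_effDom {f : Euc n → EReal} (hf : f ∈ convexFun n) :
    ConvexOn ℝ (effDom f) fun x => (f x).toReal := by
  have key : ∀ ⦃x⦄, x ∈ effDom f → ∀ ⦃y⦄, y ∈ effDom f → ∀ ⦃a b : ℝ⦄, 0 ≤ a → 0 ≤ b → a + b = 1 →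
      f (a • x + b • y) ≤ ((a * (f x).toReal + b * (f y).toReal : ℝ) : EReal) := by
    intro x hx y hy a b ha hb hab
    have := hf.2.2.2 x y a b ha hb hab
    rw [← coe_toReal_of_mem_effDom hf hx, ← coe_toReal_of_mem_effDom hf hy] at this
    exact_mod_cast this
  have hmem : Convex ℝ (effDom f) := fun x hx y hy a b ha hb hab =>
    ((key hx hy ha hb hab).trans_lt (EReal.coe_lt_top _)).ne
  refine ⟨hmem, fun x hx y hy a b ha hb hab => ?_⟩
  have := key hx hy ha hb hab
  rw [← coe_toReal_of_mem_effDom hf (hmem hx hy ha hb hab), EReal.coe_le_coe_iff] at this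
  exact this

theorem coe_le_legendre {f : Euc n → EReal} (hf : f ∈ convexFun n) {x : Euc n} (hx : x ∈ effDom f)
    (y : Euc n) : ((inner ℝ x y - (f x).toReal : ℝ) : EReal) ≤ legendre f y := by
  rw [EReal.coe_sub, coe_toReal_of_mem_effDom hf hx]
  exact le_iSup (fun x => ((inner ℝ x y : ℝ) : EReal) - f x) x

theorem legendre_anti {f g : Euc n → EReal} (h : ∀ x, f x ≤ g x) (y : Euc n) :
    legendre g y ≤ legendre f y :=
  iSup_mono fun x => EReal.sub_le_sub le_rfl (h x)

theorem measurable_legendre (f : Euc n → EReal) : Measurable (legendre f) := by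
  refine LowerSemicontinuous.measurable (lowerSemicontinuous_iSup fun x => ?_)
  refine Continuous.lowerSemicontinuous ?_
  induction h : f x with
  | bot => simp only [EReal.coe_sub_bot]; exact continuous_const
  | top => simp only [EReal.sub_top]; exact continuous_const
  | coe r =>
    simp_rw [← EReal.coe_sub]
    exact continuous_coe_real_ereal.comp (by fun_prop)

/-- Positivity of `∫ e^{-f*}` makes `f*` finite somewhere, and any point of finiteness is the slope
of an affine minorant. -/
theorem exists_affine_minorant {f : Euc n → EReal} (hf : f ∈ convexFun n)
    (hpos : 0 < intExpNeg (legendre f)) :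
    ∃ (y : Euc n) (b : ℝ), ∀ x ∈ effDom f, inner ℝ x y - b ≤ (f x).toReal := by
  obtain ⟨y, hy⟩ : ∃ y, legendre f y ≠ ⊤ := by
    by_contra! h
    simp [intExpNeg, h] at hpos
  refine ⟨y, (legendre f y).toReal, fun x hx => ?_⟩
  have h1 := coe_le_legendre hf hx y
  have h2 : legendre f y ≠ ⊥ := ne_bot_of_le_ne_bot (EReal.coe_ne_bot _) h1
  rw [← EReal.coe_toReal hy h2, EReal.coe_le_coe_iff] at h1
  linarith

/-- A convex set with empty interior is contained in its frontier, which is Lebesgue-null; then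
`e^{-f}` would vanish almost everywhere. -/
theorem interior_effDom_nonempty {f : Euc n → EReal} (hf : f ∈ convexFun n)
    (hpos : 0 < intExpNeg f) : (interior (effDom f)).Nonempty := by
  by_contra h
  rw [Set.not_nonempty_iff_eq_empty] at h
  have h1 : (volume : Measure (Euc n)) (effDom f) = 0 := by
    refine measure_mono_null (t := frontier (effDom f)) ?_
      ((convexOn_effDom hf).1.addHaar_frontier volume)
    rw [frontier, h, Set.sdiff_empty]
    exact subset_closure
  refine hpos.ne' ?_
  have hm : Measurable fun x => EReal.exp (-f x) := continuous_exp_neg.measurable.comp hf.1.measurable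
  rw [intExpNeg, lintegral_eq_zero_iff hm]
  have h2 : ∀ᵐ x, x ∉ effDom f := by
    rw [ae_iff]; simpa using h1
  filter_upwards [h2] with x hx
  simp [eq_top_of_notMem_effDom hx]

/-- The integral over a ball is at most that over the ball translated by `k • v`, hence over the
complement of an ever larger ball, and these tails vanish. -/
theorem lintegral_eq_zero_of_le_translate {h : Euc n → ℝ≥0∞}
    (hfin : ∫⁻ x, h x ≠ ∞) {v : Euc n} (hv : v ≠ 0) (hle : ∀ x, h x ≤ h (x + v)) :
    ∫⁻ x, h x = 0 := by
  have hit : ∀ (k : ℕ) x, h x ≤ h (x + (k : ℝ) • v) := by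
    intro k
    induction k with
    | zero => simp
    | succ k ih =>
      intro x
      refine ((ih x).trans (hle _)).trans_eq ?_
      congr 1
      push_cast
      module
  have ball : ∀ R : ℕ, ∫⁻ x in Metric.closedBall (0 : Euc n) R, h x = 0 := by
    intro R
    set S : ℕ → Set (Euc n) := fun k => {y | (k : ℝ) * ‖v‖ - R ≤ ‖y‖} with hS
    have hSm : ∀ k, MeasurableSet (S k) := fun k => measurableSet_le measurable_const measurable_norm
    have hanti : Antitone S := fun k l hkl y hy => by
      simp only [hS, Set.mem_ofPred_eq] at hy ⊢
      have : (k : ℝ) * ‖v‖ ≤ l * ‖v‖ := by gcongr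
      linarith
    have hempty : ⋂ k, S k = ∅ := by
      ext y
      simp only [Set.mem_iInter, Set.mem_empty_iff_false, iff_false, not_forall]
      obtain ⟨k, hk⟩ := exists_nat_gt ((‖y‖ + R) / ‖v‖)
      refine ⟨k, fun hy => ?_⟩
      simp only [hS, Set.mem_ofPred_eq] at hy
      rw [div_lt_iff₀ (norm_pos_iff.2 hv)] at hk
      linarith
    have lim := tendsto_measure_iInter_atTop (μ := volume.withDensity h)
      (fun k => (hSm k).nullMeasurableSet) hanti ⟨0, by
        refine ne_top_of_le_ne_top hfin ?_
        rw [withDensity_apply _ (hSm 0)]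
        exact setLIntegral_le_lintegral _ _⟩
    rw [hempty, measure_empty] at lim
    refine nonpos_iff_eq_zero.1 (ge_of_tendsto' lim fun k => ?_)
    rw [Function.comp_apply, withDensity_apply _ (hSm k),
      ← lintegral_indicator Metric.isClosed_closedBall.measurableSet, ← lintegral_indicator (hSm k),
      ← lintegral_add_right_eq_self ((S k).indicator h) ((k : ℝ) • v)]
    refine lintegral_mono fun x => ?_
    by_cases hx : x ∈ Metric.closedBall (0 : Euc n) R
    · have hx' : x + (k : ℝ) • v ∈ S k := by
        simp only [hS, Set.mem_ofPred_eq]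
        rw [mem_closedBall_zero_iff] at hx
        have h1 := norm_sub_le (x + (k : ℝ) • v) x
        rw [add_sub_cancel_left, norm_smul, Real.norm_natCast] at h1
        linarith
      rw [Set.indicator_of_mem hx, Set.indicator_of_mem hx']
      exact hit k x
    · rw [Set.indicator_of_notMem hx]; exact zero_le
  have huniv : (⋃ R : ℕ, Metric.closedBall (0 : Euc n) R) = Set.univ := Metric.iUnion_closedBall_nat 0
  rw [← setLIntegral_univ, ← huniv, ← nonpos_iff_eq_zero]
  exact (lintegral_iUnion_le _ _).trans (by simp [ball])

/-- Otherwise a hyperplane through `0` bounds the domain, `⟨x, v⟩ ≤ 0` on it, so `f*` decreases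
along `v` and `∫ e^{-f*}` is `0` or infinite. -/
theorem zero_mem_interior_effDom {f : Euc n → EReal} (hf : f ∈ convexFun n)
    (hpos : 0 < intExpNeg f) (hpos' : 0 < intExpNeg (legendre f))
    (hfin : intExpNeg (legendre f) ≠ ∞) : (0 : Euc n) ∈ interior (effDom f) := by
  by_contra h0
  have hconv := (convexOn_effDom hf).1
  have hne := interior_effDom_nonempty hf hpos
  obtain ⟨L, hL⟩ := geometric_hahn_banach_open_point hconv.interior isOpen_interior h0
  rw [map_zero] at hL
  set v := (InnerProductSpace.toDual ℝ (Euc n)).symm L with hv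
  have hvL : ∀ x, inner ℝ v x = L x := fun x => InnerProductSpace.toDual_symm_apply
  have hv0 : v ≠ 0 := by
    rintro h
    obtain ⟨x, hx⟩ := hne
    have := hL x hx
    rw [← hvL, h, inner_zero_left] at this
    exact lt_irrefl _ this
  have hle : ∀ x ∈ effDom f, inner ℝ x v ≤ 0 := by
    intro x hx
    have h1 : x ∈ closure (interior (effDom f)) := by
      rw [hconv.closure_interior_eq_closure_of_nonempty_interior hne]; exact subset_closure hx
    have h2 : closure (interior (effDom f)) ⊆ {x | L x ≤ 0} :=
      closure_minimal (fun y hy => (hL y hy).le) (isClosed_le L.continuous continuous_const)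
    rw [real_inner_comm, hvL]
    exact h2 h1
  have hmono : ∀ y, legendre f (y + v) ≤ legendre f y := by
    intro y
    refine iSup_le fun x => ?_
    by_cases hx : x ∈ effDom f
    · refine le_trans ?_ (coe_le_legendre hf hx y)
      nth_rw 1 [← coe_toReal_of_mem_effDom hf hx]
      rw [← EReal.coe_sub, EReal.coe_le_coe_iff, inner_add_right]
      linarith [hle x hx]
    · rw [eq_top_of_notMem_effDom hx, EReal.sub_top]; exact bot_le
  exact hpos'.ne' (lintegral_eq_zero_of_le_translate hfin hv0 fun y =>
      EReal.exp_monotone (EReal.neg_le_neg_iff.2 (hmono y)))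

theorem exists_ball_bound {f : Euc n → EReal} (hf : f ∈ convexFun n)
    (h0 : (0 : Euc n) ∈ interior (effDom f)) :
    ∃ r > 0, ∃ C : ℝ, ∀ x, ‖x‖ ≤ r → x ∈ effDom f ∧ (f x).toReal ≤ C := by
  have hc : ContinuousAt (fun x => (f x).toReal) 0 :=
    (convexOn_effDom hf).continuousOn_interior.continuousAt (isOpen_interior.mem_nhds h0)
  have h1 := (hc.eventually (Iio_mem_nhds (lt_add_one _))).and (isOpen_interior.mem_nhds h0)
  obtain ⟨r, hr, hr'⟩ := Metric.nhds_basis_closedBall.mem_iff.1 h1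
  refine ⟨r, hr, (f 0).toReal + 1, fun x hx => ?_⟩
  have := hr' (mem_closedBall_zero_iff.2 hx)
  exact ⟨interior_subset this.2, this.1.le⟩

/-- Integrability of `e^{-r|x|}`. -/
theorem lintegral_exp_neg_norm_ne_top {r : ℝ} (hr : 0 < r) (C : ℝ) :
    ∫⁻ x : Euc n, ENNReal.ofReal (Real.exp (C - r * ‖x‖)) ≠ ∞ := by
  have hi : Integrable fun x : Euc n => (1 + ‖x‖) ^ (-((n + 1 : ℕ) : ℝ)) :=
    integrable_one_add_norm (by rw [finrank_euclideanSpace, Fintype.card_fin]; exact_mod_cast n.lt_succ_self)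
  -- From `e^s ≥ s^{n+1}/(n+1)!` at `s = r(1 + |x|)`; the power `n + 1` exceeds the dimension.
  set K : ℝ := (n + 1).factorial / r ^ (n + 1) * Real.exp (C + r) with hK
  have hle : ∀ x : Euc n, Real.exp (C - r * ‖x‖) ≤ K * (1 + ‖x‖) ^ (-((n + 1 : ℕ) : ℝ)) := by
    intro x
    have h1 := Real.pow_div_factorial_le_exp (r * (1 + ‖x‖)) (by positivity) (n + 1)
    rw [Real.rpow_neg (by positivity), Real.rpow_natCast]
    have h2 : Real.exp (C - r * ‖x‖) = Real.exp (C + r) * (Real.exp (r * (1 + ‖x‖)))⁻¹ := by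
      rw [← Real.exp_neg, ← Real.exp_add]; congr 1; ring
    rw [h2, hK]
    have h3 : (Real.exp (r * (1 + ‖x‖)))⁻¹ ≤ ((r * (1 + ‖x‖)) ^ (n + 1) / (n + 1).factorial)⁻¹ := by
      gcongr
    calc _ ≤ Real.exp (C + r) * ((r * (1 + ‖x‖)) ^ (n + 1) / (n + 1).factorial)⁻¹ := by gcongr
      _ = _ := by rw [mul_pow]; field_simp
  have : Integrable (fun x : Euc n => Real.exp (C - r * ‖x‖)) := by
    refine (hi.const_mul K).mono' (Continuous.aestronglyMeasurable (by fun_prop)) (.of_forall fun x => ?_)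
    rw [Real.norm_eq_abs, Real.abs_exp]
    exact hle x
  exact this.lintegral_lt_top.ne

end ExtendedConvex

end InvSantalo

namespace InvSantalo

/-! ### Moreau envelopes -/

section Moreau

variable {n : ℕ}

/-- The Moreau envelope of an extended-valued function. -/
noncomputable def moreau (f : Euc n → EReal) (k : ℝ) (x : Euc n) : ℝ :=
  ⨅ z : effDom f, ((f z).toReal + k / 2 * ‖x - z‖ ^ 2)

variable {f : Euc n → EReal} {y : Euc n} {b k : ℝ}

/-- One unit of the penalty `k` pays for moving the affine minorant from `z` to `x`; the remaining
`k - 1` forces convergence in `tendsto_moreau`. -/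
theorem affine_le_moreau_aux (h : ∀ z ∈ effDom f, inner ℝ z y - b ≤ (f z).toReal)
    (x : Euc n) {z : Euc n} (hz : z ∈ effDom f) :
    inner ℝ x y - ‖y‖ ^ 2 / 2 - b + (k - 1) / 2 * ‖x - z‖ ^ 2 ≤
      (f z).toReal + k / 2 * ‖x - z‖ ^ 2 := by
  have h1 := inner_le_quad (one_half_pos (α := ℝ)) (x - z) y
  rw [inner_sub_left] at h1
  linarith [h z hz]

theorem moreau_bddBelow (h : ∀ z ∈ effDom f, inner ℝ z y - b ≤ (f z).toReal) (hk : 1 ≤ k)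
    (x : Euc n) :
    BddBelow (Set.range fun z : effDom f => (f z).toReal + k / 2 * ‖x - z‖ ^ 2) := by
  refine ⟨inner ℝ x y - ‖y‖ ^ 2 / 2 - b, ?_⟩
  rintro _ ⟨z, rfl⟩
  have h1 := affine_le_moreau_aux (k := k) h x z.2
  have h2 : 0 ≤ (k - 1) / 2 * ‖x - z‖ ^ 2 := mul_nonneg (by linarith) (by positivity)
  simp only
  linarith

theorem moreau_le (h : ∀ z ∈ effDom f, inner ℝ z y - b ≤ (f z).toReal) (hk : 1 ≤ k) (x : Euc n)
    {z : Euc n} (hz : z ∈ effDom f) : moreau f k x ≤ (f z).toReal + k / 2 * ‖x - z‖ ^ 2 :=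
  ciInf_le (moreau_bddBelow h hk x) ⟨z, hz⟩

theorem le_moreau (hf : f ∈ convexFun n) {x : Euc n} {M : ℝ}
    (h : ∀ z ∈ effDom f, M ≤ (f z).toReal + k / 2 * ‖x - z‖ ^ 2) : M ≤ moreau f k x := by
  have := (effDom_nonempty hf).to_subtype
  exact le_ciInf fun z => h z z.2

theorem affine_le_moreau (hf : f ∈ convexFun n)
    (h : ∀ z ∈ effDom f, inner ℝ z y - b ≤ (f z).toReal) (hk : 1 ≤ k) (x : Euc n) :
    inner ℝ x y - ‖y‖ ^ 2 / 2 - b ≤ moreau f k x :=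
  le_moreau hf fun z hz => by
    have h1 := affine_le_moreau_aux (k := k) h x hz
    have h2 : 0 ≤ (k - 1) / 2 * ‖x - z‖ ^ 2 := mul_nonneg (by linarith) (by positivity)
    linarith

theorem moreau_le_self (hf : f ∈ convexFun n)
    (h : ∀ z ∈ effDom f, inner ℝ z y - b ≤ (f z).toReal) (hk : 1 ≤ k) (x : Euc n) :
    (moreau f k x : EReal) ≤ f x := by
  by_cases hx : x ∈ effDom f
  · rw [← coe_toReal_of_mem_effDom hf hx, EReal.coe_le_coe_iff]
    simpa using moreau_le h hk x hx
  · rw [eq_top_of_notMem_effDom hx]; exact le_top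

theorem convexOn_moreau (hf : f ∈ convexFun n)
    (h : ∀ z ∈ effDom f, inner ℝ z y - b ≤ (f z).toReal) (hk : 1 ≤ k) :
    ConvexOn ℝ Set.univ (moreau f k) := by
  have := (effDom_nonempty hf).to_subtype
  have hsq : ConvexOn ℝ Set.univ fun x : Euc n => ‖x‖ ^ 2 :=
    convexOn_univ_norm.pow (fun _ _ => norm_nonneg _) 2
  refine ⟨convex_univ, fun x₁ _ x₂ _ s t hs ht hst => le_of_forall_pos_le_add fun δ hδ => ?_⟩
  obtain ⟨⟨z₁, hz₁⟩, h₁⟩ := exists_lt_of_ciInf_lt (lt_add_of_pos_right (moreau f k x₁) hδ)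
  obtain ⟨⟨z₂, hz₂⟩, h₂⟩ := exists_lt_of_ciInf_lt (lt_add_of_pos_right (moreau f k x₂) hδ)
  have hu := convexOn_effDom hf
  have e := moreau_le h hk (s • x₁ + t • x₂) (hu.1 hz₁ hz₂ hs ht hst)
  have e1 := hu.2 hz₁ hz₂ hs ht hst
  have e2 := hsq.2 (Set.mem_univ (x₁ - z₁)) (Set.mem_univ (x₂ - z₂)) hs ht hst
  have e3 : s • x₁ + t • x₂ - (s • z₁ + t • z₂) = s • (x₁ - z₁) + t • (x₂ - z₂) := by module
  rw [e3] at e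
  simp only [smul_eq_mul] at *
  have e4 := mul_le_mul_of_nonneg_left e2 (show 0 ≤ k / 2 by linarith)
  have e5 := mul_le_mul_of_nonneg_left h₁.le hs
  have e6 := mul_le_mul_of_nonneg_left h₂.le ht
  have e7 : s * (moreau f k x₁ + δ) + t * (moreau f k x₂ + δ) =
      s * moreau f k x₁ + t * moreau f k x₂ + δ := by linear_combination δ * hst
  linarith

theorem moreau_comp_isometry (hf : f ∈ convexFun n)
    (h : ∀ z ∈ effDom f, inner ℝ z y - b ≤ (f z).toReal) (hk : 1 ≤ k) (σ : Euc n ≃ₗᵢ[ℝ] Euc n)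
    (hσ : ∀ x, f (σ x) = f x) (x : Euc n) : moreau f k (σ x) = moreau f k x := by
  have hmem : ∀ z, σ z ∈ effDom f ↔ z ∈ effDom f := fun z => by
    simp only [effDom, Set.mem_ofPred_eq, hσ]
  refine le_antisymm (le_moreau hf fun z hz => ?_) (le_moreau hf fun z hz => ?_)
  · have := moreau_le h hk (σ x) ((hmem z).2 hz)
    rwa [hσ, ← map_sub, σ.norm_map] at this
  · obtain ⟨w, rfl⟩ := σ.surjective z
    rw [hσ, ← map_sub, σ.norm_map]
    exact moreau_le h hk x ((hmem w).1 hz)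

/-- Near `x` lower semicontinuity keeps `f` above any level below `f x`; away from `x` the growing
penalty beats the affine minorant. -/
theorem tendsto_moreau (hf : f ∈ convexFun n)
    (h : ∀ z ∈ effDom f, inner ℝ z y - b ≤ (f z).toReal) (x : Euc n) :
    Filter.Tendsto (fun k : ℕ => (moreau f (k + 1) x : EReal)) Filter.atTop (nhds (f x)) := by
  have hk1 : ∀ k : ℕ, (1 : ℝ) ≤ k + 1 := fun k => by simp
  refine tendsto_order.2 ⟨fun l hl => ?_, fun l hl =>
    .of_forall fun k => (moreau_le_self hf h (hk1 k) x).trans_lt hl⟩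
  obtain ⟨M, hlM, hM⟩ := EReal.lt_iff_exists_real_btwn.1 hl
  obtain ⟨δ, hδ, hball⟩ := Metric.eventually_nhds_iff_ball.1 (hf.1 x M hM)
  obtain ⟨N, hN⟩ := exists_nat_gt ((M - (inner ℝ x y - ‖y‖ ^ 2 / 2 - b)) / (δ ^ 2 / 2))
  rw [div_lt_iff₀ (by positivity)] at hN
  filter_upwards [Filter.eventually_ge_atTop N] with k hk
  refine hlM.trans_le (EReal.coe_le_coe_iff.2 (le_moreau hf fun z hz => ?_))
  by_cases hz' : z ∈ Metric.ball x δ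
  · have h1 : (M : EReal) < f z := hball z hz'
    rw [← coe_toReal_of_mem_effDom hf hz, EReal.coe_lt_coe_iff] at h1
    have : 0 ≤ ((k : ℝ) + 1) / 2 * ‖x - z‖ ^ 2 := by positivity
    linarith
  · rw [Metric.mem_ball, not_lt, dist_comm, dist_eq_norm] at hz'
    have h1 := affine_le_moreau_aux (k := k + 1) h x hz
    have hk' : (N : ℝ) ≤ k := by exact_mod_cast hk
    have h2 : (N : ℝ) * (δ ^ 2 / 2) ≤ (k + 1 - 1) / 2 * ‖x - z‖ ^ 2 := by
      have : δ ^ 2 ≤ ‖x - z‖ ^ 2 := by gcongr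
      calc (N : ℝ) * (δ ^ 2 / 2) ≤ k * (‖x - z‖ ^ 2 / 2) := by gcongr
        _ = _ := by ring
    linarith

theorem le_moreau_add_sq (hf : f ∈ convexFun n)
    (h : ∀ z ∈ effDom f, inner ℝ z y - b ≤ (f z).toReal) (hk : 1 ≤ k) {a : ℝ} (ha : 0 < a)
    (x : Euc n) : a / 2 * ‖x‖ ^ 2 - ((4 * (a / 2))⁻¹ * ‖y‖ ^ 2 + ‖y‖ ^ 2 / 2 + b) ≤
      moreau f k x + a * ‖x‖ ^ 2 := by
  have h1 := affine_le_moreau hf h hk x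
  have h2 := inner_le_quad (half_pos ha) (-x) y
  rw [inner_neg_left, norm_neg] at h2
  linarith

/-- A single competitor `z` in the infimum gives the quadratic upper bound, and `a|x|²` beats the
affine minorant. -/
theorem nice_moreau_add_sq (hf : f ∈ convexFun n)
    (h : ∀ z ∈ effDom f, inner ℝ z y - b ≤ (f z).toReal) (hk : 1 ≤ k) {a : ℝ} (ha : 0 < a) :
    Nice fun x => moreau f k x + a * ‖x‖ ^ 2 := by
  refine ⟨(convexOn_moreau hf h hk).add ((convexOn_univ_norm.pow (fun _ _ => norm_nonneg _) 2).smul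
    ha.le), ⟨a / 2, _, half_pos ha, le_moreau_add_sq hf h hk ha⟩, ?_⟩
  obtain ⟨z, hz⟩ := effDom_nonempty hf
  refine ⟨|(f z).toReal| + k * ‖z‖ ^ 2 + k + a, fun x => ?_⟩
  have h1 := moreau_le h hk x hz
  have h2 : ‖x - z‖ ^ 2 ≤ 2 * ‖x‖ ^ 2 + 2 * ‖z‖ ^ 2 := by
    nlinarith [norm_sub_le x z, sq_nonneg (‖x‖ - ‖z‖), norm_nonneg (x - z)]
  have h3 : k / 2 * ‖x - z‖ ^ 2 ≤ k / 2 * (2 * ‖x‖ ^ 2 + 2 * ‖z‖ ^ 2) := by gcongr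
  have h4 : 0 ≤ (|(f z).toReal| + k * ‖z‖ ^ 2) * ‖x‖ ^ 2 := by positivity
  nlinarith [le_abs_self (f z).toReal]

end Moreau

/-! ### From transport-entropy to inverse Santaló by approximation -/

section Approximation

variable {n : ℕ}

/-- The invariance of the measures used for nice functions. -/
theorem smooth_momentMeasure_mem {H : Subgroup (Fin n → ℤˣ)} {F : Euc n → ℝ} (hF : Nice F)
    (hinv : ∀ ε ∈ H, ∀ x, F (signFlip ε x) = F x) {ε : ℝ} (hε : |ε| ≤ 1) :
    smooth ε (momentMeasure F) ∈ measureClass H := by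
  have := hF.isProbabilityMeasure
  refine ⟨mem_P2 (integrable_sq_smooth hF.integrable_sq_momentMeasure hε), fun s hs => ?_⟩
  exact map_smooth (signIso s) (map_momentMeasure (signIso s) (hinv s hs)) ε

theorem tendsto_lintegral_exp_neg {F : ℕ → Euc n → EReal} {F' : Euc n → EReal} {B : Euc n → ℝ}
    (hm : ∀ k, Measurable (F k)) (hB : ∀ k x, (B x : EReal) ≤ F k x)
    (hfin : ∫⁻ x, ENNReal.ofReal (Real.exp (-B x)) ≠ ∞)
    (hlim : ∀ x, Filter.Tendsto (fun k => F k x) Filter.atTop (nhds (F' x))) :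
    Filter.Tendsto (fun k => intExpNeg (F k)) Filter.atTop (nhds (intExpNeg F')) := by
  refine tendsto_lintegral_of_dominated_convergence _
    (fun k => continuous_exp_neg.measurable.comp (hm k)) (fun k => .of_forall fun x => ?_) hfin
    (.of_forall fun x => (continuous_exp_neg.tendsto _).comp (hlim x))
  rw [← EReal.exp_coe, EReal.coe_neg]
  exact EReal.exp_monotone (EReal.neg_le_neg_iff.2 (hB k x))

/-- The quadratic perturbation of an extended-valued function. -/
noncomputable def addSq (f : Euc n → EReal) (a : ℝ) (x : Euc n) : EReal :=
  f x + ((a * ‖x‖ ^ 2 : ℝ) : EReal)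

theorem le_addSq (f : Euc n → EReal) {a : ℝ} (ha : 0 ≤ a) (x : Euc n) : f x ≤ addSq f a x :=
  le_add_of_nonneg_right (EReal.coe_nonneg.2 (by positivity))

theorem coe_le_legendre_addSq {f : Euc n → EReal} (hf : f ∈ convexFun n) {x : Euc n}
    (hx : x ∈ effDom f) (a : ℝ) (y : Euc n) :
    ((inner ℝ x y - ((f x).toReal + a * ‖x‖ ^ 2) : ℝ) : EReal) ≤ legendre (addSq f a) y := by
  rw [EReal.coe_sub, EReal.coe_add, coe_toReal_of_mem_effDom hf hx]
  exact le_iSup (fun x => ((inner ℝ x y : ℝ) : EReal) - addSq f a x) x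

theorem norm_le_legendre_addSq {f : Euc n → EReal} (hf : f ∈ convexFun n) {r C : ℝ} (hr : 0 < r)
    (h : ∀ x, ‖x‖ ≤ r → x ∈ effDom f ∧ (f x).toReal ≤ C) {a : ℝ} (ha : a ≤ 1) (y : Euc n) :
    ((r * ‖y‖ - (C + r ^ 2) : ℝ) : EReal) ≤ legendre (addSq f a) y := by
  -- The point of the ball of radius `r` furthest in the direction of `y`; for `y = 0` it is `0`,
  -- which serves as well.
  set x := (r / ‖y‖) • y with hx
  have hxr : ‖x‖ ≤ r := by
    rw [hx, norm_smul, Real.norm_eq_abs, abs_of_nonneg (by positivity)]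
    rcases eq_or_ne ‖y‖ 0 with h0 | h0
    · simp [h0, hr.le]
    · rw [div_mul_cancel₀ _ h0]
  have hin : inner ℝ x y = r * ‖y‖ := by
    rw [hx, real_inner_smul_left, real_inner_self_eq_norm_sq]
    rcases eq_or_ne ‖y‖ 0 with h0 | h0
    · simp [h0]
    · field_simp
  obtain ⟨h1, h2⟩ := h x hxr
  refine le_trans ?_ (coe_le_legendre_addSq hf h1 a y)
  rw [EReal.coe_le_coe_iff, hin]
  have h3 : ‖x‖ ^ 2 ≤ r ^ 2 := by gcongr
  have h4 : a * ‖x‖ ^ 2 ≤ 1 * ‖x‖ ^ 2 := by gcongr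
  linarith

/-- The perturbation only lowers the transform, and it changes each competitor in the supremum by
`a|x|²`, which tends to `0`. -/
theorem tendsto_legendre_addSq {f : Euc n → EReal} (hf : f ∈ convexFun n) {a : ℕ → ℝ}
    (ha : ∀ m, 0 ≤ a m) (hlim : Filter.Tendsto a Filter.atTop (nhds 0)) (y : Euc n) :
    Filter.Tendsto (fun m => legendre (addSq f (a m)) y) Filter.atTop (nhds (legendre f y)) := by
  refine tendsto_order.2 ⟨fun l hl => ?_, fun l hl =>
    .of_forall fun m => (legendre_anti (le_addSq f (ha m)) y).trans_lt hl⟩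
  obtain ⟨x, hx⟩ := lt_iSup_iff.1 hl
  have hxD : x ∈ effDom f := by
    intro h
    rw [h, EReal.sub_top] at hx
    exact not_lt_bot hx
  rw [← coe_toReal_of_mem_effDom hf hxD, ← EReal.coe_sub] at hx
  have h1 : Filter.Tendsto (fun m => ((inner ℝ x y - ((f x).toReal + a m * ‖x‖ ^ 2) : ℝ) : EReal))
      Filter.atTop (nhds ((inner ℝ x y - ((f x).toReal + 0 * ‖x‖ ^ 2) : ℝ) : EReal)) :=
    continuous_coe_real_ereal.continuousAt.tendsto.comp
      (((hlim.mul_const _).const_add _).const_sub _)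
  rw [zero_mul, add_zero] at h1
  filter_upwards [h1.eventually (lt_mem_nhds hx)] with m hm
  exact hm.trans_le (coe_le_legendre_addSq hf hxD (a m) y)

/-- The approximants satisfy `F k ≤ f + a|x|²`, so their transforms dominate that of `f + a|x|²`;
only the first factor needs a limit in `k`. -/
theorem le_mul_legendre_addSq {H : Subgroup (Fin n → ℤˣ)} {c : ℝ} (hc : 0 < c)
    (h : ∀ ν₁ ∈ measureClass H, ∀ ν₂ ∈ measureClass H, G ν₁ ν₂ ≥
      (⨅ η₁ ∈ measureClass H, G η₁ ν₂) + (⨅ η₂ ∈ measureClass H, G ν₁ η₂) +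
      ((n * Real.log (c / (2 * Real.pi)) : ℝ) : EReal))
    {f : Euc n → EReal} (hf : f ∈ convexClass H) (hpos : 0 < intExpNeg (legendre f)) {a : ℝ}
    (ha : 0 < a) (hfin : intExpNeg (legendre (addSq f a)) ≠ ∞) :
    ENNReal.ofReal (c ^ n) ≤ intExpNeg f * intExpNeg (legendre (addSq f a)) := by
  obtain ⟨hf, hinv⟩ := hf
  obtain ⟨y, b, hmin⟩ := exists_affine_minorant hf hpos
  have hk1 : ∀ k : ℕ, (1 : ℝ) ≤ k + 1 := fun k => by simp
  set F : ℕ → Euc n → ℝ := fun k x => moreau f (k + 1) x + a * ‖x‖ ^ 2 with hF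
  have nice : ∀ k, Nice (F k) := fun k => nice_moreau_add_sq hf hmin (hk1 k) ha
  have Finv : ∀ k, ∀ ε ∈ H, ∀ x, F k (signFlip ε x) = F k x := fun k ε hε x => by
    have := moreau_comp_isometry hf hmin (hk1 k) (signIso ε) (hinv ε hε) x
    rw [coe_signIso] at this
    simp only [hF, norm_signFlip, this]
  have hle : ∀ k x, (F k x : EReal) ≤ addSq f a x := fun k x => by
    simp only [hF, addSq, EReal.coe_add]
    exact add_le_add_left (moreau_le_self hf hmin (hk1 k) x) _
  have ineq : ∀ k, ENNReal.ofReal (c ^ n) ≤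
      intExpNeg (fun x => (F k x : EReal)) * intExpNeg (legendre (addSq f a)) := fun k => by
    refine (nice_inverse_santalo hc (fun _ hν => hν.1) h (nice k)
      (fun ε hε => smooth_momentMeasure_mem (nice k) (Finv k) hε)
      (fun ε hε => smooth_momentMeasure_mem (nice k).conj (fun s hs =>
        conj_comp_isometry (signIso s) (Finv k s hs)) hε)).trans ?_
    refine mul_le_mul_right (lintegral_mono fun x => ?_) _
    exact EReal.exp_monotone (EReal.neg_le_neg_iff.2 (legendre_anti (hle k) x))
  have lim : Filter.Tendsto (fun k => intExpNeg fun x => (F k x : EReal)) Filter.atTop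
      (nhds (intExpNeg (addSq f a))) := by
    refine tendsto_lintegral_exp_neg
      (B := fun x => a / 2 * ‖x‖ ^ 2 - ((4 * (a / 2))⁻¹ * ‖y‖ ^ 2 + ‖y‖ ^ 2 / 2 + b))
      (fun k => (nice k).continuous.measurable.coe_real_ereal)
      (fun k x => EReal.coe_le_coe_iff.2 (le_moreau_add_sq hf hmin (hk1 k) ha x)) ?_ fun x => ?_
    · exact (integrable_exp_of_le (by fun_prop) (half_pos ha)
        (C := (4 * (a / 2))⁻¹ * ‖y‖ ^ 2 + ‖y‖ ^ 2 / 2 + b) fun x => by linarith).lintegral_lt_top.ne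
    · simp only [hF, addSq, EReal.coe_add]
      exact (EReal.continuousAt_add (.inr (EReal.coe_ne_bot _)) (.inr (EReal.coe_ne_top _))).tendsto.comp
        ((tendsto_moreau hf hmin x).prodMk_nhds tendsto_const_nhds)
  refine (ge_of_tendsto' (ENNReal.Tendsto.mul_const lim (.inr hfin)) ineq).trans ?_
  refine mul_le_mul_left (lintegral_mono fun x => ?_) _
  exact EReal.exp_monotone (EReal.neg_le_neg_iff.2 (le_addSq f ha.le x))

/-- The transport-entropy inequality implies the inverse Santaló inequality. -/
theorem invSantaloOn_of_transport_entropy {H : Subgroup (Fin n → ℤˣ)} {c : ℝ} (hc : 0 < c)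
    (h : ∀ ν₁ ∈ measureClass H, ∀ ν₂ ∈ measureClass H, G ν₁ ν₂ ≥
      (⨅ η₁ ∈ measureClass H, G η₁ ν₂) + (⨅ η₂ ∈ measureClass H, G ν₁ η₂) +
      ((n * Real.log (c / (2 * Real.pi)) : ℝ) : EReal)) : InvSantaloOn (convexClass H) c := by
  intro f hf hpos hpos'
  by_cases h1 : intExpNeg f = ∞
  · rw [h1, ENNReal.top_mul hpos'.ne']; exact le_top
  by_cases h2 : intExpNeg (legendre f) = ∞
  · rw [h2, ENNReal.mul_top hpos.ne']; exact le_top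
  -- A bound for `f` on a ball around `0` gives all the perturbed transforms the common lower bound
  -- `r|y| - (C + r²)`, which dominates the limit `a → 0`.
  obtain ⟨r, hr, C, hC⟩ := exists_ball_bound hf.1 (zero_mem_interior_effDom hf.1 hpos hpos' h2)
  set a : ℕ → ℝ := fun m => 1 / ((m : ℝ) + 1) with ha
  have ha0 : ∀ m, 0 < a m := fun m => Nat.one_div_pos_of_nat
  have ha1 : ∀ m, a m ≤ 1 := fun m => by
    rw [ha, div_le_one (by positivity)]; simp
  have hB := lintegral_exp_neg_norm_ne_top (n := n) hr (C + r ^ 2)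
  have hB' : ∫⁻ x : Euc n, ENNReal.ofReal (Real.exp (-(r * ‖x‖ - (C + r ^ 2)))) ≠ ∞ := by
    simpa only [neg_sub] using hB
  have hle := fun m x => norm_le_legendre_addSq hf.1 hr hC (ha1 m) x
  have fin : ∀ m, intExpNeg (legendre (addSq f (a m))) ≠ ∞ := fun m => by
    refine ne_top_of_le_ne_top hB' (lintegral_mono fun x => ?_)
    rw [← EReal.exp_coe, EReal.coe_neg]
    exact EReal.exp_monotone (EReal.neg_le_neg_iff.2 (hle m x))
  have lim := tendsto_lintegral_exp_neg (fun m => measurable_legendre (addSq f (a m))) hle hB'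
    (tendsto_legendre_addSq hf.1 (fun m => (ha0 m).le) tendsto_one_div_add_atTop_nhds_zero_nat)
  exact ge_of_tendsto' (ENNReal.Tendsto.const_mul lim (.inr h1)) fun m =>
    le_mul_legendre_addSq hc h hf hpos' (ha0 m) (fin m)

end Approximation

end InvSantalo

namespace InvSantalo

/-! ### The trivial, central and full groups of sign changes -/

section Classes

variable {n : ℕ}

theorem convexClass_bot : convexClass (⊥ : Subgroup (Fin n → ℤˣ)) = convexFun n := by
  ext f
  refine ⟨fun h => h.1, fun h => ⟨h, fun ε hε x => ?_⟩⟩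
  rw [Subgroup.mem_bot.1 hε, signFlip_one]

theorem measureClass_bot : measureClass (⊥ : Subgroup (Fin n → ℤˣ)) = P2 n := by
  ext ν
  refine ⟨fun h => h.1, fun h => ⟨h, fun ε hε => ?_⟩⟩
  rw [Subgroup.mem_bot.1 hε, show (signFlip 1 : Euc n → Euc n) = id from funext signFlip_one,
    Measure.map_id]

variable (n) in
/-- The group `{1, -1}` of central symmetries. -/
def centralSigns : Subgroup (Fin n → ℤˣ) := Subgroup.zpowers (-1)

theorem signFlip_neg_one (x : Euc n) : signFlip (-1) x = -x := by
  ext i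
  simp [signFlip]

theorem mem_centralSigns {ε : Fin n → ℤˣ} (hε : ε ∈ centralSigns n) : ε = 1 ∨ ε = -1 := by
  obtain ⟨k, rfl⟩ := Subgroup.mem_zpowers_iff.1 hε
  rcases Int.even_or_odd k with h | h
  · exact .inl h.neg_one_zpow
  · exact .inr h.neg_one_zpow

theorem convexClass_centralSigns : convexClass (centralSigns n) = symmConvexFun n := by
  ext f
  refine ⟨fun h => ⟨h.1, fun x => ?_⟩, fun h => ⟨h.1, fun ε hε x => ?_⟩⟩
  · rw [← signFlip_neg_one]
    exact h.2 _ (Subgroup.mem_zpowers _) x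
  · rcases mem_centralSigns hε with rfl | rfl
    · rw [signFlip_one]
    · rw [signFlip_neg_one, h.2]

theorem measureClass_centralSigns : measureClass (centralSigns n) = P2symm n := by
  have e : (signFlip (-1) : Euc n → Euc n) = fun x => -x := funext signFlip_neg_one
  ext ν
  refine ⟨fun h => ⟨h.1, ?_⟩, fun h => ⟨h.1, fun ε hε => ?_⟩⟩
  · rw [← e]
    exact h.2 _ (Subgroup.mem_zpowers _)
  · rcases mem_centralSigns hε with rfl | rfl
    · rw [show (signFlip 1 : Euc n → Euc n) = id from funext signFlip_one, Measure.map_id]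
    · rw [e, h.2]

theorem convexClass_top : convexClass (⊤ : Subgroup (Fin n → ℤˣ)) = uncondConvexFun n := by
  ext f
  simp [convexClass, uncondConvexFun]

theorem measureClass_top : measureClass (⊤ : Subgroup (Fin n → ℤˣ)) = P2uncond n := by
  ext ν
  simp [measureClass, P2uncond]

/-- The duality between inverse Santaló and transport-entropy inequalities, in the class of
functions and measures invariant under a group of sign changes. -/
theorem invSantaloOn_iff_transport_entropy (H : Subgroup (Fin n → ℤˣ)) {c : ℝ} (hc : 0 < c) :
    InvSantaloOn (convexClass H) c ↔ ∀ ν₁ ∈ measureClass H, ∀ ν₂ ∈ measureClass H, G ν₁ ν₂ ≥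
      (⨅ η₁ ∈ measureClass H, G η₁ ν₂) + (⨅ η₂ ∈ measureClass H, G ν₁ η₂) +
      ((n * Real.log (c / (2 * Real.pi)) : ℝ) : EReal) :=
  ⟨fun h _ h₁ _ h₂ => transport_entropy_of_invSantaloOn hc h h₁ h₂,
    invSantaloOn_of_transport_entropy hc⟩

end Classes

end InvSantalo

theorem theorem3p7 (n : ℕ) (hn : 1 ≤ n) (c : ℝ) (hc : 0 < c) :
    (InvSantalo.IS n c ↔
      ∀ ν₁ ∈ InvSantalo.P2 n, ∀ ν₂ ∈ InvSantalo.P2 n,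
        InvSantalo.G ν₁ ν₂ ≥
          (⨅ η₁ ∈ InvSantalo.P2 n, InvSantalo.G η₁ ν₂)
            + (⨅ η₂ ∈ InvSantalo.P2 n, InvSantalo.G ν₁ η₂)
            + ((n * Real.log (c / (2 * Real.pi)) : ℝ) : EReal)) ∧
    (InvSantalo.ISsymm n c ↔
      ∀ ν₁ ∈ InvSantalo.P2symm n, ∀ ν₂ ∈ InvSantalo.P2symm n,
        InvSantalo.G ν₁ ν₂ ≥
          (⨅ η₁ ∈ InvSantalo.P2symm n, InvSantalo.G η₁ ν₂)
            + (⨅ η₂ ∈ InvSantalo.P2symm n, InvSantalo.G ν₁ η₂)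
            + ((n * Real.log (c / (2 * Real.pi)) : ℝ) : EReal)) ∧
    (InvSantalo.ISuncond n c ↔
      ∀ ν₁ ∈ InvSantalo.P2uncond n, ∀ ν₂ ∈ InvSantalo.P2uncond n,
        InvSantalo.G ν₁ ν₂ ≥
          (⨅ η₁ ∈ InvSantalo.P2uncond n, InvSantalo.G η₁ ν₂)
            + (⨅ η₂ ∈ InvSantalo.P2uncond n, InvSantalo.G ν₁ η₂)
            + ((n * Real.log (c / (2 * Real.pi)) : ℝ) : EReal)) := by
  refine ⟨?_, ?_, ?_⟩
  · simpa only [InvSantalo.IS, InvSantalo.convexClass_bot, InvSantalo.measureClass_bot] using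
      InvSantalo.invSantaloOn_iff_transport_entropy (n := n) ⊥ hc
  · simpa only [InvSantalo.ISsymm, InvSantalo.convexClass_centralSigns,
      InvSantalo.measureClass_centralSigns] using
      InvSantalo.invSantaloOn_iff_transport_entropy (InvSantalo.centralSigns n) hc
  · simpa only [InvSantalo.ISuncond, InvSantalo.convexClass_top, InvSantalo.measureClass_top] using
      InvSantalo.invSantaloOn_iff_transport_entropy (n := n) ⊤ hc
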